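/- Setting. For every sample size $n\ge 3$ let $p=p_n\in\mathbb N$ and let $X_1,\dots,X_n$ be independent draws from a law on $\mathbb R^{p}$ that is transelliptical $\mathrm{TE}_p(\Sigma,r;g_1,\dots,g_p)$: its coordinates have continuous distributions, $g_1,\dots,g_p$ are monotone functions $\mathbb R\to\mathbb R$, and $(g_1(X_{i1}),\dots,g_p(X_{ip}))$ has the law of $rAU$, where $U$ is uniform on the unit sphere of $\mathbb R^p$, $r\ge 0$ is independent of $U$, has a density and $\mathbb E(r^2)<\infty$, and $A\in\mathbb R^{p\times p}$ satisfies $AA^T=\Sigma$, with $\Sigma=(\rho_{jj'})$ positive definite with unit diagonal. The law, $\Sigma$, $r$ and the $g_j$ may depend on $n$. Put $$\mathcal E=\{(j,j'):j<j',(\Sigma^{-1})_{jj'}\ne0\},\quad \mathcal E^c=\{(j,j'):j<j',(\Sigma^{-1})_{jj'}=0\},\quad \mathcal E_j=\{j'\neq j:(\Sigma^{-1})_{jj'}\ne0\}.$$ Let $s_{ii'}=\mathrm{sign}\big((X_{ij}-X_{i'j})(X_{ij'}-X_{i'j'})\big)$ and $$\widehat\tau_{jj'}=\frac{2}{n(n-1)}\sum_{1\le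 i\le i'\le n}s_{ii'},\qquad \widehat S_{jj'}=\sin\Big(\frac\pi2\widehat\tau_{jj'}\Big)\ (j\ne j'),\qquad \widehat S_{jj}=1,$$ $$\widehat\omega_{jj'}^2=\frac{4(n-1)}{(n-2)^2}\sum_{i'=1}^n\Big[\frac1{n-1}\sum_{i\neq i'}s_{ii'}-\widehat\tau_{jj'}\Big]^2,\qquad \gamma_{n,jj'}=\frac\pi2\,\widehat\omega_{jj'}\,\Phi^{-1}\Big(1-\frac{f_n}{p(p-1)}\Big)\Big/\sqrt n ,$$ with $\widehat\omega_{jj'}\ge 0$ and $\Phi$ the standard normal distribution function, and $$\widehat{\mathcal E}=\{(j,j'):j<j',|\widehat S_{jj'}|>\gamma_{n,jj'}\},\qquad \widehat{\mathcal E}_j=\{j'\ne j:|\widehat S_{jj'}|>\gamma_{n,jj'}\}.$$ Theorem. Let $C_1>0$, $0<\kappa<1/2$, $C_3>0$, $0<\xi<1-2\kappa$, $f_0>0$, and let $\log p_n\sim C_3n^{\xi}$ as $n\to\infty$. There are constants $C_4,C_5>0$, depending only on $C_1,\kappa,C_3,\xi,f_0$ and the sequence $(p_n)$, such that the following holds for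 every sequence of transelliptical laws as above and every sequence $(f_n)$ (for instance a constant one) with $f_n\ge f_0$ for all $n$ and $f_n<p_n(p_n-1)/2$ for all large $n$. Suppose that 1. $|\rho_{jj'}|\ge C_1n^{-\kappa}$ for all $(j,j')\in\mathcal E$ and all $n\ge3$; 2. for some constants $\alpha\ge0$, $C_2>0$, the largest eigenvalue of $\Sigma$ is at most $C_2n^{\alpha}$ for all $n\ge3$; 3. $\max_{(j,j')\in\mathcal E^c}|\rho_{jj'}|=o\big(n^{-(1-\xi)/2}\big)$. Then the expected false positive rate is asymptotically controlled at $f_n/|\mathcal E^c|$: for every $\varepsilon>0$ and all sufficiently large $n$, $$\mathbb E\left(\frac{|\widehat{\mathcal E}\cap\mathcal E^c|}{|\mathcal E^c|}\right)\le\frac{f_n}{|\mathcal E^c|}+\varepsilon .$$ Moreover, with the same thresholds, sure screening holds: for all $n\ge3$ and all $j\in\{1,\dots,p_n\}$, $$\Pr(\mathcal E\subseteq\widehat{\mathcal E})\ge1-C_4\exp(-C_5n^{1-2\kappa}),\qquad \Pr(\mathcal E_j\subseteq\widehat{\mathcal E}_j)\ge1-C_4\exp(-C_5n^{1-2\kappa}).$$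 -/

import Mathlib

open MeasureTheory ProbabilityTheory Filter Topology Asymptotics

noncomputable section

namespace Grass

/-! ### Elliptical and transelliptical laws -/

/-- The uniform distribution on the unit sphere of `ℝ^p`, as a measure on `ℝ^p`: the normalized
surface measure. -/
def uniformSphere (p : ℕ) : Measure (EuclideanSpace ℝ (Fin p)) :=
  (((volume : Measure (EuclideanSpace ℝ (Fin p))).toSphere Set.univ)⁻¹ •
    (volume : Measure (EuclideanSpace ℝ (Fin p))).toSphere).map Subtype.val

/-- The law of `m + r A U`, where `r` has law `ν`, `U` is uniform on the unit sphere and `r`, `U`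
are independent. -/
def ellipticalLaw {p : ℕ} (m : Fin p → ℝ) (A : Matrix (Fin p) (Fin p) ℝ) (ν : Measure ℝ) :
    Measure (Fin p → ℝ) :=
  (ν.prod (uniformSphere p)).map fun x => m + x.1 • A.mulVec x.2.ofLp

/-- `P` is the elliptical law `EC_p(m, S, r)`, where `r` has law `ν` and `S` has full rank `p`,
unit diagonal, `r ≥ 0`, `r` has a density and a finite second moment. -/
structure IsElliptical {p : ℕ} (P : Measure (Fin p → ℝ)) (m : Fin p → ℝ)
    (S : Matrix (Fin p) (Fin p) ℝ) (ν : Measure ℝ) : Prop where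
  posDef : S.PosDef
  diag_eq_one : ∀ j, S j j = 1
  isProbabilityMeasure_radius : IsProbabilityMeasure ν
  radius_nonneg : ∀ᵐ r ∂ν, 0 ≤ r
  radius_density : ν ≪ volume
  radius_sq : Integrable (fun r : ℝ => r ^ 2) ν
  representation : ∃ A : Matrix (Fin p) (Fin p) ℝ, A * A.transpose = S ∧ P = ellipticalLaw m A ν

/-- `P` is the transelliptical law `TE_p(S, r; g_1, …, g_p)`, where `r` has law `ν`: the
coordinates of `P` are continuous and `(g_1(X_1), …, g_p(X_p))` is `EC_p(0, S, r)` for `X ∼ P`.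
The condition `Pr(r = 0) = 0` is part of `r` having a density. -/
structure IsTranselliptical {p : ℕ} (P : Measure (Fin p → ℝ))
    (S : Matrix (Fin p) (Fin p) ℝ) (ν : Measure ℝ) (g : Fin p → ℝ → ℝ) : Prop where
  isProbabilityMeasure : IsProbabilityMeasure P
  continuous_marginal : ∀ j t, P {x | x j = t} = 0
  monotone : ∀ j, Monotone (g j) ∨ Antitone (g j)
  elliptical : IsElliptical (P.map fun x j => g j (x j)) 0 S ν

/-- The law of `n` independent draws from `P`; `X i j` is the `j`th variable in the `i`th draw. -/
def sampleLaw {p : ℕ} (P : Measure (Fin p → ℝ)) (n : ℕ) : Measure (Fin n → Fin p → ℝ) :=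
  Measure.pi fun _ => P

/-! ### The partial correlation graph -/

open Classical in
/-- The edge set: pairs `j < j'` with `(S⁻¹)_{jj'} ≠ 0`. -/
def edges {p : ℕ} (S : Matrix (Fin p) (Fin p) ℝ) : Finset (Fin p × Fin p) :=
  Finset.univ.filter fun e => e.1 < e.2 ∧ S⁻¹ e.1 e.2 ≠ 0

open Classical in
/-- The set of non-edges: pairs `j < j'` with `(S⁻¹)_{jj'} = 0`. -/
def nonEdges {p : ℕ} (S : Matrix (Fin p) (Fin p) ℝ) : Finset (Fin p × Fin p) :=
  Finset.univ.filter fun e => e.1 < e.2 ∧ S⁻¹ e.1 e.2 = 0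

open Classical in
/-- The neighborhood of the node `j`. -/
def neighborhood {p : ℕ} (S : Matrix (Fin p) (Fin p) ℝ) (j : Fin p) : Finset (Fin p) :=
  Finset.univ.filter fun k => k ≠ j ∧ S⁻¹ j k ≠ 0

/-! ### The estimators -/

section Estimators

variable {n p : ℕ}

/-- The Kendall kernel `sign((X_{ij} - X_{i'j})(X_{ij'} - X_{i'j'}))`. -/
def concordance (X : Fin n → Fin p → ℝ) (j j' : Fin p) (i i' : Fin n) : ℝ :=
  Real.sign ((X i j - X i' j) * (X i j' - X i' j'))

/-- The sample version of Kendall's tau. -/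
def kendallTau (X : Fin n → Fin p → ℝ) (j j' : Fin p) : ℝ :=
  2 / ((n : ℝ) * ((n : ℝ) - 1)) *
    ∑ e ∈ Finset.univ.filter (fun e : Fin n × Fin n => e.1 ≤ e.2), concordance X j j' e.1 e.2

/-- The correlation estimator `sin(π τ̂ / 2)`, with unit diagonal. -/
def corrEstimator (X : Fin n → Fin p → ℝ) (j j' : Fin p) : ℝ :=
  if j = j' then 1 else Real.sin (Real.pi / 2 * kendallTau X j j')

/-- The jackknife estimator of the asymptotic variance of Kendall's tau. -/
def jackknifeVar (X : Fin n → Fin p → ℝ) (j j' : Fin p) : ℝ :=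
  4 * ((n : ℝ) - 1) / ((n : ℝ) - 2) ^ 2 *
    ∑ i' : Fin n, (1 / ((n : ℝ) - 1) * (∑ i ∈ Finset.univ.erase i', concordance X j j' i i')
      - kendallTau X j j') ^ 2

/-- The standard normal quantile function; on `(0, 1)` it is the inverse of the distribution
function. -/
def normalQuantile (u : ℝ) : ℝ :=
  sInf {x : ℝ | u ≤ cdf (gaussianReal 0 1) x}

/-- The threshold `(π/2) ω̂_{jj'} Φ⁻¹(1 - f / (p (p - 1))) / √n`. -/
def threshold (f : ℝ) (X : Fin n → Fin p → ℝ) (j j' : Fin p) : ℝ :=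
  Real.pi / 2 * Real.sqrt (jackknifeVar X j j') *
    normalQuantile (1 - f / ((p : ℝ) * ((p : ℝ) - 1))) / Real.sqrt n

open Classical in
/-- The estimated edge set, with thresholds `γ`. -/
def edgesHat (γ : Fin p → Fin p → ℝ) (X : Fin n → Fin p → ℝ) : Finset (Fin p × Fin p) :=
  Finset.univ.filter fun e => e.1 < e.2 ∧ γ e.1 e.2 < |corrEstimator X e.1 e.2|

open Classical in
/-- The estimated neighborhood of the node `j`, with thresholds `γ`. -/
def neighborhoodHat (γ : Fin p → Fin p → ℝ) (X : Fin n → Fin p → ℝ) (j : Fin p) :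
    Finset (Fin p) :=
  Finset.univ.filter fun k => k ≠ j ∧ γ j k < |corrEstimator X j k|

/-- The false positive rate `|Ê ∩ E^c| / |E^c|`. -/
def falsePositiveRate (S : Matrix (Fin p) (Fin p) ℝ) (γ : Fin p → Fin p → ℝ)
    (X : Fin n → Fin p → ℝ) : ℝ :=
  ((edgesHat γ X ∩ nonEdges S).card : ℝ) / ((nonEdges S).card : ℝ)

end Estimators

end Grass

end

/-! Kendall's tau is a U-statistic of order two whose kernel is bounded by 1. A monotone
transformation of a coordinate changes the kernel only by a global sign, up to ties of probability
zero. A transelliptical law may thus be replaced by that of `rAU`, and the population tau of a pair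
becomes the sign correlation of two linear forms `⟪a, ·⟫`, `⟪b, ·⟫` (two rows of `A`) of the
difference of two independent copies of `rU`. This difference is invariant under reflections, so
averaging over a circle gives `τ = ± (2/π) arcsin ρ`. Hence `|sin (π τ / 2)| = |ρ|` and `|τ| ≤ |ρ|`.

Sure screening is concentration. Hoeffding's inequality (`IsKernel.measureReal_abs_uStat_ge_le`) and
a union bound over the `p²` pairs show that every estimator is within `C₁ n^(-κ) / 2` of its target
in absolute value, outside an event of probability of order `p² exp (-2 C₅ n^(1-2κ))`. Since `ξ < 1
- 2κ`, half of the exponent absorbs `p²`. The jackknife variance is at most 100 and the normal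
quantile grows at most like a small multiple of `n^((1-2κ)/2)`, so the thresholds eventually stay
below `C₁ n^(-κ) / 2`. The finitely many remaining `n` are paid for by a large `C₄`.

For the false positives, call a pair good if `|ρ| ≤ 1/n`. Since `∑ ρ² = tr (Σ²) ≤ λ_max tr Σ ≤ C₂
n^α p`, at most a polynomial in `n` times `p` pairs can be edges or fail to be good, whereas there
are of order `p²` pairs and `p` outgrows every power of `n` (`card_filter_nonEdges_le`). The
non-edges that are not good are thus a negligible fraction of all non-edges. At a good pair `|τ| ≤
1/n`, which is negligible against `n^(-1/2)`; as `|sin x| ≤ |x|`, a false positive forces the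
studentized U-statistic beyond the normal quantile, which has probability at most `2 f / (p (p - 1))
+ ε`. Finally `2 f / (p (p - 1)) ≤ f / |E^c|`, because there are at most `p (p - 1) / 2` non-edges.

The last probability bound must be uniform in the law and in the pair
(`exists_measureReal_studentized_le`). It rests on Hoeffding's decomposition, on a rate for the
jackknife, on a central limit theorem uniform over bounded standardized laws, and on a lower bound
for the variance of the first projection of the Kendall kernel
(`IsIsotropic.le_projVar_signKernel`). For the lower bound, the projection is tested against the
sign of the product of two orthogonal coordinates; reflections and a pigeonhole argument in three
orthogonal directions bound the resulting correlation from below. -/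

noncomputable section

namespace Grass

set_option linter.unusedSectionVars false

/-! ### Symmetric kernels of order two -/

section UStatistics

variable {α : Type*} [MeasurableSpace α]

/-- Resampling one coordinate of a product measure preserves it. -/
lemma measurePreserving_update {ι : Type*} [Fintype ι] [DecidableEq ι] (P : Measure α)
    [IsProbabilityMeasure P] (j : ι) :
    MeasurePreserving (fun z : (ι → α) × α => Function.update z.1 j z.2)
      ((Measure.pi fun _ => P).prod P) (Measure.pi fun _ => P) := by
  have hm : Measurable fun z : (ι → α) × α => Function.update z.1 j z.2 := by
    refine measurable_pi_lambda _ fun i => ?_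
    by_cases h : i = j
    · subst h; simpa using measurable_snd
    · simp only [Function.update_of_ne h]
      fun_prop
  refine ⟨hm, (Measure.pi_eq fun s hs => ?_).symm⟩
  have hpre : (fun z : (ι → α) × α => Function.update z.1 j z.2) ⁻¹' Set.univ.pi s =
      (Set.univ.pi (Function.update s j Set.univ)) ×ˢ s j := by
    ext ⟨x, y⟩
    simp only [Set.mem_preimage, Set.mem_pi, Set.mem_univ, true_implies, Set.mem_prod]
    constructor
    · intro h
      refine ⟨fun i => ?_, by simpa using h j⟩
      by_cases hi : i = j
      · subst hi; simp
      · simpa [Function.update_of_ne hi] using h i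
    · rintro ⟨h1, h2⟩ i
      by_cases hi : i = j
      · subst hi; simpa using h2
      · simpa [Function.update_of_ne hi] using h1 i
  rw [Measure.map_apply hm (MeasurableSet.univ_pi hs), hpre, Measure.prod_prod, Measure.pi_pi,
    ← Finset.prod_erase_mul _ _ (Finset.mem_univ j),
    ← Finset.prod_erase_mul _ _ (Finset.mem_univ j)]
  simp only [Function.update_self, measure_univ, mul_one]
  congr 1
  refine Finset.prod_congr rfl fun i hi => ?_
  rw [Function.update_of_ne (Finset.ne_of_mem_erase hi)]

lemma integrable_of_measurable_of_abs_le {β : Type*} [MeasurableSpace β] {μ : Measure β}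
    [IsFiniteMeasure μ] {f : β → ℝ} (hf : Measurable f) {C : ℝ} (hC : ∀ x, |f x| ≤ C) :
    Integrable f μ :=
  Integrable.of_bound hf.aestronglyMeasurable C (Eventually.of_forall hC)

/-- A bounded function whose averages over one coordinate vanish has mean zero. -/
lemma integral_pi_eq_zero {ι : Type*} [Fintype ι] [DecidableEq ι] (P : Measure α)
    [IsProbabilityMeasure P] (j : ι) {Φ : (ι → α) → ℝ} (hΦ : Measurable Φ) {C : ℝ}
    (hC : ∀ x, |Φ x| ≤ C) (h0 : ∀ x, ∫ y, Φ (Function.update x j y) ∂P = 0) :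
    ∫ x, Φ x ∂(Measure.pi fun _ => P) = 0 := by
  have hmp := measurePreserving_update (ι := ι) P j
  rw [← hmp.map_eq, integral_map hmp.measurable.aemeasurable hΦ.aestronglyMeasurable,
    integral_prod (fun z : (ι → α) × α => Φ (Function.update z.1 j z.2))
      (integrable_of_measurable_of_abs_le (hΦ.comp hmp.measurable) fun _ => hC _)]
  simp [h0]

/-- After coordinate `j` is resampled, the pair consists of an old coordinate and the fresh draw,
which are independent by construction. -/
lemma measurePreserving_pair {ι : Type*} [Fintype ι] [DecidableEq ι] (P : Measure α)
    [IsProbabilityMeasure P] {i j : ι} (hij : i ≠ j) :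
    MeasurePreserving (fun x : ι → α => (x i, x j)) (Measure.pi fun _ => P) (P.prod P) := by
  have hm : Measurable fun x : ι → α => (x i, x j) := by fun_prop
  refine ⟨hm, ?_⟩
  have hmp := measurePreserving_update (ι := ι) P j
  rw [← hmp.map_eq, Measure.map_map hm hmp.measurable]
  have : ((fun x : ι → α => (x i, x j)) ∘ fun z : (ι → α) × α => Function.update z.1 j z.2) =
      Prod.map (Function.eval i) id := by
    ext z <;> simp [Function.update_of_ne hij]
  rw [this]
  exact ((measurePreserving_eval (fun _ : ι => P) i).prod (MeasurePreserving.id P)).map_eq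

/-- A bounded symmetric measurable kernel that vanishes on the diagonal. -/
structure IsKernel (h : α → α → ℝ) : Prop where
  measurable : Measurable (Function.uncurry h)
  symm : ∀ x y, h x y = h y x
  diag : ∀ x, h x x = 0
  abs_le_one : ∀ x y, |h x y| ≤ 1

/-- The U-statistic with kernel `h`. -/
def uStat {n : ℕ} (h : α → α → ℝ) (x : Fin n → α) : ℝ :=
  1 / ((n : ℝ) * ((n : ℝ) - 1)) * ∑ i, ∑ j, h (x i) (x j)

/-- The first projection of the kernel `h`. -/
def proj (P : Measure α) (h : α → α → ℝ) (x : α) : ℝ := ∫ y, h x y ∂P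

/-- The mean of the kernel `h`. -/
def kernelMean (P : Measure α) (h : α → α → ℝ) : ℝ := ∫ x, proj P h x ∂P

lemma IsKernel.neg {h : α → α → ℝ} (hh : IsKernel h) : IsKernel fun x y => -h x y where
  measurable := hh.measurable.neg
  symm x y := by rw [hh.symm]
  diag x := by simp [hh.diag]
  abs_le_one x y := by simpa using hh.abs_le_one x y

variable {P : Measure α} [IsProbabilityMeasure P] {h : α → α → ℝ}

lemma IsKernel.measurable_right (hh : IsKernel h) (x : α) : Measurable (h x) :=
  hh.measurable.of_uncurry_left

lemma IsKernel.measurable_proj (hh : IsKernel h) : Measurable (proj P h) :=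
  (hh.measurable.stronglyMeasurable.integral_prod_right' (ν := P)).measurable

lemma abs_integral_le_of_abs_le {β : Type*} [MeasurableSpace β] {μ : Measure β}
    [IsProbabilityMeasure μ] {f : β → ℝ} {C : ℝ} (hC : ∀ x, |f x| ≤ C) : |∫ x, f x ∂μ| ≤ C := by
  simpa using norm_integral_le_of_norm_le_const (μ := μ) (f := f) (Eventually.of_forall hC)

lemma IsKernel.abs_proj_le (hh : IsKernel h) (x : α) : |proj P h x| ≤ 1 :=
  abs_integral_le_of_abs_le fun y => hh.abs_le_one x y

lemma IsKernel.abs_kernelMean_le (hh : IsKernel h) : |kernelMean P h| ≤ 1 :=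
  abs_integral_le_of_abs_le fun x => hh.abs_proj_le x

lemma IsKernel.kernelMean_eq_integral_prod (hh : IsKernel h) :
    kernelMean P h = ∫ z, h z.1 z.2 ∂(P.prod P) := by
  rw [integral_prod (fun z : α × α => h z.1 z.2) (integrable_of_measurable_of_abs_le (C := 1)
    hh.measurable fun z => hh.abs_le_one z.1 z.2)]
  rfl

/-! #### Hoeffding's inequality -/

/-- No independence is assumed: square roots of the variance proxies add, which produces the squared
cardinality. -/
lemma hasSubgaussianMGF_finset_sum {Ω ι : Type*} [MeasurableSpace Ω] {μ : Measure Ω}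
    [IsProbabilityMeasure μ] (s : Finset ι) {X : ι → Ω → ℝ} {c : NNReal}
    (hX : ∀ i ∈ s, HasSubgaussianMGF (X i) c μ) :
    HasSubgaussianMGF (fun ω => ∑ i ∈ s, X i ω) ((s.card : NNReal) ^ 2 * c) μ := by
  classical
  induction s using Finset.induction_on with
  | empty => simp
  | insert i s his ih =>
    have h1 := hX i (Finset.mem_insert_self _ _)
    have h2 := ih fun k hk => hX k (Finset.mem_insert_of_mem hk)
    have h3 := h1.add h2
    simp only [Finset.sum_insert his]
    convert h3 using 1
    rw [Finset.card_insert_of_notMem his, NNReal.sqrt_mul, NNReal.sqrt_sq]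
    conv_lhs => rw [← NNReal.sq_sqrt c]
    push_cast
    ring

/-- A sum of bounded centered kernel values over disjoint pairs of observations. -/
lemma hasSubgaussianMGF_sum_disjoint_pairs {ι : Type*} [Fintype ι] [DecidableEq ι]
    (hh : IsKernel h) (s : Finset (ι × ι)) (hne : ∀ e ∈ s, e.1 ≠ e.2)
    (hdisj : ∀ e ∈ s, ∀ e' ∈ s, e ≠ e' → Disjoint ({e.1, e.2} : Finset ι) {e'.1, e'.2}) :
    HasSubgaussianMGF (fun x : ι → α => ∑ e ∈ s, (h (x e.1) (x e.2) - kernelMean P h))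
      (s.card : NNReal) (Measure.pi fun _ => P) := by
  induction s using Finset.induction_on with
  | empty => simp
  | insert e s hes ih =>
    have hij := hne e (Finset.mem_insert_self _ _)
    have h2 := ih (fun k hk => hne k (Finset.mem_insert_of_mem hk))
      fun k hk k' hk' => hdisj k (Finset.mem_insert_of_mem hk) k' (Finset.mem_insert_of_mem hk')
    have hm : Measurable fun x : ι → α => h (x e.1) (x e.2) :=
      hh.measurable.comp (by fun_prop : Measurable fun x : ι → α => (x e.1, x e.2))
    have h1 : HasSubgaussianMGF (fun x : ι → α => h (x e.1) (x e.2) - kernelMean P h) 1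
        (Measure.pi fun _ => P) := by
      have := hasSubgaussianMGF_of_mem_Icc (μ := Measure.pi fun _ : ι => P) (a := -1) (b := 1)
        hm.aemeasurable (Eventually.of_forall fun x => abs_le.1 (hh.abs_le_one _ _))
      convert this using 1
      · have hk : kernelMean P h = ∫ x : ι → α, h (x e.1) (x e.2) ∂(Measure.pi fun _ => P) := by
          have hmp := measurePreserving_pair (ι := ι) P hij
          rw [hh.kernelMean_eq_integral_prod, ← hmp.map_eq,
            integral_map (f := fun z : α × α => h z.1 z.2) hmp.measurable.aemeasurable
              hh.measurable.aestronglyMeasurable]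
        rw [hk]
      · ext
        norm_num
    have hind : IndepFun (fun x : ι → α => h (x e.1) (x e.2) - kernelMean P h)
        (fun x : ι → α => ∑ e ∈ s, (h (x e.1) (x e.2) - kernelMean P h))
        (Measure.pi fun _ => P) := by
      have hI : iIndepFun (fun (i : ι) (x : ι → α) => x i) (Measure.pi fun _ => P) :=
        iIndepFun_pi (X := fun _ => id) fun _ => aemeasurable_id
      -- The new summand reads only the coordinates in `S` and the old sum only those in `T`;
      -- disjointness of the pairs makes the two independent.
      let S : Finset ι := {e.1, e.2}
      let T : Finset ι := s.biUnion fun e => {e.1, e.2}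
      have hST : Disjoint S T := by
        rw [Finset.disjoint_biUnion_right]
        intro e' he'
        exact hdisj e (Finset.mem_insert_self _ _) e' (Finset.mem_insert_of_mem he')
          (fun hE => hes (hE ▸ he'))
      have h3 := hI.indepFun_finset S T hST fun i => measurable_pi_apply i
      have hS1 : e.1 ∈ S := by simp [S]
      have hS2 : e.2 ∈ S := by simp [S]
      have hT : ∀ e' ∈ s, e'.1 ∈ T ∧ e'.2 ∈ T := fun e' he' =>
        ⟨Finset.mem_biUnion.2 ⟨e', he', by simp⟩, Finset.mem_biUnion.2 ⟨e', he', by simp⟩⟩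
      have h4 := h3.comp (_mγ := inferInstance) (_mγ' := inferInstance)
        (φ := fun y => h (y ⟨e.1, hS1⟩) (y ⟨e.2, hS2⟩) - kernelMean P h)
        (ψ := fun y => ∑ e' : s, (h (y ⟨e'.1.1, (hT e'.1 e'.2).1⟩) (y ⟨e'.1.2, (hT e'.1 e'.2).2⟩)
          - kernelMean P h)) ?_ ?_
      · convert h4 using 1
        · rfl
        ext x
        exact (Finset.sum_coe_sort s fun e' => h (x e'.1) (x e'.2) - kernelMean P h).symm
      · exact (hh.measurable.comp
          (by fun_prop : Measurable fun y : S → α => (y ⟨e.1, hS1⟩, y ⟨e.2, hS2⟩))).sub_const _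
      · exact Finset.measurable_sum _ fun e' _ => (hh.measurable.comp
          (by fun_prop : Measurable fun y : T → α => (y ⟨e'.1.1, (hT e'.1 e'.2).1⟩,
            y ⟨e'.1.2, (hT e'.1 e'.2).2⟩))).sub_const _
    have h3 := h1.add_of_indepFun h2 hind
    simp only [Finset.sum_insert hes]
    convert h3 using 1
    rw [Finset.card_insert_of_notMem hes]
    push_cast
    ring

lemma IsKernel.sum_sum_eq {n : ℕ} (hh : IsKernel h) (x : Fin n → α) :
    ∑ i, ∑ j, h (x i) (x j) =
      2 * ∑ e ∈ Finset.univ.filter (fun e : Fin n × Fin n => e.1 < e.2), h (x e.1) (x e.2) := by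
  rw [← Finset.sum_product', Finset.univ_product_univ]
  have h1 : ∀ e : Fin n × Fin n, h (x e.1) (x e.2) =
      (if e.1 < e.2 then h (x e.1) (x e.2) else 0) +
        (if e.2 < e.1 then h (x e.1) (x e.2) else 0) := by
    intro e
    rcases lt_trichotomy e.1 e.2 with hlt | heq | hgt
    · simp [hlt, hlt.not_gt]
    · simp [heq, hh.diag]
    · simp [hgt, hgt.not_gt]
  rw [Finset.sum_congr rfl fun e _ => h1 e, Finset.sum_add_distrib, Finset.sum_filter, two_mul]
  congr 1
  rw [← (Equiv.prodComm (Fin n) (Fin n)).sum_comp]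
  exact Finset.sum_congr rfl fun e _ => by simp [hh.symm (x e.2) (x e.1)]

lemma card_filter_lt_fin (n : ℕ) :
    ((Finset.univ.filter (fun e : Fin n × Fin n => e.1 < e.2)).card : ℝ) =
      (n : ℝ) * ((n : ℝ) - 1) / 2 := by
  have h1 : ∀ e : Fin n × Fin n, (1 : ℝ) =
      (if e.1 < e.2 then 1 else 0) + (if e.2 < e.1 then 1 else 0) +
        (if e.1 = e.2 then 1 else 0) := by
    intro e
    rcases lt_trichotomy e.1 e.2 with hlt | heq | hgt
    · simp [hlt, hlt.not_gt, hlt.ne]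
    · simp [heq]
    · simp [hgt, hgt.not_gt, hgt.ne']
  have h2 : ∑ e : Fin n × Fin n, (1 : ℝ) = (n : ℝ) * n := by simp
  have h5 : ∑ e : Fin n × Fin n, (if e.2 < e.1 then (1 : ℝ) else 0) =
      ∑ e : Fin n × Fin n, (if e.1 < e.2 then (1 : ℝ) else 0) :=
    (Equiv.prodComm (Fin n) (Fin n)).sum_comp fun e => if e.1 < e.2 then (1 : ℝ) else 0
  rw [Finset.sum_congr rfl fun e _ => h1 e, Finset.sum_add_distrib, Finset.sum_add_distrib,
    h5] at h2
  have h3 : ∑ e : Fin n × Fin n, (if e.1 = e.2 then (1 : ℝ) else 0) = n := by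
    rw [Fintype.sum_prod_type]
    simp
  have h4 : ((Finset.univ.filter (fun e : Fin n × Fin n => e.1 < e.2)).card : ℝ) =
      ∑ e : Fin n × Fin n, (if e.1 < e.2 then (1 : ℝ) else 0) := by simp
  rw [h3] at h2
  rw [h4]
  linarith

/-- **Hoeffding's inequality** for U-statistics of order two. -/
lemma IsKernel.measureReal_uStat_ge_le {n : ℕ} (hn : 3 ≤ n) (hh : IsKernel h) {t : ℝ}
    (ht : 0 ≤ t) :
    (Measure.pi fun _ : Fin n => P).real {x | t ≤ uStat h x - kernelMean P h} ≤
      Real.exp (-(n * t ^ 2 / 72)) := by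
  have hn' : (3 : ℝ) ≤ n := by exact_mod_cast hn
  have hN : 0 < (n : ℝ) * ((n : ℝ) - 1) := by nlinarith
  set s := Finset.univ.filter (fun e : Fin n × Fin n => e.1 < e.2) with hs
  -- The pairs `i < j` are split by the value of `i + j`. Two different pairs with the same sum
  -- share no index, so each class is a sum of at most `n` independent terms; the `2n` classes are
  -- then added without independence.
  let c : ℕ → Finset (Fin n × Fin n) := fun k => s.filter fun e => (e.1 : ℕ) + e.2 = k
  have hc : ∀ k, HasSubgaussianMGF
      (fun x : Fin n → α => ∑ e ∈ c k, (h (x e.1) (x e.2) - kernelMean P h)) (n : NNReal)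
      (Measure.pi fun _ => P) := by
    intro k
    have hlt : ∀ e ∈ c k, e.1 < e.2 := fun e he =>
      (Finset.mem_filter.1 (Finset.mem_filter.1 he).1).2
    have hsum : ∀ e ∈ c k, (e.1 : ℕ) + e.2 = k := fun e he => (Finset.mem_filter.1 he).2
    have h1 := hasSubgaussianMGF_sum_disjoint_pairs (P := P) hh (c k)
      (fun e he => (hlt e he).ne) ?_
    · have hcard : (c k).card ≤ n := by
        have : (c k).card ≤ (Finset.univ : Finset (Fin n)).card :=
          Finset.card_le_card_of_injOn Prod.fst (by simp) fun e he e' he' hee => by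
            have h1 := hsum e he
            have h2 := hsum e' he'
            refine Prod.ext hee (Fin.ext ?_)
            have := congrArg Fin.val hee
            omega
        simpa using this
      refine ⟨h1.integrable_exp_mul, fun t => (h1.mgf_le t).trans (Real.exp_le_exp.2 ?_)⟩
      have : ((c k).card : ℝ) ≤ n := by exact_mod_cast hcard
      simp only [NNReal.coe_natCast]
      gcongr
    · intro e he e' he' hne
      have h1 := hsum e he
      have h2 := hsum e' he'
      have h3 : (e.1 : ℕ) < e.2 := hlt e he
      have h4 : (e'.1 : ℕ) < e'.2 := hlt e' he'
      have h5 : ¬ ((e.1 : ℕ) = e'.1 ∧ (e.2 : ℕ) = e'.2) := fun hE =>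
        hne (Prod.ext (Fin.ext hE.1) (Fin.ext hE.2))
      simp only [Finset.disjoint_insert_left, Finset.disjoint_singleton_left, Finset.mem_insert,
        Finset.mem_singleton, Fin.ext_iff]
      omega
  have hS := hasSubgaussianMGF_finset_sum (Finset.range (2 * n)) fun k _ => hc k
  have hsumeq : ∀ x : Fin n → α,
      ∑ k ∈ Finset.range (2 * n), ∑ e ∈ c k, (h (x e.1) (x e.2) - kernelMean P h) =
        (n : ℝ) * ((n : ℝ) - 1) / 2 * (uStat h x - kernelMean P h) := by
    intro x
    rw [Finset.sum_fiberwise_of_maps_to (g := fun e : Fin n × Fin n => (e.1 : ℕ) + e.2),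
      Finset.sum_sub_distrib, Finset.sum_const, nsmul_eq_mul, card_filter_lt_fin]
    · have h1 : (n : ℝ) - 1 ≠ 0 := by linarith
      rw [uStat, hh.sum_sum_eq, ← hs]
      field_simp
    · intro e _
      have := e.1.2
      have := e.2.2
      simp only [Finset.mem_range]
      omega
  have hb := hS.measure_ge_le (ε := (n : ℝ) * ((n : ℝ) - 1) / 2 * t) (by positivity)
  simp only [hsumeq] at hb
  have hset : {x : Fin n → α | t ≤ uStat h x - kernelMean P h} =
      {x | (n : ℝ) * ((n : ℝ) - 1) / 2 * t ≤
        (n : ℝ) * ((n : ℝ) - 1) / 2 * (uStat h x - kernelMean P h)} := by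
    ext x
    simp only [Set.mem_ofPred_eq]
    rw [mul_le_mul_iff_right₀ (by positivity)]
  rw [hset]
  refine hb.trans (Real.exp_le_exp.2 ?_)
  simp only [Finset.card_range, NNReal.coe_mul, NNReal.coe_pow, NNReal.coe_natCast]
  rw [neg_div, neg_le_neg_iff, div_le_div_iff₀ (by norm_num) (by positivity)]
  push_cast
  -- The exponent obtained is `(n - 1)² t² / (32 n)`. For `n ≥ 3` one has `2 n ≤ 3 (n - 1)`, which
  -- turns it into `n t² / 72`.
  have h1 : (2 * (n : ℝ)) ^ 2 ≤ 9 * ((n : ℝ) - 1) ^ 2 := by nlinarith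
  have h2 : 0 ≤ (n : ℝ) ^ 2 * t ^ 2 * 2 := by positivity
  nlinarith [mul_le_mul_of_nonneg_left h1 h2]

lemma IsKernel.measureReal_abs_uStat_ge_le {n : ℕ} (hn : 3 ≤ n) (hh : IsKernel h) {t : ℝ}
    (ht : 0 ≤ t) :
    (Measure.pi fun _ : Fin n => P).real {x | t ≤ |uStat h x - kernelMean P h|} ≤
      2 * Real.exp (-(n * t ^ 2 / 72)) := by
  have h1 := hh.measureReal_uStat_ge_le (P := P) hn ht
  have h2 := hh.neg.measureReal_uStat_ge_le (P := P) hn ht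
  have h3 : kernelMean P (fun x y => -h x y) = -kernelMean P h := by
    simp [kernelMean, proj, integral_neg]
  have h4 : ∀ x : Fin n → α, uStat (fun x y => -h x y) x = -uStat h x := by
    intro x; simp [uStat, Finset.sum_neg_distrib]
  have h5 : {x : Fin n → α | t ≤ |uStat h x - kernelMean P h|} ⊆
      {x | t ≤ uStat h x - kernelMean P h} ∪
        {x | t ≤ uStat (fun x y => -h x y) x - kernelMean P fun x y => -h x y} := by
    intro x hx
    simp only [Set.mem_union, Set.mem_ofPred_eq, h3, h4] at hx ⊢
    rcases le_abs.1 hx with h | h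
    · exact Or.inl h
    · right
      linarith
  calc _ ≤ _ := measureReal_mono h5
    _ ≤ _ := measureReal_union_le _ _
    _ ≤ _ := by linarith

end UStatistics

/-! ### A uniform central limit theorem for bounded variables -/

section CentralLimit

/-- Telescoping: one factor is exchanged at a time, and the other factors have norm at most 1. -/
lemma norm_pow_sub_pow_le_of_norm_le_one {a b : ℂ} (ha : ‖a‖ ≤ 1) (hb : ‖b‖ ≤ 1) (n : ℕ) :
    ‖a ^ n - b ^ n‖ ≤ n * ‖a - b‖ := by
  induction n with
  | zero => simp
  | succ n ih =>
    have h1 : a ^ (n + 1) - b ^ (n + 1) = a * (a ^ n - b ^ n) + (a - b) * b ^ n := by ring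
    have h2 : ‖b ^ n‖ ≤ 1 := by rw [norm_pow]; exact pow_le_one₀ (norm_nonneg _) hb
    calc ‖a ^ (n + 1) - b ^ (n + 1)‖ ≤ ‖a‖ * ‖a ^ n - b ^ n‖ + ‖a - b‖ * ‖b ^ n‖ := by
          rw [h1, ← norm_mul, ← norm_mul]; exact norm_add_le _ _
      _ ≤ 1 * (n * ‖a - b‖) + ‖a - b‖ * 1 := by gcongr
      _ = ((n + 1 : ℕ) : ℝ) * ‖a - b‖ := by push_cast; ring

/-- Second order expansion of the characteristic function of a bounded standardized variable. -/
lemma norm_charFun_sub_le {μ : Measure ℝ} [IsProbabilityMeasure μ] {B : ℝ}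
    (hB : ∀ᵐ x ∂μ, |x| ≤ B) (h0 : ∫ x, x ∂μ = 0) (h1 : ∫ x, x ^ 2 ∂μ = 1) (t : ℝ) :
    ‖charFun μ t - (1 - t ^ 2 / 2)‖ ≤ B * |t| ^ 3 * Real.exp (B * |t|) := by
  have hint : Integrable (fun x : ℝ => x) μ :=
    Integrable.of_bound measurable_id.aestronglyMeasurable B hB
  have hint2 : Integrable (fun x : ℝ => x ^ 2) μ :=
    Integrable.of_bound (by fun_prop) (B ^ 2) (by
      filter_upwards [hB] with x hx
      rw [norm_pow]
      exact pow_le_pow_left₀ (norm_nonneg _) hx 2)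
  have hE : Integrable (fun x : ℝ => Complex.exp (t * x * Complex.I)) μ :=
    Integrable.of_bound (by fun_prop) 1 (Eventually.of_forall fun x => by
      rw [show (t : ℂ) * x * Complex.I = ((t * x : ℝ) : ℂ) * Complex.I by push_cast; ring,
        Complex.norm_exp_ofReal_mul_I])
  have hlin : Integrable (fun x : ℝ => (t : ℂ) * x * Complex.I) μ :=
    (hint.ofReal.const_mul _).mul_const _
  have hq : Integrable (fun x : ℝ => (t : ℂ) ^ 2 / 2 * ((x ^ 2 : ℝ) : ℂ)) μ :=
    hint2.ofReal.const_mul _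
  have hrep : charFun μ t - (1 - t ^ 2 / 2) = ∫ x : ℝ, (Complex.exp (t * x * Complex.I) -
      (1 + (t * x * Complex.I - (t : ℂ) ^ 2 / 2 * ((x ^ 2 : ℝ) : ℂ)))) ∂μ := by
    have hlq : Integrable (fun x : ℝ => (t : ℂ) * x * Complex.I -
        (t : ℂ) ^ 2 / 2 * ((x ^ 2 : ℝ) : ℂ)) μ := hlin.sub hq
    have hclq : Integrable (fun x : ℝ => 1 + ((t : ℂ) * x * Complex.I -
        (t : ℂ) ^ 2 / 2 * ((x ^ 2 : ℝ) : ℂ))) μ := (integrable_const _).add hlq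
    have k1 : ∫ x : ℝ, (x : ℂ) ∂μ = 0 := by
      rw [← Complex.ofReal_zero, ← h0]
      exact integral_ofReal
    have k2 : ∫ x : ℝ, ((x ^ 2 : ℝ) : ℂ) ∂μ = 1 := by
      rw [← Complex.ofReal_one, ← h1]
      exact integral_ofReal
    rw [integral_sub hE hclq, integral_add (integrable_const _) hlq, integral_sub hlin hq,
      integral_mul_const,
      integral_const_mul, integral_const_mul, k1, k2,
      charFun_apply_real]
    simp
    ring
  rw [hrep]
  calc _ ≤ ∫ x : ℝ, B * |t| ^ 3 * Real.exp (B * |t|) * x ^ 2 ∂μ := by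
        refine norm_integral_le_of_norm_le (hint2.const_mul _) ?_
        filter_upwards [hB] with x hx
        have h3 := Complex.norm_exp_sub_sum_le_norm_mul_exp (t * x * Complex.I) 3
        have h4 : ‖(t : ℂ) * x * Complex.I‖ = |t| * |x| := by simp
        have h5 : ∑ m ∈ Finset.range 3, ((t : ℂ) * x * Complex.I) ^ m / m.factorial =
            1 + (t * x * Complex.I - (t : ℂ) ^ 2 / 2 * ((x ^ 2 : ℝ) : ℂ)) := by
          have hI : Complex.I ^ 2 = -1 := Complex.I_sq
          simp only [Finset.sum_range_succ, Finset.sum_range_zero, Nat.factorial]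
          push_cast
          linear_combination ((t : ℂ) * x) ^ 2 / 2 * hI
        rw [h5, h4] at h3
        refine h3.trans ?_
        have hB0 : 0 ≤ B := (abs_nonneg x).trans hx
        -- Boundedness trades the third moment for the second, which equals 1. The bound therefore
        -- depends on the law only through `B`.
        have hx2 : |x| ^ 3 ≤ B * x ^ 2 := by
          rw [← sq_abs x, pow_succ, mul_comm]
          gcongr
        calc (|t| * |x|) ^ 3 * Real.exp (|t| * |x|)
            = |t| ^ 3 * |x| ^ 3 * Real.exp (|t| * |x|) := by ring
          _ ≤ |t| ^ 3 * (B * x ^ 2) * Real.exp (|t| * B) := by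
            gcongr
          _ = _ := by rw [mul_comm |t| B]; ring
    _ = _ := by rw [integral_const_mul, h1, mul_one]

/-- The law of the normalized sum of `n` independent variables with law `μ`. -/
def normalizedSumLaw (μ : Measure ℝ) (n : ℕ) : Measure ℝ :=
  (Measure.pi fun _ : Fin n => μ).map fun x => (√n)⁻¹ * ∑ i, x i

/-- Both characteristic functions are `n`th powers of functions evaluated at `s = t / √n`. The bases
differ by a term of order `n^(-3/2)` from the expansion of the law and one of order `n^(-2)` from
that of the Gaussian; passing to powers costs a factor `n`. -/
lemma norm_charFun_normalizedSumLaw_sub_le {μ : Measure ℝ} [IsProbabilityMeasure μ] {B : ℝ}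
    (hB : ∀ᵐ x ∂μ, |x| ≤ B) (h0 : ∫ x, x ∂μ = 0) (h1 : ∫ x, x ^ 2 ∂μ = 1) (t : ℝ) {n : ℕ}
    (hn : 0 < n) :
    ‖charFun (normalizedSumLaw μ n) t - charFun (gaussianReal 0 1) t‖ ≤
      (√n)⁻¹ * (B * |t| ^ 3 * Real.exp (B * |t|)) + (n : ℝ)⁻¹ * (t ^ 4 * Real.exp (t ^ 2)) := by
  have hB0 : 0 ≤ B := by
    obtain ⟨x, hx⟩ := hB.exists
    exact (abs_nonneg x).trans hx
  have hn' : (1 : ℝ) ≤ n := by exact_mod_cast hn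
  have hs : 0 < √(n : ℝ) := by positivity
  have hs1 : 1 ≤ √(n : ℝ) := Real.one_le_sqrt.2 hn'
  have hss : √(n : ℝ) ^ 2 = n := Real.sq_sqrt (by positivity)
  set s : ℝ := (√n)⁻¹ * t with hsdef
  have hst : |s| ≤ |t| := by
    rw [hsdef, abs_mul, abs_of_pos (inv_pos.2 hs)]
    exact mul_le_of_le_one_left (abs_nonneg _) (inv_le_one_of_one_le₀ hs1)
  have hsq : s ^ 2 = t ^ 2 / n := by
    rw [hsdef, mul_pow, inv_pow, hss]; ring
  have e1 : charFun (normalizedSumLaw μ n) t = charFun μ s ^ n := by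
    rw [normalizedSumLaw, charFun_map_mul_comp (by fun_prop), charFun_map_sum_pi_eq_prod]
    simp [hsdef]
  have e2 : charFun (gaussianReal 0 1) t = Complex.exp (-(s ^ 2 / 2 : ℝ)) ^ n := by
    rw [charFun_gaussianReal, ← Complex.exp_nat_mul, hsq]
    congr 1
    have hn0 : (n : ℂ) ≠ 0 := by exact_mod_cast hn.ne'
    push_cast
    field_simp
    simp
    ring
  have hb : ‖Complex.exp (-(s ^ 2 / 2 : ℝ))‖ ≤ 1 := by
    rw [Complex.norm_exp]
    have h : (0 : ℝ) ≤ s ^ 2 / 2 := by positivity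
    rw [Real.exp_le_one_iff]
    rw [Complex.neg_re, Complex.ofReal_re]
    linarith
  rw [e1, e2]
  refine (norm_pow_sub_pow_le_of_norm_le_one (norm_charFun_le_one s) hb n).trans ?_
  have hA := norm_charFun_sub_le hB h0 h1 s
  have hE : ‖(1 - (s : ℂ) ^ 2 / 2) - Complex.exp (-(s ^ 2 / 2 : ℝ))‖ ≤
      (s ^ 2 / 2) ^ 2 * Real.exp (s ^ 2 / 2) := by
    have h := Complex.norm_exp_sub_sum_le_norm_mul_exp (-(s ^ 2 / 2 : ℝ)) 2
    rw [norm_neg, Complex.norm_real, Real.norm_of_nonneg (by positivity)] at h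
    have hs2 : ∑ m ∈ Finset.range 2, (-((s ^ 2 / 2 : ℝ) : ℂ)) ^ m / m.factorial =
        1 - (s : ℂ) ^ 2 / 2 := by
      simp only [Finset.sum_range_succ, Finset.sum_range_zero, Nat.factorial]
      push_cast
      ring
    rwa [hs2, norm_sub_rev] at h
  have hsum : ‖charFun μ s - Complex.exp (-(s ^ 2 / 2 : ℝ))‖ ≤
      B * |s| ^ 3 * Real.exp (B * |s|) + (s ^ 2 / 2) ^ 2 * Real.exp (s ^ 2 / 2) :=
    (norm_sub_le_norm_sub_add_norm_sub _ (1 - (s : ℂ) ^ 2 / 2) _).trans (add_le_add hA hE)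
  have hs3 : |s| ^ 3 = (n : ℝ)⁻¹ * (√n)⁻¹ * |t| ^ 3 := by
    rw [hsdef, abs_mul, abs_of_pos (inv_pos.2 hs), mul_pow,
      show (n : ℝ)⁻¹ = (√n)⁻¹ ^ 2 by rw [inv_pow, hss]]
    ring
  have hs2 : s ^ 2 ≤ t ^ 2 := sq_le_sq.2 hst
  calc n * ‖charFun μ s - Complex.exp (-(s ^ 2 / 2 : ℝ))‖
      ≤ n * (B * |s| ^ 3 * Real.exp (B * |t|) + (s ^ 2) ^ 2 * Real.exp (t ^ 2)) := by
        gcongr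
        refine hsum.trans ?_
        gcongr
        · nlinarith [sq_nonneg s]
        · nlinarith [sq_nonneg s]
    _ = _ := by
        rw [hs3, hsq]
        field_simp

instance (μ : Measure ℝ) [IsProbabilityMeasure μ] (n : ℕ) :
    IsProbabilityMeasure (normalizedSumLaw μ n) :=
  Measure.isProbabilityMeasure_map (by fun_prop)

/-- The central limit theorem, uniformly over bounded standardized laws: the Lévy-Prokhorov
distance of the normalized sum to the normal law is small. -/
lemma exists_levyProkhorovEDist_normalizedSumLaw_lt (B : ℝ) {δ : ℝ} (hδ : 0 < δ) :
    ∃ N : ℕ, ∀ n ≥ N, ∀ μ : Measure ℝ, IsProbabilityMeasure μ → (∀ᵐ x ∂μ, |x| ≤ B) →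
      ∫ x, x ∂μ = 0 → ∫ x, x ^ 2 ∂μ = 1 →
      levyProkhorovEDist (normalizedSumLaw μ n) (gaussianReal 0 1) < ENNReal.ofReal δ := by
  -- Uniformity comes from a contradiction: a sequence of counterexamples with `n → ∞` has
  -- characteristic functions converging to the Gaussian one, by the explicit bound. It converges
  -- weakly, hence in the Lévy-Prokhorov metric.
  by_contra! hcon
  choose n hn μ hμ hB h0 h1 hdist using hcon
  let ν : ℕ → ProbabilityMeasure ℝ := fun k => ⟨normalizedSumLaw (μ k) (n k), inferInstance⟩
  let γ : ProbabilityMeasure ℝ := ⟨gaussianReal 0 1, inferInstance⟩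
  have hnat : Tendsto n atTop atTop := tendsto_atTop_mono hn tendsto_id
  have hlim : Tendsto ν atTop (𝓝 γ) := by
    refine ProbabilityMeasure.tendsto_of_tendsto_charFun fun t => ?_
    rw [tendsto_iff_norm_sub_tendsto_zero]
    have hR : Tendsto (fun m : ℕ => (√m)⁻¹ * (B * |t| ^ 3 * Real.exp (B * |t|)) +
        (m : ℝ)⁻¹ * (t ^ 4 * Real.exp (t ^ 2))) atTop (𝓝 0) := by
      have a1 : Tendsto (fun m : ℕ => (√(m : ℝ))⁻¹) atTop (𝓝 0) :=
        tendsto_inv_atTop_zero.comp (Real.tendsto_sqrt_atTop.comp tendsto_natCast_atTop_atTop)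
      have a2 : Tendsto (fun m : ℕ => (m : ℝ)⁻¹) atTop (𝓝 0) :=
        tendsto_inv_atTop_zero.comp tendsto_natCast_atTop_atTop
      simpa using (a1.mul_const _).add (a2.mul_const _)
    refine squeeze_zero' (Eventually.of_forall fun _ => norm_nonneg _) ?_ (hR.comp hnat)
    filter_upwards [eventually_gt_atTop 0] with k hk
    have := hμ k
    exact norm_charFun_normalizedSumLaw_sub_le (hB k) (h0 k) (h1 k) t (hk.trans_le (hn k))
  have hLP := (LevyProkhorov.continuous_ofMeasure_probabilityMeasure.tendsto γ).comp hlim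
  rw [EMetric.tendsto_nhds] at hLP
  obtain ⟨k, hk⟩ := (hLP (ENNReal.ofReal δ) (by simpa using hδ)).exists
  refine absurd hk (not_lt.2 ((hdist k).trans_eq ?_))
  rw [edist_dist, LevyProkhorov.dist_probabilityMeasure_def, levyProkhorovDist,
    ENNReal.ofReal_toReal (levyProkhorovEDist_ne_top _ _)]
  rfl

/-- The uniform central limit theorem for two-sided tail probabilities. -/
lemma exists_measureReal_normalizedSum_le (B : ℝ) {δ : ℝ} (hδ : 0 < δ) :
    ∃ N : ℕ, ∀ n ≥ N, ∀ μ : Measure ℝ, IsProbabilityMeasure μ → (∀ᵐ x ∂μ, |x| ≤ B) →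
      ∫ x, x ∂μ = 0 → ∫ x, x ^ 2 ∂μ = 1 → ∀ t : ℝ,
      (Measure.pi fun _ : Fin n => μ).real {x | t < |(√n)⁻¹ * ∑ i, x i|} ≤
        (gaussianReal 0 1).real {x | t - δ < |x|} + δ := by
  obtain ⟨N, hN⟩ := exists_levyProkhorovEDist_normalizedSumLaw_lt B hδ
  refine ⟨N, fun n hn μ hμ hB h0 h1 t => ?_⟩
  have hmeas : MeasurableSet {x : ℝ | t < |x|} := measurableSet_lt measurable_const (by fun_prop)
  -- A Lévy-Prokhorov distance below `δ` bounds the mass of a set by the mass of its `δ`-thickening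
  -- plus `δ`.
  have h := left_measure_le_of_levyProkhorovEDist_lt (hN n hn μ hμ hB h0 h1) hmeas
  rw [ENNReal.toReal_ofReal hδ.le, normalizedSumLaw, Measure.map_apply (by fun_prop) hmeas] at h
  have hsub : Metric.thickening δ {x : ℝ | t < |x|} ⊆ {x | t - δ < |x|} := by
    intro x hx
    obtain ⟨y, hy, hxy⟩ := Metric.mem_thickening_iff.1 hx
    simp only [Set.mem_ofPred_eq] at hy ⊢
    rw [Real.dist_eq] at hxy
    have := abs_sub_abs_le_abs_sub y x
    rw [abs_sub_comm y x] at this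
    linarith
  have h2 := h.trans (add_le_add_left (measure_mono hsub) _)
  have h3 := ENNReal.toReal_mono (by finiteness) h2
  rw [ENNReal.toReal_add (by finiteness) (by finiteness), ENNReal.toReal_ofReal hδ.le] at h3
  exact h3

end CentralLimit

/-! ### Moment bounds for U-statistics -/

section Moments

variable {α : Type*} [MeasurableSpace α]

/-- The second moment of a sum of bounded functions, most of which are uncorrelated. -/
lemma integral_sq_sum_le {Ω ι : Type*} [MeasurableSpace Ω] {μ : Measure Ω}
    [IsProbabilityMeasure μ] (s : Finset ι) {Φ : ι → Ω → ℝ} (hm : ∀ a ∈ s, Measurable (Φ a))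
    {C : ℝ} (hC : ∀ a ∈ s, ∀ x, |Φ a x| ≤ C) (R : ι → ι → Prop)
    [∀ a, DecidablePred (R a)] (hR : ∀ a ∈ s, ∀ b ∈ s, ¬ R a b → ∫ x, Φ a x * Φ b x ∂μ = 0)
    {m : ℕ} (hcard : ∀ a ∈ s, (s.filter (R a)).card ≤ m) :
    ∫ x, (∑ a ∈ s, Φ a x) ^ 2 ∂μ ≤ s.card * (m * C ^ 2) := by
  have hb : ∀ a ∈ s, ∀ b ∈ s, ∀ x, |Φ a x * Φ b x| ≤ C ^ 2 := by
    intro a ha b hb x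
    rw [abs_mul, sq]
    exact mul_le_mul (hC a ha x) (hC b hb x) (abs_nonneg _) ((abs_nonneg _).trans (hC a ha x))
  have hint : ∀ a ∈ s, ∀ b ∈ s, Integrable (fun x => Φ a x * Φ b x) μ := fun a ha b hb' =>
    integrable_of_measurable_of_abs_le ((hm a ha).mul (hm b hb')) (hb a ha b hb')
  have h1 : ∫ x, (∑ a ∈ s, Φ a x) ^ 2 ∂μ = ∑ a ∈ s, ∑ b ∈ s, ∫ x, Φ a x * Φ b x ∂μ := by
    simp_rw [sq, Finset.sum_mul_sum]
    rw [integral_finsetSum s fun a ha => integrable_finsetSum s fun b hb' => hint a ha b hb']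
    exact Finset.sum_congr rfl fun a ha => integral_finsetSum s fun b hb' => hint a ha b hb'
  rw [h1, ← nsmul_eq_mul]
  refine Finset.sum_le_card_nsmul s _ _ fun a ha => ?_
  have h2 : ∑ b ∈ s, ∫ x, Φ a x * Φ b x ∂μ = ∑ b ∈ s.filter (R a), ∫ x, Φ a x * Φ b x ∂μ := by
    rw [Finset.sum_filter]
    refine Finset.sum_congr rfl fun b hb' => ?_
    split_ifs with h
    · rfl
    · exact hR a ha b hb' h
  rw [h2]
  calc _ ≤ (s.filter (R a)).card • C ^ 2 := by
        refine Finset.sum_le_card_nsmul _ _ _ fun b hb' => ?_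
        exact (abs_le.1 (abs_integral_le_of_abs_le (hb a ha b (Finset.mem_filter.1 hb').1))).2
    _ ≤ _ := by
        rw [nsmul_eq_mul]
        gcongr
        exact hcard a ha

/-- Pointwise `|X| ≤ X² / (2 D) + D / 2`, from `(|X| - D)² ≥ 0`. -/
lemma integral_abs_le_of_integral_sq_le {Ω : Type*} [MeasurableSpace Ω] {μ : Measure Ω}
    [IsProbabilityMeasure μ] {X : Ω → ℝ} (hX : Measurable X) {C : ℝ} (hC : ∀ x, |X x| ≤ C)
    {D : ℝ} (hD : 0 < D) (h : ∫ x, X x ^ 2 ∂μ ≤ D ^ 2) : ∫ x, |X x| ∂μ ≤ D := by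
  have hi : Integrable (fun x => |X x|) μ :=
    integrable_of_measurable_of_abs_le (C := C) (by fun_prop) (by simpa using hC)
  have hi2 : Integrable (fun x => X x ^ 2) μ :=
    integrable_of_measurable_of_abs_le (C := C ^ 2) (by fun_prop) fun x => by
      rw [abs_pow]
      exact pow_le_pow_left₀ (abs_nonneg _) (hC x) 2
  calc ∫ x, |X x| ∂μ ≤ ∫ x, (X x ^ 2 / (2 * D) + D / 2) ∂μ := by
        refine integral_mono hi ((hi2.div_const _).add (integrable_const _)) fun x => ?_
        have h1 : 0 ≤ (|X x| - D) ^ 2 := sq_nonneg _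
        have h2 : |X x| ≤ (X x ^ 2 + D ^ 2) / (2 * D) := by
          rw [le_div_iff₀ (by positivity), ← sq_abs (X x)]
          nlinarith
        calc |X x| ≤ _ := h2
          _ = _ := by field_simp
    _ = (∫ x, X x ^ 2 ∂μ) / (2 * D) + D / 2 := by
        rw [integral_add (hi2.div_const _) (integrable_const _), integral_div]
        simp
    _ ≤ D ^ 2 / (2 * D) + D / 2 := by gcongr
    _ = D := by field_simp; ring

variable {P : Measure α} [IsProbabilityMeasure P] {h : α → α → ℝ}

lemma integral_sq_sum_eval_le {n : ℕ} {G : α → ℝ} (hG : Measurable G) {C : ℝ}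
    (hC : ∀ x, |G x| ≤ C) (h0 : ∫ x, G x ∂P = 0) :
    ∫ x : Fin n → α, (∑ i, G (x i)) ^ 2 ∂(Measure.pi fun _ => P) ≤ n * C ^ 2 := by
  have h1 := integral_sq_sum_le (μ := Measure.pi fun _ : Fin n => P) Finset.univ
    (Φ := fun i x => G (x i)) (fun i _ => by fun_prop) (C := C) (fun i _ x => hC _)
    (fun i j => j = i) (m := 1) ?_ ?_
  · simpa using h1
  · intro i _ j _ hij
    refine integral_pi_eq_zero P j (by fun_prop) (C := C ^ 2) (fun x => ?_) fun x => ?_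
    · rw [abs_mul, sq]
      exact mul_le_mul (hC _) (hC _) (abs_nonneg _) ((abs_nonneg _).trans (hC (x i)))
    · simp [Function.update_of_ne (Ne.symm hij), integral_const_mul, h0]
  · intro i _
    simp [Finset.filter_eq']

/-- The first projection, centered. -/
def centeredProj (P : Measure α) (h : α → α → ℝ) (x : α) : ℝ := proj P h x - kernelMean P h

/-- The variance of the first projection. -/
def projVar (P : Measure α) (h : α → α → ℝ) : ℝ := ∫ x, centeredProj P h x ^ 2 ∂P

/-- The degenerate part of a kernel. -/
def degenerateKernel (P : Measure α) (h : α → α → ℝ) (x y : α) : ℝ :=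
  h x y - proj P h x - centeredProj P h y

lemma IsKernel.measurable_centeredProj (hh : IsKernel h) : Measurable (centeredProj P h) :=
  hh.measurable_proj.sub_const _

lemma IsKernel.abs_centeredProj_le (hh : IsKernel h) (x : α) : |centeredProj P h x| ≤ 2 := by
  have h1 := hh.abs_proj_le (P := P) x
  have h2 := hh.abs_kernelMean_le (P := P)
  have := abs_sub (proj P h x) (kernelMean P h)
  rw [centeredProj]
  linarith

lemma IsKernel.integrable_right (hh : IsKernel h) (x : α) : Integrable (h x) P :=
  integrable_of_measurable_of_abs_le (hh.measurable_right x) (hh.abs_le_one x)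

lemma IsKernel.integrable_proj (hh : IsKernel h) : Integrable (proj P h) P :=
  integrable_of_measurable_of_abs_le hh.measurable_proj hh.abs_proj_le

lemma IsKernel.integral_centeredProj (hh : IsKernel h) : ∫ x, centeredProj P h x ∂P = 0 := by
  simp only [centeredProj]
  rw [integral_sub hh.integrable_proj (integrable_const _)]
  simp [kernelMean]

lemma IsKernel.integral_sub_proj (hh : IsKernel h) (x : α) :
    ∫ y, (h x y - proj P h x) ∂P = 0 := by
  rw [integral_sub (hh.integrable_right x) (integrable_const _)]
  simp [proj]

lemma IsKernel.integral_degenerateKernel (hh : IsKernel h) (x : α) :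
    ∫ y, degenerateKernel P h x y ∂P = 0 := by
  simp only [degenerateKernel]
  have h1 : Integrable (fun y => h x y - proj P h x) P :=
    (hh.integrable_right x).sub (integrable_const _)
  rw [integral_sub h1
    (integrable_of_measurable_of_abs_le hh.measurable_centeredProj hh.abs_centeredProj_le),
    hh.integral_sub_proj, hh.integral_centeredProj, sub_zero]

lemma IsKernel.degenerateKernel_symm (hh : IsKernel h) (x y : α) :
    degenerateKernel P h x y = degenerateKernel P h y x := by
  simp only [degenerateKernel, centeredProj, hh.symm x y]
  ring

lemma IsKernel.abs_degenerateKernel_le (hh : IsKernel h) (x y : α) :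
    |degenerateKernel P h x y| ≤ 4 := by
  have h1 := abs_le.1 (hh.abs_proj_le (P := P) x)
  have h2 := abs_le.1 (hh.abs_centeredProj_le (P := P) y)
  have h3 := abs_le.1 (hh.abs_le_one x y)
  rw [degenerateKernel, abs_le]
  constructor <;> linarith

lemma IsKernel.measurable_eval {ι : Type*} (hh : IsKernel h) (i j : ι) :
    Measurable fun x : ι → α => h (x i) (x j) :=
  hh.measurable.comp (by fun_prop : Measurable fun x : ι → α => (x i, x j))

lemma IsKernel.measurable_proj_eval {ι : Type*} (hh : IsKernel h) (i : ι) :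
    Measurable fun x : ι → α => proj P h (x i) :=
  hh.measurable_proj.comp (measurable_pi_apply i)

lemma IsKernel.measurable_degenerateKernel_eval {ι : Type*} (hh : IsKernel h) (i j : ι) :
    Measurable fun x : ι → α => degenerateKernel P h (x i) (x j) :=
  ((hh.measurable_eval i j).sub (hh.measurable_proj_eval i)).sub
    ((hh.measurable_proj_eval j).sub_const _)

/-- Conditionally on `x i` the summands are independent and centered. Only the squares survive, at
most `n` of them, each bounded by 4. -/
lemma IsKernel.integral_sq_sum_sub_proj_le {n : ℕ} (hh : IsKernel h) (i : Fin n) :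
    ∫ x : Fin n → α, (∑ j ∈ Finset.univ.erase i, (h (x i) (x j) - proj P h (x i))) ^ 2
      ∂(Measure.pi fun _ => P) ≤ 4 * n := by
  have hb : ∀ (j : Fin n) (x : Fin n → α), |h (x i) (x j) - proj P h (x i)| ≤ 2 := by
    intro j x
    have h1 := abs_le.1 (hh.abs_proj_le (P := P) (x i))
    have h3 := abs_le.1 (hh.abs_le_one (x i) (x j))
    rw [abs_le]
    constructor <;> linarith
  have hm : ∀ j : Fin n, Measurable fun x : Fin n → α => h (x i) (x j) - proj P h (x i) :=
    fun j => (hh.measurable_eval i j).sub (hh.measurable_proj_eval i)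
  have h1 := integral_sq_sum_le (μ := Measure.pi fun _ : Fin n => P) (Finset.univ.erase i)
    (Φ := fun j x => h (x i) (x j) - proj P h (x i)) (fun j _ => hm j)
    (C := 2) (fun j _ x => hb j x) (fun a b => b = a) (m := 1) ?_ ?_
  · refine h1.trans ?_
    have : ((Finset.univ.erase i).card : ℝ) ≤ n := by
      have := Finset.card_le_univ (Finset.univ.erase i)
      exact_mod_cast this.trans_eq (by simp)
    push_cast
    nlinarith
  · intro a ha b hb' hab
    refine integral_pi_eq_zero P b ((hm a).mul (hm b)) (C := 2 ^ 2) (fun x => ?_) fun x => ?_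
    · rw [abs_mul, sq]
      exact mul_le_mul (hb a x) (hb b x) (abs_nonneg _) (by norm_num)
    · simp only [Function.update_of_ne (Finset.ne_of_mem_erase hb').symm,
        Function.update_of_ne (Ne.symm hab), Function.update_self]
      rw [integral_const_mul, hh.integral_sub_proj, mul_zero]
  · intro a ha
    rw [Finset.filter_eq', if_pos ha, Finset.card_singleton]

/-- An ordered pair is correlated only with itself and with its swap. The constant is 2 such
partners times the bound `4²`, and there are at most `n²` pairs. -/
lemma IsKernel.integral_sq_sum_degenerateKernel_le {n : ℕ} (hh : IsKernel h) :
    ∫ x : Fin n → α, (∑ e ∈ Finset.univ.filter (fun e : Fin n × Fin n => e.1 ≠ e.2),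
      degenerateKernel P h (x e.1) (x e.2)) ^ 2 ∂(Measure.pi fun _ => P) ≤ 32 * n ^ 2 := by
  set s := Finset.univ.filter (fun e : Fin n × Fin n => e.1 ≠ e.2)
  have hs : ∀ e ∈ s, e.1 ≠ e.2 := fun e he => (Finset.mem_filter.1 he).2
  have hm : ∀ e : Fin n × Fin n, Measurable fun x : Fin n → α =>
    degenerateKernel P h (x e.1) (x e.2) := fun e => hh.measurable_degenerateKernel_eval _ _
  have h1 := integral_sq_sum_le (μ := Measure.pi fun _ : Fin n => P) s
    (Φ := fun e x => degenerateKernel P h (x e.1) (x e.2)) (fun e _ => hm e)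
    (C := 4) (fun e _ x => hh.abs_degenerateKernel_le _ _)
    (fun a b => b = a ∨ b = a.swap) (m := 2) ?_ ?_
  · refine h1.trans ?_
    have : (s.card : ℝ) ≤ (n : ℝ) ^ 2 := by
      have := Finset.card_le_univ s
      rw [Fintype.card_prod, Fintype.card_fin] at this
      rw [sq]
      exact_mod_cast this
    push_cast
    nlinarith
  · intro a ha b hb hab
    have hba := hs b hb
    have hbd : ∀ x : Fin n → α, |degenerateKernel P h (x a.1) (x a.2) *
        degenerateKernel P h (x b.1) (x b.2)| ≤ 4 ^ 2 := by
      intro x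
      rw [abs_mul, sq]
      exact mul_le_mul (hh.abs_degenerateKernel_le _ _) (hh.abs_degenerateKernel_le _ _)
        (abs_nonneg _) (by norm_num)
    -- As `b` is neither `a` nor its swap, some index of `b` does not occur in `a`; averaging over
    -- that coordinate kills the product.
    by_cases h2 : b.2 ≠ a.1 ∧ b.2 ≠ a.2
    · refine integral_pi_eq_zero P b.2 ((hm a).mul (hm b)) hbd fun x => ?_
      simp only [Function.update_of_ne h2.1.symm, Function.update_of_ne h2.2.symm,
        Function.update_of_ne hba, Function.update_self]
      rw [integral_const_mul, hh.integral_degenerateKernel, mul_zero]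
    · have h3 : b.1 ≠ a.1 ∧ b.1 ≠ a.2 := by
        have haa := hs a ha
        simp only [Prod.ext_iff, Prod.fst_swap, Prod.snd_swap, not_or, not_and] at hab
        grind
      refine integral_pi_eq_zero P b.1 ((hm a).mul (hm b)) hbd fun x => ?_
      simp only [Function.update_of_ne h3.1.symm, Function.update_of_ne h3.2.symm,
        Function.update_of_ne hba.symm, Function.update_self, hh.degenerateKernel_symm _ (x b.2)]
      rw [integral_const_mul, hh.integral_degenerateKernel, mul_zero]
  · intro a ha
    have hsub : s.filter (fun b => b = a ∨ b = a.swap) ⊆ {a, a.swap} := by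
      intro b hb
      simpa using (Finset.mem_filter.1 hb).2
    exact (Finset.card_le_card hsub).trans Finset.card_le_two

end Moments

/-! ### The jackknife variance estimator and the studentized U-statistic -/

section Jackknife

variable {α : Type*} [MeasurableSpace α]

/-- The average of the kernel over the pairs that contain the observation `i`. -/
def leaveOneMean {n : ℕ} (h : α → α → ℝ) (x : Fin n → α) (i : Fin n) : ℝ :=
  1 / ((n : ℝ) - 1) * ∑ j, h (x j) (x i)

/-- The empirical variance of the averages over the pairs that contain a given observation. -/
def jackknifeMean {n : ℕ} (h : α → α → ℝ) (x : Fin n → α) : ℝ :=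
  1 / (n : ℝ) * ∑ i, (leaveOneMean h x i - uStat h x) ^ 2

variable {P : Measure α} [IsProbabilityMeasure P] {h : α → α → ℝ} {n : ℕ}

lemma IsKernel.abs_leaveOneMean_le (hh : IsKernel h) (hn : 3 ≤ n) (x : Fin n → α) (i : Fin n) :
    |leaveOneMean h x i| ≤ 1 := by
  have hn' : (3 : ℝ) ≤ n := by exact_mod_cast hn
  have h1 : |∑ j, h (x j) (x i)| ≤ n - 1 := by
    rw [← Finset.sum_erase (f := fun j => h (x j) (x i)) Finset.univ (hh.diag (x i))]
    refine (Finset.abs_sum_le_sum_abs _ _).trans ?_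
    refine (Finset.sum_le_card_nsmul _ _ 1 fun j _ => hh.abs_le_one _ _).trans ?_
    rw [Finset.card_erase_of_mem (Finset.mem_univ _), Finset.card_fin]
    simp [Nat.cast_sub (by omega : 1 ≤ n)]
  rw [leaveOneMean, abs_mul, abs_of_pos (by apply one_div_pos.2; linarith), one_div,
    inv_mul_le_iff₀ (by linarith), mul_one]
  exact h1

lemma uStat_eq_average (h : α → α → ℝ) (x : Fin n → α) :
    uStat h x = 1 / (n : ℝ) * ∑ i, leaveOneMean h x i := by
  simp only [uStat, leaveOneMean, ← Finset.mul_sum]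
  rw [Finset.sum_comm, ← mul_assoc, one_div_mul_one_div]

lemma abs_average_le (hn : 3 ≤ n) {f : Fin n → ℝ} {C : ℝ} (hf : ∀ i, |f i| ≤ C) :
    |1 / (n : ℝ) * ∑ i, f i| ≤ C := by
  have hn' : (3 : ℝ) ≤ n := by exact_mod_cast hn
  rw [abs_mul, abs_of_pos (by positivity), one_div, inv_mul_le_iff₀ (by linarith)]
  refine (Finset.abs_sum_le_sum_abs _ _).trans ?_
  simpa using Finset.sum_le_card_nsmul _ _ C fun i (_ : i ∈ Finset.univ) => hf i

lemma IsKernel.abs_uStat_le (hh : IsKernel h) (hn : 3 ≤ n) (x : Fin n → α) :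
    |uStat h x| ≤ 1 := by
  rw [uStat_eq_average]
  exact abs_average_le hn fun i => hh.abs_leaveOneMean_le hn x i

lemma IsKernel.measurable_uStat (hh : IsKernel h) : Measurable fun x : Fin n → α => uStat h x :=
  (Finset.measurable_sum _ fun i _ => Finset.measurable_sum _ fun j _ =>
    hh.measurable_eval i j).const_mul _

lemma IsKernel.measurable_leaveOneMean (hh : IsKernel h) (i : Fin n) :
    Measurable fun x : Fin n → α => leaveOneMean h x i :=
  (Finset.measurable_sum _ fun j _ => hh.measurable_eval j i).const_mul _

lemma IsKernel.measurable_jackknifeMean (hh : IsKernel h) :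
    Measurable fun x : Fin n → α => jackknifeMean h x :=
  (Finset.measurable_sum _ fun i _ =>
    ((hh.measurable_leaveOneMean i).sub hh.measurable_uStat).pow_const 2).const_mul _

lemma IsKernel.leaveOneMean_sub (hh : IsKernel h) (hn : 3 ≤ n) (x : Fin n → α) (i : Fin n) :
    leaveOneMean h x i - proj P h (x i) =
      1 / ((n : ℝ) - 1) * ∑ j ∈ Finset.univ.erase i, (h (x i) (x j) - proj P h (x i)) := by
  have hn' : (3 : ℝ) ≤ n := by exact_mod_cast hn
  have h1 : (n : ℝ) - 1 ≠ 0 := by linarith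
  rw [Finset.sum_sub_distrib, Finset.sum_const, Finset.card_erase_of_mem (Finset.mem_univ _),
    Finset.card_fin, nsmul_eq_mul, Nat.cast_sub (by omega),
    Finset.sum_erase (f := fun j => h (x i) (x j)) Finset.univ (hh.diag (x i)),
    leaveOneMean]
  simp_rw [hh.symm (x _) (x i)]
  push_cast
  field_simp

/-- The second moment is at most `4 n / (n - 1)² ≤ 16 / n`, since `n ≤ 2 (n - 1)`. -/
lemma IsKernel.integral_abs_leaveOneMean_sub_le (hh : IsKernel h) (hn : 3 ≤ n) (i : Fin n) :
    ∫ x : Fin n → α, |leaveOneMean h x i - proj P h (x i)| ∂(Measure.pi fun _ => P) ≤ 4 / √n := by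
  have hn' : (3 : ℝ) ≤ n := by exact_mod_cast hn
  have hs : 0 < √(n : ℝ) := by positivity
  refine integral_abs_le_of_integral_sq_le (C := 2)
    (X := fun x : Fin n → α => leaveOneMean h x i - proj P h (x i))
    ((hh.measurable_leaveOneMean i).sub (hh.measurable_proj_eval i)) (fun x => ?_)
    (by positivity) ?_
  · have h1 := abs_le.1 (hh.abs_leaveOneMean_le hn x i)
    have h2 := abs_le.1 (hh.abs_proj_le (P := P) (x i))
    rw [_root_.abs_le]
    constructor <;> linarith
  · simp_rw [hh.leaveOneMean_sub hn, mul_pow]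
    rw [integral_const_mul]
    have h1 := hh.integral_sq_sum_sub_proj_le (P := P) i
    have h2 : (1 / ((n : ℝ) - 1)) ^ 2 * (4 * n) ≤ (4 / √n) ^ 2 := by
      rw [div_pow, div_pow, Real.sq_sqrt (by positivity), one_pow, one_div_mul_eq_div,
        div_le_div_iff₀ (by nlinarith) (by positivity)]
      nlinarith
    exact (mul_le_mul_of_nonneg_left h1 (by positivity)).trans h2

lemma integral_abs_average_le (hn : 3 ≤ n) {G : α → ℝ} (hG : Measurable G) {C : ℝ}
    (hC0 : 0 < C) (hC : ∀ x, |G x| ≤ C) (h0 : ∫ x, G x ∂P = 0) :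
    ∫ x : Fin n → α, |1 / (n : ℝ) * ∑ i, G (x i)| ∂(Measure.pi fun _ => P) ≤ C / √n := by
  have hn' : (3 : ℝ) ≤ n := by exact_mod_cast hn
  have hs : 0 < √(n : ℝ) := by positivity
  refine integral_abs_le_of_integral_sq_le (C := C) (by fun_prop)
    (fun x => abs_average_le hn fun i => hC _) (by positivity) ?_
  simp_rw [mul_pow]
  rw [integral_const_mul]
  calc (1 / (n : ℝ)) ^ 2 * _ ≤ (1 / (n : ℝ)) ^ 2 * (n * C ^ 2) := by
        gcongr
        exact integral_sq_sum_eval_le hG hC h0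
    _ = _ := by
        rw [div_pow C, Real.sq_sqrt (by positivity)]
        field_simp

lemma integrable_abs_of_measurable_of_abs_le {β : Type*} [MeasurableSpace β] {μ : Measure β}
    [IsFiniteMeasure μ] {f : β → ℝ} (hf : Measurable f) {C : ℝ} (hC : ∀ x, |f x| ≤ C) :
    Integrable (fun x => |f x|) μ :=
  (integrable_of_measurable_of_abs_le hf hC).abs

/-- The averages over the pairs that contain an observation estimate the first projection. -/
lemma IsKernel.integral_abs_leaveOneMean_sub_uStat_le (hh : IsKernel h) (hn : 3 ≤ n) (i : Fin n) :
    ∫ x : Fin n → α, |(leaveOneMean h x i - uStat h x) - centeredProj P h (x i)|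
      ∂(Measure.pi fun _ => P) ≤ 10 / √n := by
  have hn' : (3 : ℝ) ≤ n := by exact_mod_cast hn
  set μ := Measure.pi fun _ : Fin n => P
  have hmr : ∀ i, Measurable fun x : Fin n → α => leaveOneMean h x i - proj P h (x i) := fun i =>
    (hh.measurable_leaveOneMean i).sub (hh.measurable_proj_eval i)
  have hbr : ∀ i (x : Fin n → α), |leaveOneMean h x i - proj P h (x i)| ≤ 2 := by
    intro i x
    have h1 := abs_le.1 (hh.abs_leaveOneMean_le hn x i)
    have h2 := abs_le.1 (hh.abs_proj_le (P := P) (x i))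
    rw [_root_.abs_le]
    constructor <;> linarith
  have hir : ∀ i, Integrable (fun x : Fin n → α => |leaveOneMean h x i - proj P h (x i)|) μ :=
    fun i => integrable_abs_of_measurable_of_abs_le (hmr i) (hbr i)
  have hia : Integrable (fun x : Fin n → α => |1 / (n : ℝ) * ∑ k, centeredProj P h (x k)|) μ := by
    have := hh.measurable_centeredProj (P := P)
    exact integrable_abs_of_measurable_of_abs_le (by fun_prop) fun x => abs_average_le hn fun k =>
      hh.abs_centeredProj_le (x k)
  have his : Integrable (fun x : Fin n → α =>
      1 / (n : ℝ) * ∑ k, |leaveOneMean h x k - proj P h (x k)|) μ :=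
    (integrable_finsetSum _ fun k _ => hir k).const_mul _
  have hpt : ∀ x : Fin n → α, |(leaveOneMean h x i - uStat h x) - centeredProj P h (x i)| ≤
      |leaveOneMean h x i - proj P h (x i)| +
        (1 / (n : ℝ) * ∑ k, |leaveOneMean h x k - proj P h (x k)| +
          |1 / (n : ℝ) * ∑ k, centeredProj P h (x k)|) := by
    intro x
    have e1 : (leaveOneMean h x i - uStat h x) - centeredProj P h (x i) =
        (leaveOneMean h x i - proj P h (x i)) -
          (1 / (n : ℝ) * ∑ k, (leaveOneMean h x k - proj P h (x k)) +
            1 / (n : ℝ) * ∑ k, centeredProj P h (x k)) := by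
      rw [uStat_eq_average, ← mul_add, ← Finset.sum_add_distrib]
      have : ∀ k, leaveOneMean h x k - proj P h (x k) + centeredProj P h (x k) =
          leaveOneMean h x k - kernelMean P h := fun k => by rw [centeredProj]; ring
      simp_rw [this]
      rw [Finset.sum_sub_distrib, mul_sub, Finset.sum_const, Finset.card_fin, nsmul_eq_mul,
        centeredProj]
      field_simp
      ring
    rw [e1]
    refine (abs_sub _ _).trans (add_le_add le_rfl ((abs_add_le _ _).trans (add_le_add ?_ le_rfl)))
    rw [abs_mul, abs_of_pos (by positivity)]
    gcongr
    exact Finset.abs_sum_le_sum_abs _ _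
  calc _ ≤ ∫ x : Fin n → α, (|leaveOneMean h x i - proj P h (x i)| +
        (1 / (n : ℝ) * ∑ k, |leaveOneMean h x k - proj P h (x k)| +
          |1 / (n : ℝ) * ∑ k, centeredProj P h (x k)|)) ∂μ :=
        integral_mono_of_nonneg (Eventually.of_forall fun _ => abs_nonneg _)
          ((hir i).add (his.add hia)) (Eventually.of_forall hpt)
    _ = ∫ x : Fin n → α, |leaveOneMean h x i - proj P h (x i)| ∂μ +
          (1 / (n : ℝ) * ∑ k, ∫ x : Fin n → α, |leaveOneMean h x k - proj P h (x k)| ∂μ +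
            ∫ x : Fin n → α, |1 / (n : ℝ) * ∑ k, centeredProj P h (x k)| ∂μ) := by
        have hisa : Integrable (fun x : Fin n → α =>
          1 / (n : ℝ) * ∑ k, |leaveOneMean h x k - proj P h (x k)| +
            |1 / (n : ℝ) * ∑ k, centeredProj P h (x k)|) μ := his.add hia
        rw [integral_add (hir i) hisa, integral_add his hia, integral_const_mul,
          integral_finsetSum _ fun k _ => hir k]
    -- The three contributions are the error of the leave-one mean at `i`, the average of these
    -- errors inside the U-statistic, and the sample mean of the centered projection, which is
    -- bounded by 2.
    _ ≤ 4 / √n + (1 / (n : ℝ) * ∑ _k : Fin n, 4 / √n + 2 / √n) := by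
        gcongr with k
        · exact hh.integral_abs_leaveOneMean_sub_le hn i
        · exact hh.integral_abs_leaveOneMean_sub_le hn k
        · exact integral_abs_average_le hn hh.measurable_centeredProj two_pos
            hh.abs_centeredProj_le hh.integral_centeredProj
    _ = 10 / √n := by
        rw [Finset.sum_const, Finset.card_fin, nsmul_eq_mul]
        field_simp
        ring

/-- Consistency of the jackknife variance estimator, with a rate. -/
lemma IsKernel.integral_abs_jackknifeMean_sub_le (hh : IsKernel h) (hn : 3 ≤ n) :
    ∫ x : Fin n → α, |jackknifeMean h x - projVar P h| ∂(Measure.pi fun _ => P) ≤ 44 / √n := by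
  have hn' : (3 : ℝ) ≤ n := by exact_mod_cast hn
  set μ := Measure.pi fun _ : Fin n => P
  have hmc := hh.measurable_centeredProj (P := P)
  have hbd : ∀ i (x : Fin n → α), |leaveOneMean h x i - uStat h x| ≤ 2 := by
    intro i x
    have h1 := abs_le.1 (hh.abs_leaveOneMean_le hn x i)
    have h2 := abs_le.1 (hh.abs_uStat_le hn x)
    rw [_root_.abs_le]
    constructor <;> linarith
  have hmd : ∀ i, Measurable fun x : Fin n → α =>
      (leaveOneMean h x i - uStat h x) - centeredProj P h (x i) := fun i =>
    ((hh.measurable_leaveOneMean i).sub hh.measurable_uStat).sub (hmc.comp (measurable_pi_apply i))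
  have hid : ∀ i, Integrable (fun x : Fin n → α =>
      |(leaveOneMean h x i - uStat h x) - centeredProj P h (x i)|) μ := fun i =>
    integrable_abs_of_measurable_of_abs_le (C := 4) (hmd i) fun x => by
      have h1 := abs_le.1 (hbd i x)
      have h2 := abs_le.1 (hh.abs_centeredProj_le (P := P) (x i))
      rw [_root_.abs_le]
      constructor <;> linarith
  have hsq : ∀ x, |centeredProj P h x ^ 2| ≤ 4 := fun x => by
    have := pow_le_pow_left₀ (abs_nonneg _) (hh.abs_centeredProj_le (P := P) x) 2
    rw [abs_pow]
    linarith
  have hv0 : 0 ≤ projVar P h := integral_nonneg fun x => sq_nonneg _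
  have hv : projVar P h ≤ 4 := (abs_le.1 (abs_integral_le_of_abs_le hsq)).2
  have hGm : Measurable fun y => centeredProj P h y ^ 2 - projVar P h := by fun_prop
  have hGb : ∀ y, |centeredProj P h y ^ 2 - projVar P h| ≤ 4 := fun y => by
    have h1 := (abs_le.1 (hsq y)).2
    have h2 := sq_nonneg (centeredProj P h y)
    rw [_root_.abs_le]
    constructor <;> linarith
  have hG0 : ∫ y, (centeredProj P h y ^ 2 - projVar P h) ∂P = 0 := by
    rw [integral_sub (integrable_of_measurable_of_abs_le (by fun_prop) hsq) (integrable_const _)]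
    simp [projVar]
  have hiG : Integrable (fun x : Fin n → α =>
      |1 / (n : ℝ) * ∑ k, (centeredProj P h (x k) ^ 2 - projVar P h)|) μ :=
    integrable_abs_of_measurable_of_abs_le (by fun_prop) fun x => abs_average_le hn fun k =>
      hGb (x k)
  have his : Integrable (fun x : Fin n → α => 1 / (n : ℝ) * ∑ k,
      4 * |(leaveOneMean h x k - uStat h x) - centeredProj P h (x k)|) μ :=
    (integrable_finsetSum _ fun k _ => (hid k).const_mul 4).const_mul _
  have hpt : ∀ x : Fin n → α, |jackknifeMean h x - projVar P h| ≤
      1 / (n : ℝ) * ∑ k, 4 * |(leaveOneMean h x k - uStat h x) - centeredProj P h (x k)| +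
        |1 / (n : ℝ) * ∑ k, (centeredProj P h (x k) ^ 2 - projVar P h)| := by
    intro x
    -- The first part is controlled by `|A² - B²| ≤ 4 |A - B|` for `|A|, |B| ≤ 2`; the second is a
    -- law of large numbers for the squared projections.
    have e1 : jackknifeMean h x - projVar P h =
        1 / (n : ℝ) * ∑ k, ((leaveOneMean h x k - uStat h x) ^ 2 - centeredProj P h (x k) ^ 2) +
          1 / (n : ℝ) * ∑ k, (centeredProj P h (x k) ^ 2 - projVar P h) := by
      rw [Finset.sum_sub_distrib, Finset.sum_sub_distrib, Finset.sum_const, Finset.card_fin,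
        nsmul_eq_mul, jackknifeMean]
      field_simp
      ring
    rw [e1]
    refine (abs_add_le _ _).trans (add_le_add ?_ le_rfl)
    rw [abs_mul, abs_of_pos (by positivity)]
    gcongr
    refine (Finset.abs_sum_le_sum_abs _ _).trans (Finset.sum_le_sum fun k _ => ?_)
    rw [sq_sub_sq, abs_mul]
    gcongr
    have h1 := abs_le.1 (hbd k x)
    have h2 := abs_le.1 (hh.abs_centeredProj_le (P := P) (x k))
    rw [_root_.abs_le]
    constructor <;> linarith
  calc _ ≤ ∫ x : Fin n → α, (1 / (n : ℝ) * ∑ k,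
        4 * |(leaveOneMean h x k - uStat h x) - centeredProj P h (x k)| +
        |1 / (n : ℝ) * ∑ k, (centeredProj P h (x k) ^ 2 - projVar P h)|) ∂μ :=
        integral_mono_of_nonneg (Eventually.of_forall fun _ => abs_nonneg _)
          (his.add hiG) (Eventually.of_forall hpt)
    _ = 1 / (n : ℝ) * ∑ k, 4 * ∫ x : Fin n → α,
          |(leaveOneMean h x k - uStat h x) - centeredProj P h (x k)| ∂μ +
        ∫ x : Fin n → α, |1 / (n : ℝ) * ∑ k, (centeredProj P h (x k) ^ 2 - projVar P h)| ∂μ := by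
        rw [integral_add his hiG, integral_const_mul,
          integral_finsetSum _ fun k _ => (hid k).const_mul 4]
        simp_rw [integral_const_mul]
    _ ≤ 1 / (n : ℝ) * ∑ _k : Fin n, 4 * (10 / √n) + 4 / √n := by
        gcongr with k
        · exact hh.integral_abs_leaveOneMean_sub_uStat_le hn k
        · exact integral_abs_average_le hn hGm four_pos hGb hG0
    _ = 44 / √n := by
        rw [Finset.sum_const, Finset.card_fin, nsmul_eq_mul]
        field_simp
        ring

/-- The remainder of the first order approximation of a U-statistic. -/
def hajekRemainder (P : Measure α) (h : α → α → ℝ) (x : Fin n → α) : ℝ :=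
  uStat h x - kernelMean P h - 2 / (n : ℝ) * ∑ i, centeredProj P h (x i)

lemma IsKernel.measurable_hajekRemainder (hh : IsKernel h) :
    Measurable fun x : Fin n → α => hajekRemainder P h x := by
  have := hh.measurable_centeredProj (P := P)
  have := hh.measurable_uStat (n := n)
  unfold hajekRemainder
  fun_prop

/-- Hoeffding's decomposition: once the mean and the linear part are removed, only the degenerate
kernel over pairs of distinct indices is left. -/
lemma IsKernel.hajekRemainder_eq (hh : IsKernel h) (hn : 3 ≤ n) (x : Fin n → α) :
    hajekRemainder P h x = 1 / ((n : ℝ) * ((n : ℝ) - 1)) *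
      ∑ e ∈ Finset.univ.filter (fun e : Fin n × Fin n => e.1 ≠ e.2),
        degenerateKernel P h (x e.1) (x e.2) := by
  have hn' : (3 : ℝ) ≤ n := by exact_mod_cast hn
  have h1 : (n : ℝ) - 1 ≠ 0 := by linarith
  have h2 : ∑ e ∈ Finset.univ.filter (fun e : Fin n × Fin n => e.1 ≠ e.2),
        degenerateKernel P h (x e.1) (x e.2) =
      ∑ i, ∑ j, degenerateKernel P h (x i) (x j) - ∑ i, degenerateKernel P h (x i) (x i) := by
    rw [Finset.sum_filter, Fintype.sum_prod_type, ← Finset.sum_sub_distrib]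
    refine Finset.sum_congr rfl fun i _ => ?_
    have h3 : degenerateKernel P h (x i) (x i) =
        ∑ j, if j = i then degenerateKernel P h (x i) (x j) else 0 := by simp
    rw [eq_sub_iff_add_eq, h3, ← Finset.sum_add_distrib]
    refine Finset.sum_congr rfl fun j _ => ?_
    by_cases hij : j = i
    · simp [hij]
    · simp [hij, Ne.symm hij]
  rw [h2]
  simp only [degenerateKernel, centeredProj, hajekRemainder, uStat, Finset.sum_sub_distrib,
    Finset.sum_const, Finset.card_fin, nsmul_eq_mul, hh.diag, ← Finset.mul_sum]
  field_simp
  ring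

/-- Degeneracy makes the remainder of order `1 / n` in mean square root, hence negligible against
the linear part of order `1 / √n`. -/
lemma IsKernel.integral_sq_hajekRemainder_le (hh : IsKernel h) (hn : 3 ≤ n) :
    ∫ x : Fin n → α, hajekRemainder P h x ^ 2 ∂(Measure.pi fun _ => P) ≤ 128 / n ^ 2 := by
  have hn' : (3 : ℝ) ≤ n := by exact_mod_cast hn
  simp_rw [hh.hajekRemainder_eq hn, mul_pow]
  rw [integral_const_mul]
  calc _ ≤ (1 / ((n : ℝ) * ((n : ℝ) - 1))) ^ 2 * (32 * n ^ 2) := by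
        gcongr
        exact hh.integral_sq_sum_degenerateKernel_le
    _ = 32 / ((n : ℝ) - 1) ^ 2 := by
        have h1 : (n : ℝ) - 1 ≠ 0 := by linarith
        field_simp
    _ ≤ _ := by
        rw [div_le_div_iff₀ (by nlinarith) (by positivity)]
        nlinarith

end Jackknife

/-! ### Tails of the studentized U-statistic -/

section Gaussian

/-- The standard normal density is at most 1. -/
lemma gaussianReal_real_Icc_le {a b : ℝ} (hab : a ≤ b) :
    (gaussianReal 0 1).real (Set.Icc a b) ≤ b - a := by
  have h1 : gaussianReal 0 1 (Set.Icc a b) ≤ volume (Set.Icc a b) := by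
    rw [gaussianReal_apply 0 one_ne_zero, ← one_mul (volume _), ← setLIntegral_const]
    refine setLIntegral_mono' measurableSet_Icc fun x _ => ?_
    rw [gaussianPDF, ENNReal.ofReal_le_one, gaussianPDFReal]
    have h2 : (1 : ℝ) ≤ √(2 * Real.pi * (1 : NNReal)) := by
      rw [Real.one_le_sqrt]
      have := Real.pi_gt_three
      simp
      linarith
    have h3 : Real.exp (-(x - 0) ^ 2 / (2 * (1 : NNReal))) ≤ 1 := by
      rw [Real.exp_le_one_iff]
      have : 0 ≤ (x - 0) ^ 2 := sq_nonneg _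
      simp
      linarith [sq_nonneg x]
    exact mul_le_one₀ (inv_le_one_of_one_le₀ h2) (Real.exp_nonneg _) h3
  have h2 := ENNReal.toReal_mono (by simp) h1
  rw [Real.volume_Icc, ENNReal.toReal_ofReal (by linarith)] at h2
  exact h2

lemma tendsto_gaussianReal_tail :
    Tendsto (fun K : ℕ => (gaussianReal 0 1).real {x : ℝ | (K : ℝ) < |x|}) atTop (𝓝 0) := by
  have h := tendsto_measure_iInter_atTop (μ := gaussianReal 0 1)
    (s := fun K : ℕ => {x : ℝ | (K : ℝ) < |x|})
    (fun K => (measurableSet_lt measurable_const (by fun_prop)).nullMeasurableSet)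
    (fun a b hab x hx => by
      simp only [Set.mem_ofPred_eq] at hx ⊢
      exact lt_of_le_of_lt (by exact_mod_cast hab) hx) ⟨0, by finiteness⟩
  have he : ⋂ K : ℕ, {x : ℝ | (K : ℝ) < |x|} = ∅ := by
    ext x
    simp only [Set.mem_iInter, Set.mem_ofPred_eq, Set.mem_empty_iff_false, iff_false, not_forall,
      not_lt]
    exact exists_nat_ge |x|
  rw [he, measure_empty] at h
  have h2 := (ENNReal.tendsto_toReal ENNReal.zero_ne_top).comp h
  rw [ENNReal.toReal_zero] at h2
  exact h2

/-- The two-sided normal tail is stable under small perturbations of the threshold. -/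
lemma exists_gaussianReal_tail_le {ε : ℝ} (hε : 0 < ε) :
    ∃ δ : ℝ, 0 < δ ∧ δ ≤ 1 / 2 ∧ ∀ q : ℝ, 0 ≤ q →
      (gaussianReal 0 1).real {x | (1 - δ) * q - δ < |x|} ≤
        (gaussianReal 0 1).real {x | q < |x|} + ε := by
  obtain ⟨K, hK, hK1⟩ := ((tendsto_gaussianReal_tail.eventually (gt_mem_nhds hε)).and
    (eventually_ge_atTop 1)).exists
  have hK1' : (1 : ℝ) ≤ K := by exact_mod_cast hK1
  -- Beyond `K` the tail is below `ε`. If `q ≤ 4 K`, the threshold moves by `δ (q + 1) ≤ δ (4 K +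
  -- 1)`, which costs at most this length on either side of the origin. If `q > 4 K`, then `δ ≤ 1 /
  -- 2` keeps the lowered threshold above `K`.
  refine ⟨min (1 / 2) (ε / (2 * (4 * K + 1))), by positivity, min_le_left _ _, fun q hq => ?_⟩
  set δ := min (1 / 2) (ε / (2 * (4 * K + 1))) with hδ
  have hδ0 : 0 < δ := by positivity
  have hδ1 : δ ≤ 1 / 2 := min_le_left _ _
  have hδ2 : δ * (2 * (4 * K + 1)) ≤ ε := by
    rw [← le_div_iff₀ (by positivity)]
    exact min_le_right _ _
  by_cases hqK : q ≤ 4 * K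
  · have hsub : {x : ℝ | (1 - δ) * q - δ < |x|} ⊆ {x | q < |x|} ∪
        (Set.Icc ((1 - δ) * q - δ) q ∪ Set.Icc (-q) (-((1 - δ) * q - δ))) := by
      intro x hx
      simp only [Set.mem_ofPred_eq, Set.mem_union, Set.mem_Icc] at hx ⊢
      by_cases h : q < |x|
      · exact Or.inl h
      · right
        rcases abs_cases x with ⟨h1, _⟩ | ⟨h1, _⟩
        · left; constructor <;> linarith
        · right; constructor <;> linarith
    have hle : (1 - δ) * q - δ ≤ q := by nlinarith
    have h1 := gaussianReal_real_Icc_le hle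
    have h2 := gaussianReal_real_Icc_le (neg_le_neg hle)
    calc _ ≤ _ := measureReal_mono hsub
      _ ≤ _ := measureReal_union_le _ _
      _ ≤ (gaussianReal 0 1).real {x | q < |x|} + ε := by
        refine add_le_add le_rfl ((measureReal_union_le _ _).trans ?_)
        nlinarith
  · push Not at hqK
    have hsub : {x : ℝ | (1 - δ) * q - δ < |x|} ⊆ {x | (K : ℝ) < |x|} := by
      intro x hx
      simp only [Set.mem_ofPred_eq] at hx ⊢
      nlinarith
    have := measureReal_nonneg (μ := gaussianReal 0 1) (s := {x | q < |x|})
    exact (measureReal_mono hsub).trans (by linarith)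

end Gaussian

/-! ### Uniform normal tail bound for the studentized U-statistic. -/

section Studentized

variable {α : Type*} [MeasurableSpace α] {P : Measure α} [IsProbabilityMeasure P]
  {h : α → α → ℝ}

/-- The jackknife estimator of the asymptotic variance of a U-statistic of order two. -/
def jackknifeUStatVar {n : ℕ} (h : α → α → ℝ) (x : Fin n → α) : ℝ :=
  4 * ((n : ℝ) - 1) / ((n : ℝ) - 2) ^ 2 * ∑ i, (leaveOneMean h x i - uStat h x) ^ 2

/-- The normalizations compare through `(n - 2)² ≤ n (n - 1)`. Only this direction is needed,
because an overestimated variance makes rejection rarer. -/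
lemma four_mul_jackknifeMean_le {n : ℕ} (hn : 3 ≤ n) (h : α → α → ℝ) (x : Fin n → α) :
    4 * jackknifeMean h x ≤ jackknifeUStatVar h x := by
  have hn' : (3 : ℝ) ≤ n := by exact_mod_cast hn
  have hS : 0 ≤ ∑ i, (leaveOneMean h x i - uStat h x) ^ 2 :=
    Finset.sum_nonneg fun _ _ => sq_nonneg _
  rw [jackknifeMean, jackknifeUStatVar, ← mul_assoc]
  refine mul_le_mul_of_nonneg_right ?_ hS
  rw [mul_one_div, div_le_div_iff₀ (by linarith) (by nlinarith)]
  nlinarith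

lemma measureReal_ge_le_integral_abs_div {Ω : Type*} [MeasurableSpace Ω] {μ : Measure Ω}
    [IsProbabilityMeasure μ] {X : Ω → ℝ} (hX : Integrable X μ) {a : ℝ} (ha : 0 < a) :
    μ.real {x | a ≤ |X x|} ≤ (∫ x, |X x| ∂μ) / a := by
  rw [le_div_iff₀ ha, mul_comm]
  exact mul_meas_ge_le_integral_of_nonneg (Eventually.of_forall fun x => abs_nonneg (X x)) hX.abs a

/-- The law of the standardized first projection. -/
def standardizedProjLaw (P : Measure α) (h : α → α → ℝ) : Measure ℝ :=
  P.map fun x => centeredProj P h x / √(projVar P h)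

/-- The uniform central limit theorem for the linear part of a U-statistic. -/
lemma exists_measureReal_linearPart_le {v₀ : ℝ} (hv₀ : 0 < v₀) {δ : ℝ} (hδ : 0 < δ) :
    ∃ N : ℕ, ∀ n ≥ N, ∀ (α : Type) (_ : MeasurableSpace α) (P : Measure α)
      (_ : IsProbabilityMeasure P) (h : α → α → ℝ), IsKernel h → v₀ ≤ projVar P h → ∀ t : ℝ,
      (Measure.pi fun _ : Fin n => P).real
        {x | t < |(√n)⁻¹ * ∑ i, centeredProj P h (x i) / √(projVar P h)|} ≤
          (gaussianReal 0 1).real {x | t - δ < |x|} + δ := by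
  obtain ⟨N, hN⟩ := exists_measureReal_normalizedSum_le (2 / √v₀) hδ
  refine ⟨N, fun n hn α _ P _ h hh hv t => ?_⟩
  have hv' : 0 < projVar P h := hv₀.trans_le hv
  have hs : 0 < √(projVar P h) := Real.sqrt_pos.2 hv'
  have hm := hh.measurable_centeredProj (P := P)
  have hmφ : Measurable fun x => centeredProj P h x / √(projVar P h) := by fun_prop
  have hprob : IsProbabilityMeasure (standardizedProjLaw P h) :=
    Measure.isProbabilityMeasure_map hmφ.aemeasurable
  have h1 := hN n hn (standardizedProjLaw P h) hprob ?_ ?_ ?_ t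
  · have hpi : (Measure.pi fun _ : Fin n => standardizedProjLaw P h) =
        (Measure.pi fun _ : Fin n => P).map
          fun x i => centeredProj P h (x i) / √(projVar P h) :=
      (Measure.pi_map_pi (μ := fun _ : Fin n => P) fun _ => hmφ.aemeasurable).symm
    rw [hpi, map_measureReal_apply (by fun_prop)
      (measurableSet_lt measurable_const (by fun_prop))] at h1
    exact h1
  · refine (ae_map_iff hmφ.aemeasurable (measurableSet_le (by fun_prop) measurable_const)).2
      (Eventually.of_forall fun x => ?_)
    rw [abs_div, abs_of_pos hs]
    exact div_le_div₀ (by norm_num) (hh.abs_centeredProj_le x) (Real.sqrt_pos.2 hv₀)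
      (Real.sqrt_le_sqrt hv)
  · rw [standardizedProjLaw, integral_map hmφ.aemeasurable (by fun_prop), integral_div,
      hh.integral_centeredProj, zero_div]
  · rw [standardizedProjLaw, integral_map hmφ.aemeasurable (by fun_prop)]
    simp_rw [div_pow]
    rw [integral_div, Real.sq_sqrt hv'.le]
    exact div_self hv'.ne'

/-- The tail of the studentized U-statistic is asymptotically at most the normal tail, uniformly
over the kernels whose projection has variance at least `v₀` and whose mean is at most `1 / n`. -/
lemma exists_measureReal_studentized_le {v₀ : ℝ} (hv₀ : 0 < v₀) {ε : ℝ} (hε : 0 < ε) :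
    ∃ N : ℕ, ∀ n ≥ N, ∀ (α : Type) (_ : MeasurableSpace α) (P : Measure α)
      (_ : IsProbabilityMeasure P) (h : α → α → ℝ), IsKernel h → v₀ ≤ projVar P h →
      |kernelMean P h| ≤ 1 / n → ∀ q : ℝ, 0 ≤ q →
      (Measure.pi fun _ : Fin n => P).real
        {x | √(jackknifeUStatVar h x) * q / √n < |uStat h x|} ≤
          (gaussianReal 0 1).real {x | q < |x|} + ε := by
  obtain ⟨δ, hδ0, hδ1, hδ⟩ := exists_gaussianReal_tail_le (half_pos hε)
  obtain ⟨N₁, hN₁⟩ := exists_measureReal_linearPart_le hv₀ (δ := min (δ / 2) (ε / 4))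
    (by positivity)
  have hlim : Tendsto (fun n : ℕ => √(n : ℝ)) atTop atTop :=
    Real.tendsto_sqrt_atTop.comp tendsto_natCast_atTop_atTop
  -- The three lower bounds on `n` make negligible, in this order, the error of the jackknife, the
  -- mean of the kernel and the degenerate remainder. The first and the third serve in Markov's
  -- inequality.
  obtain ⟨N₂, hN₂⟩ := eventually_atTop.1 (((hlim.eventually_ge_atTop (44 * 8 / (v₀ * δ * ε))).and
    (hlim.eventually_ge_atTop (2 / (√v₀ * δ)))).and (tendsto_natCast_atTop_atTop.eventually_ge_atTop
      (128 * 4 * 8 / (v₀ * δ ^ 2 * ε))))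
  refine ⟨max (max N₁ N₂) 3, fun n hn α _ P _ h hh hv hτ q hq => ?_⟩
  have hn1 : N₁ ≤ n := (le_max_left _ _).trans ((le_max_left _ _).trans hn)
  have hn2 : N₂ ≤ n := (le_max_right _ _).trans ((le_max_left _ _).trans hn)
  have hn3 : 3 ≤ n := (le_max_right _ _).trans hn
  have hn' : (3 : ℝ) ≤ n := by exact_mod_cast hn3
  obtain ⟨⟨hb1, hb2⟩, hb3⟩ := hN₂ n hn2
  set μ := Measure.pi fun _ : Fin n => P
  set v := projVar P h with hvdef
  set σ := √v with hσ
  have hvpos : 0 < v := hv₀.trans_le hv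
  have hσpos : 0 < σ := Real.sqrt_pos.2 hvpos
  have hσσ : σ ^ 2 = v := Real.sq_sqrt hvpos.le
  have hs : 0 < √(n : ℝ) := by positivity
  have hss : √(n : ℝ) ^ 2 = n := Real.sq_sqrt (by positivity)
  let W : (Fin n → α) → ℝ := fun x => (√n)⁻¹ * ∑ i, centeredProj P h (x i) / σ
  have hmD := hh.measurable_hajekRemainder (P := P) (n := n)
  have hmJ := hh.measurable_jackknifeMean (n := n)
  have hcent := hh.abs_centeredProj_le (P := P)
  have hbD : ∀ x : Fin n → α, |hajekRemainder P h x| ≤ 6 := by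
    intro x
    have h1 := abs_le.1 (hh.abs_uStat_le hn3 x)
    have h2 := abs_le.1 (hh.abs_kernelMean_le (P := P))
    have h3 := abs_le.1 (abs_average_le hn3 fun i => hcent (x i))
    have h4 : 2 / (n : ℝ) * ∑ i, centeredProj P h (x i) =
      2 * (1 / (n : ℝ) * ∑ i, centeredProj P h (x i)) := by ring
    rw [hajekRemainder, h4, abs_le]
    constructor <;> linarith
  have hbJ : ∀ x : Fin n → α, |jackknifeMean h x| ≤ 4 := by
    intro x
    refine abs_average_le hn3 fun i => ?_
    have h1 := abs_le.1 (hh.abs_leaveOneMean_le hn3 x i)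
    have h2 := abs_le.1 (hh.abs_uStat_le hn3 x)
    rw [abs_of_nonneg (sq_nonneg _)]
    nlinarith
  have hbad1 : μ.real {x | v * δ ≤ |jackknifeMean h x - v|} ≤ ε / 8 := by
    have h1 := measureReal_ge_le_integral_abs_div (μ := μ) (X := fun x => jackknifeMean h x - v)
      ((integrable_of_measurable_of_abs_le hmJ hbJ).sub (integrable_const _)) (a := v * δ)
      (by positivity)
    refine h1.trans ?_
    rw [div_le_iff₀ (by positivity)]
    refine (hh.integral_abs_jackknifeMean_sub_le hn3).trans ?_
    rw [div_le_iff₀ hs]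
    rw [div_le_iff₀ (by positivity)] at hb1
    have : √(n : ℝ) * (v₀ * δ * ε) ≤ √(n : ℝ) * (v * δ * ε) := by gcongr
    nlinarith
  have hbad2 : μ.real {x | (σ * δ / 2) ^ 2 / n ≤ |hajekRemainder P h x ^ 2|} ≤ ε / 8 := by
    have h1 := measureReal_ge_le_integral_abs_div (μ := μ) (X := fun x => hajekRemainder P h x ^ 2)
      (integrable_of_measurable_of_abs_le (by fun_prop) (C := 6 ^ 2) fun x => by
        rw [abs_pow]; exact pow_le_pow_left₀ (abs_nonneg _) (hbD x) 2)
      (a := (σ * δ / 2) ^ 2 / n) (by positivity)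
    refine h1.trans ?_
    rw [div_le_iff₀ (by positivity)]
    simp_rw [abs_of_nonneg (sq_nonneg (hajekRemainder P h _))]
    refine (hh.integral_sq_hajekRemainder_le hn3).trans ?_
    rw [div_le_iff₀ (by positivity)] at hb3 ⊢
    have e1 : ε / 8 * ((σ * δ / 2) ^ 2 / n) * n ^ 2 = n * (v * δ ^ 2 * ε) / 32 := by
      rw [div_pow, mul_pow, hσσ]
      field_simp
      ring
    rw [e1]
    have : (n : ℝ) * (v₀ * δ ^ 2 * ε) ≤ n * (v * δ ^ 2 * ε) := by gcongr
    linarith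
  have hclt := hN₁ n hn1 α inferInstance P inferInstance h hh hv ((1 - δ) * q - δ / 2)
  -- Outside the two bad events the estimated standard deviation is at least `2 σ (1 - δ)`, and `√n
  -- |U| ≤ σ δ + 2 σ |W|`. Exceeding the threshold then forces `|W| > (1 - δ) q - δ / 2`.
  have hsub : {x : Fin n → α | √(jackknifeUStatVar h x) * q / √n < |uStat h x|} ⊆
      {x | (1 - δ) * q - δ / 2 < |W x|} ∪ ({x | v * δ ≤ |jackknifeMean h x - v|} ∪
        {x | (σ * δ / 2) ^ 2 / n ≤ |hajekRemainder P h x ^ 2|}) := by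
    intro x hx
    simp only [Set.mem_ofPred_eq, Set.mem_union] at hx ⊢
    by_contra! hcon
    obtain ⟨hc1, hc2, hc3⟩ := hcon
    -- the variance estimator is not too small
    have hJ : 2 * (σ * (1 - δ)) ≤ √(jackknifeUStatVar h x) := by
      refine Real.le_sqrt_of_sq_le ?_
      have h1 := (abs_lt.1 hc2).1
      have h2 := four_mul_jackknifeMean_le hn3 h x
      have h3 : (2 * (σ * (1 - δ))) ^ 2 = 4 * (v * (1 - δ) ^ 2) := by rw [← hσσ]; ring
      rw [h3]
      nlinarith [mul_nonneg hvpos.le (mul_nonneg hδ0.le (by linarith : (0 : ℝ) ≤ 1 - δ))]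
    have hD : √(n : ℝ) * |hajekRemainder P h x| ≤ σ * δ / 2 := by
      refine le_of_sq_le_sq ?_ (by positivity)
      rw [abs_of_nonneg (sq_nonneg _), lt_div_iff₀ (by linarith)] at hc3
      rw [mul_pow, hss, sq_abs]
      linarith
    have hT : √(n : ℝ) * |kernelMean P h| ≤ σ * δ / 2 := by
      rw [div_le_iff₀ (by positivity)] at hb2
      have h1 : √v₀ ≤ σ := Real.sqrt_le_sqrt hv
      have h2 : √(n : ℝ) * |kernelMean P h| ≤ √(n : ℝ) * (1 / n) := by gcongr
      have h3 : √(n : ℝ) * (1 / n) = 1 / √(n : ℝ) := by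
        rw [← hss]
        field_simp
        rw [Real.sqrt_sq hs.le]
      have h4 : 1 / √(n : ℝ) ≤ σ * δ / 2 := by
        rw [div_le_iff₀ hs]
        have : √(n : ℝ) * (√v₀ * δ) ≤ √(n : ℝ) * (σ * δ) := by gcongr
        linarith
      linarith
    have hdec : √(n : ℝ) * uStat h x = √(n : ℝ) * kernelMean P h + 2 * σ * W x +
        √(n : ℝ) * hajekRemainder P h x := by
      simp only [W, hajekRemainder, ← Finset.sum_div]
      have : (n : ℝ)⁻¹ * √(n : ℝ) = (√(n : ℝ))⁻¹ := by
        rw [← hss, Real.sqrt_sq hs.le]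
        field_simp
      field_simp
      rw [hss]
      ring
    have hU : √(n : ℝ) * |uStat h x| ≤ σ * δ + 2 * σ * |W x| := by
      calc √(n : ℝ) * |uStat h x| = |√(n : ℝ) * uStat h x| := by rw [abs_mul, abs_of_pos hs]
        _ ≤ |√(n : ℝ) * kernelMean P h| + |2 * σ * W x| + |√(n : ℝ) * hajekRemainder P h x| := by
          rw [hdec]
          exact abs_add_three _ _ _
        _ = √(n : ℝ) * |kernelMean P h| + 2 * σ * |W x| + √(n : ℝ) * |hajekRemainder P h x| := by
          rw [abs_mul _ (kernelMean P h), abs_mul (2 * σ), abs_mul _ (hajekRemainder P h x),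
            abs_of_pos hs, abs_of_pos (by positivity : (0 : ℝ) < 2 * σ)]
        _ ≤ _ := by linarith
    rw [div_lt_iff₀ hs] at hx
    have h5 : 2 * (σ * (1 - δ)) * q ≤ √(jackknifeUStatVar h x) * q := by gcongr
    have h6 : 2 * σ * |W x| ≤ 2 * σ * ((1 - δ) * q - δ / 2) := by gcongr
    nlinarith
  have hmin1 := min_le_left (δ / 2) (ε / 4)
  have hmin2 := min_le_right (δ / 2) (ε / 4)
  have hg : (gaussianReal 0 1).real {x | (1 - δ) * q - δ / 2 - min (δ / 2) (ε / 4) < |x|} ≤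
      (gaussianReal 0 1).real {x | (1 - δ) * q - δ < |x|} := by
    refine measureReal_mono fun x hx => ?_
    simp only [Set.mem_ofPred_eq] at hx ⊢
    linarith
  -- The budget `ε` is spent as `ε / 8` on each bad event, at most `ε / 4` on the central limit
  -- theorem and `ε / 2` on the shift of the normal threshold.
  calc _ ≤ _ := measureReal_mono hsub
    _ ≤ μ.real {x | (1 - δ) * q - δ / 2 < |W x|} + (ε / 8 + ε / 8) := by
      refine (measureReal_union_le _ _).trans (add_le_add le_rfl ?_)
      exact (measureReal_union_le _ _).trans (add_le_add hbad1 hbad2)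
    _ ≤ _ := by
      have := hδ q hq
      linarith

end Studentized

/-! ### Signs -/

section Sign

lemma measurable_realSign : Measurable Real.sign := by
  unfold Real.sign
  exact Measurable.ite measurableSet_Iio measurable_const
    (Measurable.ite measurableSet_Ioi measurable_const measurable_const)

lemma abs_realSign_le (x : ℝ) : |Real.sign x| ≤ 1 := by
  rcases Real.sign_apply_eq x with h | h | h <;> simp [h]

lemma realSign_mul (x y : ℝ) : Real.sign (x * y) = Real.sign x * Real.sign y := by
  rcases lt_trichotomy x 0 with hx | rfl | hx
  · rcases lt_trichotomy y 0 with hy | rfl | hy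
    · simp [Real.sign_of_neg hx, Real.sign_of_neg hy,
        Real.sign_of_pos (mul_pos_of_neg_of_neg hx hy)]
    · simp
    · simp [Real.sign_of_neg hx, Real.sign_of_pos hy,
        Real.sign_of_neg (mul_neg_of_neg_of_pos hx hy)]
  · simp
  · rcases lt_trichotomy y 0 with hy | rfl | hy
    · simp [Real.sign_of_pos hx, Real.sign_of_neg hy,
        Real.sign_of_neg (mul_neg_of_pos_of_neg hx hy)]
    · simp
    · simp [Real.sign_of_pos hx, Real.sign_of_pos hy, Real.sign_of_pos (mul_pos hx hy)]

lemma realSign_mul_self {x : ℝ} (hx : x ≠ 0) : Real.sign x * Real.sign x = 1 := by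
  rcases Real.sign_apply_eq_of_ne_zero x hx with h | h <;> simp [h]

lemma integral_eq_mul_of_forall_Ioo {f : ℝ → ℝ} {a b c : ℝ} (hab : a ≤ b)
    (h : ∀ x ∈ Set.Ioo a b, f x = c) : ∫ x in a..b, f x = c * (b - a) := by
  rw [intervalIntegral.integral_of_le hab, integral_Ioc_eq_integral_Ioo,
    setIntegral_congr_fun measurableSet_Ioo h, setIntegral_const]
  simp [Real.volume_real_Ioo_of_le hab, mul_comm]

/-- The integral over the circle of the product of the signs of two linear forms at angle `β`. -/
lemma integral_sign_cos_mul_sign_cos_sub {β : ℝ} (h0 : 0 ≤ β) (hπ : β ≤ Real.pi) :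
    ∫ θ in (0)..(2 * Real.pi), Real.sign (Real.cos θ) * Real.sign (Real.cos (θ - β)) =
      2 * Real.pi - 4 * β := by
  set F : ℝ → ℝ := fun θ => Real.sign (Real.cos θ) * Real.sign (Real.cos (θ - β)) with hF
  have hper : Function.Periodic F (2 * Real.pi) := by
    intro θ
    simp only [hF]
    rw [Real.cos_add_two_pi, show θ + 2 * Real.pi - β = θ - β + 2 * Real.pi by ring,
      Real.cos_add_two_pi]
  have hm : Measurable F :=
    (measurable_realSign.comp Real.measurable_cos).mul
      (measurable_realSign.comp (Real.measurable_cos.comp (measurable_id.sub_const β)))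
  have hint : ∀ a b, IntervalIntegrable F volume a b := by
    intro a b
    refine (intervalIntegrable_const (c := (1 : ℝ))).mono_fun hm.aestronglyMeasurable
      (Eventually.of_forall fun θ => ?_)
    simp only [hF, norm_one, Real.norm_eq_abs, abs_mul]
    exact mul_le_one₀ (abs_realSign_le _) (abs_nonneg _) (abs_realSign_le _)
  have hpi := Real.pi_pos
  -- Starting the period at `-π/2` puts the sign changes in the order `-π/2, β - π/2, π/2, β + π/2,
  -- 3π/2` for every `β` in `[0, π]`, so no case distinction on `β` is needed.
  have h1 : ∫ θ in (0)..(2 * Real.pi), F θ =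
      ∫ θ in (-(Real.pi / 2))..(-(Real.pi / 2) + 2 * Real.pi), F θ := by
    have := hper.intervalIntegral_add_eq 0 (-(Real.pi / 2))
    rwa [zero_add] at this
  have hpos : ∀ θ, -(Real.pi / 2) < θ → θ < Real.pi / 2 → Real.sign (Real.cos θ) = 1 :=
    fun θ ha hb => Real.sign_of_pos (Real.cos_pos_of_mem_Ioo ⟨ha, hb⟩)
  have hneg : ∀ θ, Real.pi / 2 < θ → θ < Real.pi + Real.pi / 2 → Real.sign (Real.cos θ) = -1 :=
    fun θ ha hb => Real.sign_of_neg (Real.cos_neg_of_pi_div_two_lt_of_lt ha hb)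
  have hneg' : ∀ θ, -(Real.pi + Real.pi / 2) < θ → θ < -(Real.pi / 2) →
      Real.sign (Real.cos θ) = -1 := fun θ ha hb => by
    rw [← Real.cos_neg]
    exact hneg _ (by linarith) (by linarith)
  have i1 : ∫ θ in (-(Real.pi / 2))..(β - Real.pi / 2), F θ =
      -1 * (β - Real.pi / 2 - -(Real.pi / 2)) :=
    integral_eq_mul_of_forall_Ioo (by linarith) fun θ hθ => by
      simp only [hF]
      rw [hpos θ hθ.1 (by linarith [hθ.2]), hneg' _ (by linarith [hθ.1]) (by linarith [hθ.2])]
      norm_num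
  have i2 : ∫ θ in (β - Real.pi / 2)..(Real.pi / 2), F θ = 1 * (Real.pi / 2 - (β - Real.pi / 2)) :=
    integral_eq_mul_of_forall_Ioo (by linarith) fun θ hθ => by
      simp only [hF]
      rw [hpos θ (by linarith [hθ.1]) hθ.2, hpos _ (by linarith [hθ.1]) (by linarith [hθ.2])]
      norm_num
  have i3 : ∫ θ in (Real.pi / 2)..(β + Real.pi / 2), F θ = -1 * (β + Real.pi / 2 - Real.pi / 2) :=
    integral_eq_mul_of_forall_Ioo (by linarith) fun θ hθ => by
      simp only [hF]
      rw [hneg θ hθ.1 (by linarith [hθ.2]), hpos _ (by linarith [hθ.1]) (by linarith [hθ.2])]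
      norm_num
  have i4 : ∫ θ in (β + Real.pi / 2)..(-(Real.pi / 2) + 2 * Real.pi), F θ =
      1 * (-(Real.pi / 2) + 2 * Real.pi - (β + Real.pi / 2)) :=
    integral_eq_mul_of_forall_Ioo (by linarith) fun θ hθ => by
      simp only [hF]
      rw [hneg θ (by linarith [hθ.1]) (by linarith [hθ.2]), hneg _ (by linarith [hθ.1])
        (by linarith [hθ.2])]
      norm_num
  rw [h1, ← intervalIntegral.integral_add_adjacent_intervals (hint (-(Real.pi / 2))
      (β + Real.pi / 2)) (hint _ (-(Real.pi / 2) + 2 * Real.pi)),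
    ← intervalIntegral.integral_add_adjacent_intervals (hint (-(Real.pi / 2)) (Real.pi / 2))
      (hint _ (β + Real.pi / 2)),
    ← intervalIntegral.integral_add_adjacent_intervals (hint (-(Real.pi / 2)) (β - Real.pi / 2))
      (hint _ (Real.pi / 2)),
    i1, i2, i3, i4]
  ring

end Sign

/-! ### Isotropic laws -/

section Isotropic

variable {E : Type*} [NormedAddCommGroup E] [InnerProductSpace ℝ E] [FiniteDimensional ℝ E]
  [MeasurableSpace E] [BorelSpace E]

open scoped RealInnerProductSpace

/-- The reflection in the hyperplane orthogonal to the unit vector `m`. -/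
def reflect (m v : E) : E := v - (2 * ⟪m, v⟫) • m

lemma reflect_eq_reflection {m : E} (hm : ‖m‖ = 1) (v : E) :
    reflect m v = (Submodule.span ℝ {m})ᗮ.reflection v := by
  rw [Submodule.reflection_orthogonal_apply, Submodule.reflection_singleton_apply, hm, reflect]
  simp [two_smul, add_smul, two_mul]

lemma measurable_reflect (m : E) : Measurable (reflect m) := by
  unfold reflect
  fun_prop

lemma inner_reflect (m v a : E) : ⟪a, reflect m v⟫ = ⟪a, v⟫ - 2 * ⟪m, v⟫ * ⟪a, m⟫ := by
  simp [reflect, inner_sub_right, inner_smul_right]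

/-- A probability measure is isotropic if it is invariant under all reflections and does not charge
the origin. -/
structure IsIsotropic (Q : Measure E) : Prop where
  isProbabilityMeasure : IsProbabilityMeasure Q
  map_reflect : ∀ m : E, ‖m‖ = 1 → Q.map (reflect m) = Q
  singleton_zero : Q {0} = 0

variable {Q : Measure E}

lemma IsIsotropic.measure_preimage_reflect (hQ : IsIsotropic Q) {m : E} (hm : ‖m‖ = 1) {s : Set E}
    (hs : MeasurableSet s) : Q (reflect m ⁻¹' s) = Q s := by
  rw [← Measure.map_apply (measurable_reflect m) hs, hQ.map_reflect m hm]

/-- The hyperplane is the perpendicular bisector of `a` and `b`, with unit normal along `a - b`; it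
contains every vector orthogonal to both. -/
lemma exists_reflect_eq {a b : E} (hab : ‖a‖ = ‖b‖) (hne : a ≠ b) :
    ∃ m : E, ‖m‖ = 1 ∧ (∀ v, ⟪a, reflect m v⟫ = ⟪b, v⟫) ∧ (∀ v, ⟪b, reflect m v⟫ = ⟪a, v⟫) ∧
      ∀ c : E, ⟪c, a⟫ = 0 → ⟪c, b⟫ = 0 → ∀ v, ⟪c, reflect m v⟫ = ⟪c, v⟫ := by
  have hd : 0 < ‖a - b‖ := norm_pos_iff.2 (sub_ne_zero.2 hne)
  have hsq : ‖a - b‖ ^ 2 = 2 * (⟪a, a⟫ - ⟪a, b⟫) := by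
    rw [norm_sub_sq_real, real_inner_self_eq_norm_sq, hab]
    ring
  have haa : ⟪b, b⟫ = ⟪a, a⟫ := by
    rw [real_inner_self_eq_norm_sq, real_inner_self_eq_norm_sq, hab]
  have hcomm : ⟪b, a⟫ = ⟪a, b⟫ := real_inner_comm _ _
  refine ⟨‖a - b‖⁻¹ • (a - b), ?_, fun v => ?_, fun v => ?_, fun c hca hcb v => ?_⟩
  · rw [norm_smul, norm_inv, norm_norm, inv_mul_cancel₀ hd.ne']
  · rw [inner_reflect]
    simp only [inner_smul_left, inner_smul_right, inner_sub_left, inner_sub_right,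
      RCLike.conj_to_real]
    have : ⟪a, a⟫ - ⟪a, b⟫ = ‖a - b‖ ^ 2 / 2 := by rw [hsq]; ring
    rw [this]
    field_simp
    ring
  · rw [inner_reflect]
    simp only [inner_smul_left, inner_smul_right, inner_sub_left, inner_sub_right,
      RCLike.conj_to_real]
    have : ⟪b, a⟫ - ⟪b, b⟫ = -(‖a - b‖ ^ 2 / 2) := by rw [hsq, haa, hcomm]; ring
    rw [this]
    field_simp
    ring
  · rw [inner_reflect, inner_smul_right, inner_sub_right, hca, hcb]
    simp

/-- An isotropic law does not charge hyperplanes. -/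
lemma IsIsotropic.measure_inner_eq_zero (hQ : IsIsotropic Q) {a : E} (ha : ‖a‖ = 1) :
    Q {w | ⟪a, w⟫ = 0} = 0 := by
  have := hQ.isProbabilityMeasure
  have hmeas : ∀ b : E, MeasurableSet {w : E | ⟪b, w⟫ = 0} := fun b =>
    measurableSet_eq_fun (by fun_prop) measurable_const
  -- Reflections give all hyperplanes through the origin the same mass, so one null hyperplane
  -- suffices. Fubini against Lebesgue measure supplies it: for fixed `w ≠ 0`, the normals `b`
  -- orthogonal to `w` form a proper subspace.
  have hconst : ∀ b : E, ‖b‖ = 1 → Q {w | ⟪b, w⟫ = 0} = Q {w | ⟪a, w⟫ = 0} := by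
    intro b hb
    by_cases hab : a = b
    · rw [hab]
    · obtain ⟨m, hm, h1, -, -⟩ := exists_reflect_eq (ha.trans hb.symm) hab
      rw [← hQ.measure_preimage_reflect hm (hmeas a)]
      congr 1
      ext w
      simp [h1]
  have hs : MeasurableSet {z : E × E | ⟪z.2, z.1⟫ = 0} :=
    measurableSet_eq_fun (by fun_prop) measurable_const
  have hnull : (Q.prod volume) {z : E × E | ⟪z.2, z.1⟫ = 0} = 0 := by
    rw [Measure.prod_apply hs, lintegral_eq_zero_iff (measurable_measure_prodMk_left hs)]
    have h0 : ∀ᵐ w ∂Q, w ≠ 0 := by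
      rw [ae_iff]
      simpa using hQ.singleton_zero
    filter_upwards [h0] with w hw
    have hsub : Prod.mk w ⁻¹' {z : E × E | ⟪z.2, z.1⟫ = 0} =
        ((Submodule.span ℝ {w})ᗮ : Set E) := by
      ext b
      simp [Submodule.mem_orthogonal_singleton_iff_inner_left]
    rw [hsub]
    refine Measure.addHaar_submodule _ _ fun htop => hw ?_
    have : w ∈ (Submodule.span ℝ {w})ᗮ := by rw [htop]; trivial
    rw [Submodule.mem_orthogonal_singleton_iff_inner_left] at this
    exact inner_self_eq_zero.1 this
  have hswap : ∀ᵐ b ∂(volume : Measure E), Q {w | ⟪b, w⟫ = 0} = 0 := by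
    rw [Measure.measure_prod_null hs] at hnull
    have h2 := Measure.measure_ae_null_of_prod_null (μ := (volume : Measure E)) (ν := Q)
      (s := {z : E × E | ⟪z.1, z.2⟫ = 0}) ?_
    · exact h2
    · rw [← Measure.prod_swap, Measure.map_apply measurable_swap
        (measurableSet_eq_fun (by fun_prop) measurable_const), Measure.measure_prod_null
        (measurable_swap (measurableSet_eq_fun (by fun_prop) measurable_const))]
      exact hnull
  have hnz : ∀ᵐ b ∂(volume : Measure E), b ≠ 0 := by
    have : Nontrivial E := ⟨a, 0, by intro h; simp [h] at ha⟩
    rw [ae_iff]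
    simp
  obtain ⟨b, hb, hb0⟩ := (hswap.and hnz).exists
  have h1 := hconst (‖b‖⁻¹ • b) (by
    rw [norm_smul, norm_inv, norm_norm, inv_mul_cancel₀ (norm_ne_zero_iff.2 hb0)])
  rw [← h1, ← hb]
  congr 1
  ext w
  simp [inner_smul_left, hb0]

/-- The expectation under an isotropic law of a function of two orthogonal coordinates, by
averaging over the circle. -/
lemma IsIsotropic.integral_eq_of_circle (hQ : IsIsotropic Q) {e₁ e₂ : E} (h₁ : ‖e₁‖ = 1)
    (h₂ : ‖e₂‖ = 1) (h₁₂ : ⟪e₁, e₂⟫ = 0) {f : ℝ × ℝ → ℝ} (hf : Measurable f) {C : ℝ}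
    (hC : ∀ z, |f z| ≤ C) {J : ℝ}
    (hJ : ∀ R : ℝ, 0 < R →
      ∫ θ in (0)..(2 * Real.pi), f (R * Real.cos θ, R * Real.sin θ) = J) :
    ∫ w, f (⟪e₁, w⟫, ⟪e₂, w⟫) ∂Q = J / (2 * Real.pi) := by
  have := hQ.isProbabilityMeasure
  have hpi := Real.pi_pos
  have h11 : ⟪e₁, e₁⟫ = 1 := by rw [real_inner_self_eq_norm_sq, h₁, one_pow]
  have h22 : ⟪e₂, e₂⟫ = 1 := by rw [real_inner_self_eq_norm_sq, h₂, one_pow]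
  have h21 : ⟪e₂, e₁⟫ = 0 := by rw [real_inner_comm, h₁₂]
  let r : ℝ → E → ℝ × ℝ := fun θ w =>
    (Real.cos θ * ⟪e₁, w⟫ + Real.sin θ * ⟪e₂, w⟫, Real.sin θ * ⟪e₁, w⟫ - Real.cos θ * ⟪e₂, w⟫)
  have hrm : Measurable fun z : ℝ × E => r z.1 z.2 := by
    have h1 : Measurable fun z : ℝ × E => Real.cos z.1 := Real.measurable_cos.comp measurable_fst
    have h2 : Measurable fun z : ℝ × E => Real.sin z.1 := Real.measurable_sin.comp measurable_fst
    have h3 : ∀ e : E, Measurable fun z : ℝ × E => ⟪e, z.2⟫ := fun e => by fun_prop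
    exact ((h1.mul (h3 e₁)).add (h2.mul (h3 e₂))).prodMk ((h2.mul (h3 e₁)).sub (h1.mul (h3 e₂)))
  have hinv : ∀ θ : ℝ, ∫ w, f (r θ w) ∂Q = ∫ w, f (⟪e₁, w⟫, ⟪e₂, w⟫) ∂Q := by
    intro θ
    -- In the plane of `e₁, e₂` the reflection orthogonal to this vector sends polar angle `φ` to `θ
    -- - φ`. It thus plays the role of a rotation when averaged over `θ`.
    let m : E := -Real.sin (θ / 2) • e₁ + Real.cos (θ / 2) • e₂
    have hm : ‖m‖ = 1 := by
      have : ‖m‖ ^ 2 = 1 := by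
        rw [← real_inner_self_eq_norm_sq]
        simp only [m, inner_add_left, inner_add_right, inner_smul_left, inner_smul_right, h11, h22,
          h21, h₁₂, RCLike.conj_to_real]
        linear_combination Real.sin_sq_add_cos_sq (θ / 2)
      exact (pow_eq_one_iff_of_nonneg (norm_nonneg m) two_ne_zero).1 this
    conv_rhs => rw [← hQ.map_reflect m hm]
    have hmeas : Measurable fun w : E => f (⟪e₁, w⟫, ⟪e₂, w⟫) := hf.comp (by fun_prop)
    rw [integral_map (measurable_reflect m).aemeasurable hmeas.aestronglyMeasurable]
    refine integral_congr_ae (Eventually.of_forall fun w => ?_)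
    have hθ : 2 * (θ / 2) = θ := by ring
    have hc' : Real.cos θ = 2 * Real.cos (θ / 2) ^ 2 - 1 := by
      rw [← Real.cos_two_mul, hθ]
    have hc : Real.cos θ = 1 - 2 * Real.sin (θ / 2) ^ 2 := by
      linarith [Real.sin_sq_add_cos_sq (θ / 2)]
    have hs : Real.sin θ = 2 * Real.sin (θ / 2) * Real.cos (θ / 2) := by
      rw [← Real.sin_two_mul, hθ]
    simp only [r]
    congr 2
    · rw [inner_reflect]
      simp only [m, inner_add_left, inner_add_right, inner_smul_left, inner_smul_right, h11, h₁₂,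
        RCLike.conj_to_real]
      rw [hc, hs]
      ring
    · rw [inner_reflect]
      simp only [m, inner_add_left, inner_add_right, inner_smul_left, inner_smul_right, h22, h21,
        RCLike.conj_to_real]
      rw [hc', hs]
      ring
  have hcirc : ∀ w : E, ⟪e₁, w⟫ ≠ 0 → ∫ θ in (0)..(2 * Real.pi), f (r θ w) = J := by
    intro w hw
    set z : ℂ := ⟨⟪e₁, w⟫, ⟪e₂, w⟫⟩ with hz
    have hz0 : z ≠ 0 := fun h => hw (by simpa [hz] using congrArg Complex.re h)
    have hR : 0 < ‖z‖ := norm_pos_iff.2 hz0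
    have hre : ⟪e₁, w⟫ = ‖z‖ * Real.cos z.arg := by rw [Complex.norm_mul_cos_arg]
    have him : ⟪e₂, w⟫ = ‖z‖ * Real.sin z.arg := by rw [Complex.norm_mul_sin_arg]
    have heq : ∀ θ, r θ w = (‖z‖ * Real.cos (θ - z.arg), ‖z‖ * Real.sin (θ - z.arg)) := by
      intro θ
      simp only [r]
      rw [hre, him, Real.cos_sub, Real.sin_sub]
      rw [Prod.mk.injEq]
      constructor <;> ring
    simp_rw [heq]
    rw [intervalIntegral.integral_comp_sub_right
      (fun θ => f (‖z‖ * Real.cos θ, ‖z‖ * Real.sin θ)), ← hJ ‖z‖ hR]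
    have hper : Function.Periodic (fun θ => f (‖z‖ * Real.cos θ, ‖z‖ * Real.sin θ))
        (2 * Real.pi) := fun θ => by simp
    have := hper.intervalIntegral_add_eq (0 - z.arg) 0
    rw [zero_add] at this
    rw [← this]
    ring_nf
  have hae : ∀ᵐ w ∂Q, ∫ θ in (0)..(2 * Real.pi), f (r θ w) = J := by
    have h0 : ∀ᵐ w ∂Q, ⟪e₁, w⟫ ≠ 0 := by
      rw [ae_iff]
      simpa using hQ.measure_inner_eq_zero h₁
    filter_upwards [h0] with w hw using hcirc w hw
  have hswap : ∫ θ in (0)..(2 * Real.pi), (∫ w, f (r θ w) ∂Q) =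
      ∫ w, (∫ θ in (0)..(2 * Real.pi), f (r θ w)) ∂Q := by
    have hle : 0 ≤ 2 * Real.pi := by positivity
    simp_rw [intervalIntegral.integral_of_le hle]
    refine integral_integral_swap ?_
    exact integrable_of_measurable_of_abs_le (hf.comp hrm) fun z => hC _
  rw [integral_congr_ae hae] at hswap
  simp_rw [hinv] at hswap
  rw [intervalIntegral.integral_const, integral_const, smul_eq_mul] at hswap
  simp at hswap
  rw [eq_div_iff (by positivity)]
  linarith

/-- The sign correlation of two linear forms of an isotropic vector. -/
lemma IsIsotropic.integral_sign_mul_sign (hQ : IsIsotropic Q) {a b : E} (ha : ‖a‖ = 1)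
    (hb : ‖b‖ = 1) :
    ∫ w, Real.sign ⟪a, w⟫ * Real.sign ⟪b, w⟫ ∂Q = 2 / Real.pi * Real.arcsin ⟪a, b⟫ := by
  have := hQ.isProbabilityMeasure
  have hpi := Real.pi_pos
  have haa : ⟪a, a⟫ = 1 := by rw [real_inner_self_eq_norm_sq, ha, one_pow]
  have hbb : ⟪b, b⟫ = 1 := by rw [real_inner_self_eq_norm_sq, hb, one_pow]
  have h0 : ∀ᵐ w ∂Q, ⟪a, w⟫ ≠ 0 := by
    rw [ae_iff]
    simpa using hQ.measure_inner_eq_zero ha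
  have hle := abs_le.1 ((abs_real_inner_le_norm a b).trans_eq (by rw [ha, hb, one_mul]))
  by_cases h1 : ⟪a, b⟫ = 1
  · have hab : a = b := (inner_eq_one_iff_of_norm_eq_one (𝕜 := ℝ) ha hb).1 h1
    subst hab
    rw [integral_congr_ae (g := fun _ => (1 : ℝ))
      (by filter_upwards [h0] with w hw using realSign_mul_self hw), haa, Real.arcsin_one]
    simp
  by_cases h2 : ⟪a, b⟫ = -1
  · have hab : a = -b := (inner_eq_one_iff_of_norm_eq_one (𝕜 := ℝ) ha (by simpa using hb)).1
      (by rw [inner_neg_right, h2, neg_neg])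
    have hab' : b = -a := by rw [hab, neg_neg]
    subst hab'
    rw [integral_congr_ae (g := fun _ => (-1 : ℝ)) (by
      filter_upwards [h0] with w hw
      rw [inner_neg_left, Real.sign_neg, mul_neg, realSign_mul_self hw]), h2, Real.arcsin_neg_one]
    simp
  set ρ := ⟪a, b⟫ with hρ
  have hρ1 : ρ < 1 := lt_of_le_of_ne hle.2 h1
  have hρ2 : -1 < ρ := lt_of_le_of_ne hle.1 (Ne.symm h2)
  set s := √(1 - ρ ^ 2) with hs
  have hs0 : 0 < s := Real.sqrt_pos.2 (by nlinarith)
  have hss : s ^ 2 = 1 - ρ ^ 2 := Real.sq_sqrt (by nlinarith)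
  set e := s⁻¹ • (b - ρ • a) with he
  have hba : ⟪b, a⟫ = ρ := real_inner_comm _ _
  have hae : ⟪a, e⟫ = 0 := by
    rw [he, inner_smul_right, inner_sub_right, inner_smul_right, haa, ← hρ]
    ring
  have hee : ‖e‖ = 1 := by
    have : ‖e‖ ^ 2 = 1 := by
      rw [← real_inner_self_eq_norm_sq, he]
      simp only [inner_smul_left, inner_smul_right, inner_sub_left, inner_sub_right, haa, hbb, hba,
        ← hρ, RCLike.conj_to_real]
      field_simp
      rw [hss]
      ring
    exact (pow_eq_one_iff_of_nonneg (norm_nonneg e) two_ne_zero).1 this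
  have hbe : ∀ w, ⟪b, w⟫ = ρ * ⟪a, w⟫ + s * ⟪e, w⟫ := by
    intro w
    rw [he, inner_smul_left, inner_sub_left, inner_smul_left]
    simp only [RCLike.conj_to_real]
    field_simp
    ring
  -- With `b = cos β a + sin β e` and `β = arccos ρ`, the two forms on a circle of radius `R` are `R
  -- cos θ` and `R cos (θ - β)`.
  have key := hQ.integral_eq_of_circle ha hee hae
    (f := fun z => Real.sign z.1 * Real.sign (ρ * z.1 + s * z.2)) (C := 1)
    (J := 2 * Real.pi - 4 * Real.arccos ρ) ?_ ?_ ?_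
  · simp_rw [hbe]
    rw [key, Real.arcsin_eq_pi_div_two_sub_arccos]
    field_simp
    ring
  · exact (measurable_realSign.comp measurable_fst).mul (measurable_realSign.comp (by fun_prop))
  · intro z
    rw [abs_mul]
    exact mul_le_one₀ (abs_realSign_le _) (abs_nonneg _) (abs_realSign_le _)
  · intro R hR
    rw [← integral_sign_cos_mul_sign_cos_sub (Real.arccos_nonneg ρ) (Real.arccos_le_pi ρ)]
    refine intervalIntegral.integral_congr fun θ _ => ?_
    have e1 : ρ * (R * Real.cos θ) + s * (R * Real.sin θ) = R * Real.cos (θ - Real.arccos ρ) := by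
      rw [Real.cos_sub, Real.cos_arccos hle.1 hle.2, Real.sin_arccos]
      ring
    simp only [e1, realSign_mul, Real.sign_of_pos hR, one_mul]

end Isotropic

/-! ### Pairs of independent isotropic vectors -/

section IsotropicPairs

variable {E : Type*} [NormedAddCommGroup E] [InnerProductSpace ℝ E] [FiniteDimensional ℝ E]
  [MeasurableSpace E] [BorelSpace E] {Q : Measure E}

open scoped RealInnerProductSpace

lemma IsIsotropic.measurePreserving_reflect (hQ : IsIsotropic Q) {m : E} (hm : ‖m‖ = 1) :
    MeasurePreserving (reflect m) Q Q :=
  ⟨measurable_reflect m, hQ.map_reflect m hm⟩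

/-- This is what keeps `W - W'` and `W + W'` away from the origin for independent copies. -/
lemma measure_prod_norm_eq [SFinite Q] (hN : ∀ t : ℝ, Q {w | ‖w‖ = t} = 0) :
    (Q.prod Q) {z : E × E | ‖z.1‖ = ‖z.2‖} = 0 := by
  rw [Measure.measure_prod_null (measurableSet_eq_fun (by fun_prop) (by fun_prop))]
  refine Eventually.of_forall fun w => ?_
  have : Prod.mk w ⁻¹' {z : E × E | ‖z.1‖ = ‖z.2‖} = {w' | ‖w'‖ = ‖w‖} := by
    ext w'
    simp [eq_comm]
  change Q (Prod.mk w ⁻¹' _) = 0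
  rw [this]
  exact hN _

lemma IsIsotropic.map_sub (hQ : IsIsotropic Q) (hN : ∀ t : ℝ, Q {w | ‖w‖ = t} = 0) :
    IsIsotropic ((Q.prod Q).map fun z => z.1 - z.2) := by
  have := hQ.isProbabilityMeasure
  have hm : Measurable fun z : E × E => z.1 - z.2 := by fun_prop
  refine ⟨Measure.isProbabilityMeasure_map hm.aemeasurable, fun m hm' => ?_, ?_⟩
  · have h1 := (hQ.measurePreserving_reflect hm').prod (hQ.measurePreserving_reflect hm')
    rw [Measure.map_map (measurable_reflect m) hm]
    conv_rhs => rw [← h1.map_eq, Measure.map_map hm h1.measurable]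
    congr 1
    ext z
    simp only [Function.comp_apply, Prod.map_fst, Prod.map_snd, reflect, inner_sub_right]
    module
  · rw [Measure.map_apply hm (measurableSet_singleton _)]
    refine measure_mono_null (fun z hz => ?_) (measure_prod_norm_eq hN)
    have : z.1 - z.2 = 0 := hz
    simp only [Set.mem_ofPred_eq]
    rw [sub_eq_zero.1 this]

lemma IsIsotropic.map_add (hQ : IsIsotropic Q) (hN : ∀ t : ℝ, Q {w | ‖w‖ = t} = 0) :
    IsIsotropic ((Q.prod Q).map fun z => z.1 + z.2) := by
  have := hQ.isProbabilityMeasure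
  have hm : Measurable fun z : E × E => z.1 + z.2 := by fun_prop
  refine ⟨Measure.isProbabilityMeasure_map hm.aemeasurable, fun m hm' => ?_, ?_⟩
  · have h1 := (hQ.measurePreserving_reflect hm').prod (hQ.measurePreserving_reflect hm')
    rw [Measure.map_map (measurable_reflect m) hm]
    conv_rhs => rw [← h1.map_eq, Measure.map_map hm h1.measurable]
    congr 1
    ext z
    simp only [Function.comp_apply, Prod.map_fst, Prod.map_snd, reflect, inner_add_right]
    module
  · rw [Measure.map_apply hm (measurableSet_singleton _)]
    refine measure_mono_null (fun z hz => ?_) (measure_prod_norm_eq hN)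
    have : z.1 + z.2 = 0 := hz
    simp only [Set.mem_ofPred_eq]
    rw [eq_neg_of_add_eq_zero_left this, norm_neg]

lemma IsIsotropic.ae_inner_ne (hQ : IsIsotropic Q) (hN : ∀ t : ℝ, Q {w | ‖w‖ = t} = 0) {a : E}
    (ha : ‖a‖ = 1) : ∀ᵐ z ∂(Q.prod Q), ⟪a, z.1⟫ ≠ ⟪a, z.2⟫ := by
  have h := (hQ.map_sub hN).measure_inner_eq_zero ha
  rw [Measure.map_apply (by fun_prop) (measurableSet_eq_fun (by fun_prop) measurable_const)] at h
  rw [ae_iff]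
  refine measure_mono_null (fun z hz => ?_) h
  simp only [Set.mem_ofPred_eq, not_not, Set.mem_preimage, inner_sub_right] at hz ⊢
  rw [hz, sub_self]

/-- Equality of the absolute values would put `W - W'` or `W + W'` on a hyperplane, and both have
isotropic laws. -/
lemma IsIsotropic.ae_abs_inner_ne (hQ : IsIsotropic Q) (hN : ∀ t : ℝ, Q {w | ‖w‖ = t} = 0)
    {a : E} (ha : ‖a‖ = 1) : ∀ᵐ z ∂(Q.prod Q), |⟪a, z.1⟫| ≠ |⟪a, z.2⟫| := by
  have h := (hQ.map_add hN).measure_inner_eq_zero ha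
  rw [Measure.map_apply (by fun_prop) (measurableSet_eq_fun (by fun_prop) measurable_const)] at h
  have h2 : ∀ᵐ z ∂(Q.prod Q), ¬ ⟪a, z.1 + z.2⟫ = 0 := by
    rw [ae_iff]
    simpa using h
  filter_upwards [hQ.ae_inner_ne hN ha, h2] with z h3 h4 h5
  rcases abs_eq_abs.1 h5 with h6 | h6
  · exact h3 h6
  · exact h4 (by rw [inner_add_right, h6, neg_add_cancel])

/-- The Kendall kernel of two linear forms. -/
def signKernel (a b : E) (w w' : E) : ℝ :=
  Real.sign ((⟪a, w⟫ - ⟪a, w'⟫) * (⟪b, w⟫ - ⟪b, w'⟫))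

lemma signKernel_eq (a b w w' : E) :
    signKernel a b w w' = Real.sign ⟪a, w - w'⟫ * Real.sign ⟪b, w - w'⟫ := by
  rw [signKernel, realSign_mul, inner_sub_right, inner_sub_right]

lemma isKernel_signKernel (a b : E) : IsKernel (signKernel a b) where
  measurable := by
    refine measurable_realSign.comp ?_
    have h1 : ∀ c : E, Measurable fun z : E × E => ⟪c, z.1⟫ := fun c => by fun_prop
    have h2 : ∀ c : E, Measurable fun z : E × E => ⟪c, z.2⟫ := fun c => by fun_prop
    exact ((h1 a).sub (h2 a)).mul ((h1 b).sub (h2 b))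
  symm x y := by
    unfold signKernel
    congr 1
    ring
  diag x := by simp [signKernel]
  abs_le_one x y := abs_realSign_le _

/-- The kernel depends only on the difference of the two copies, whose law is again isotropic. -/
lemma IsIsotropic.kernelMean_signKernel (hQ : IsIsotropic Q)
    (hN : ∀ t : ℝ, Q {w | ‖w‖ = t} = 0) {a b : E} (ha : ‖a‖ = 1) (hb : ‖b‖ = 1) :
    kernelMean Q (signKernel a b) = 2 / Real.pi * Real.arcsin ⟪a, b⟫ := by
  have := hQ.isProbabilityMeasure
  rw [(isKernel_signKernel a b).kernelMean_eq_integral_prod,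
    ← (hQ.map_sub hN).integral_sign_mul_sign ha hb, integral_map (by fun_prop)]
  · simp_rw [signKernel_eq]
  · exact ((measurable_realSign.comp (by fun_prop)).mul
      (measurable_realSign.comp (by fun_prop))).aestronglyMeasurable

/-! #### Domination of one copy by the other in two orthogonal coordinates -/

/-- The event that the first vector exceeds the second one in the directions `a` and `b`. -/
def dominationSet (a b : E) : Set (E × E) :=
  {z | |⟪a, z.2⟫| < |⟪a, z.1⟫| ∧ |⟪b, z.2⟫| < |⟪b, z.1⟫|}

lemma measurableSet_dominationSet (a b : E) : MeasurableSet (dominationSet a b) := by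
  have h1 : ∀ c : E, Measurable fun z : E × E => |⟪c, z.1⟫| := fun c => by fun_prop
  have h2 : ∀ c : E, Measurable fun z : E × E => |⟪c, z.2⟫| := fun c => by fun_prop
  exact (measurableSet_lt (h2 a) (h1 a)).inter (measurableSet_lt (h2 b) (h1 b))

/-- The reflection that exchanges `f` and `g` leaves the coordinate along `e` unchanged; it is
applied to both copies. -/
lemma IsIsotropic.measureReal_dominationSet_eq (hQ : IsIsotropic Q) {e f g : E} (hfg : ‖f‖ = ‖g‖)
    (hef : ⟪e, f⟫ = 0) (heg : ⟪e, g⟫ = 0) :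
    (Q.prod Q).real (dominationSet e f) = (Q.prod Q).real (dominationSet e g) := by
  have := hQ.isProbabilityMeasure
  by_cases hne : f = g
  · rw [hne]
  obtain ⟨m, hm, h1, -, h3⟩ := exists_reflect_eq hfg hne
  have h4 := (hQ.measurePreserving_reflect hm).prod (hQ.measurePreserving_reflect hm)
  rw [measureReal_def, ← h4.measure_preimage (measurableSet_dominationSet e f).nullMeasurableSet,
    measureReal_def]
  congr 2
  ext z
  simp only [dominationSet, Set.mem_preimage, Set.mem_ofPred_eq, Prod.map_fst, Prod.map_snd, h1,
    h3 e hef heg]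

lemma IsIsotropic.measureReal_swap_dominationSet (hQ : IsIsotropic Q) (a b : E) :
    (Q.prod Q).real (Prod.swap ⁻¹' dominationSet a b) = (Q.prod Q).real (dominationSet a b) := by
  have := hQ.isProbabilityMeasure
  rw [measureReal_def, measureReal_def, Measure.measurePreserving_swap.measure_preimage
    (measurableSet_dominationSet a b).nullMeasurableSet]

/-- Take three orthogonal directions. Almost surely one of the two vectors has the larger absolute
coordinate in at least two of them, so six events (three pairs of directions, two orders) cover the
space. Reflections and the swap give them equal probability. -/
lemma IsIsotropic.one_sixth_le_dominationSet (hQ : IsIsotropic Q)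
    (hN : ∀ t : ℝ, Q {w | ‖w‖ = t} = 0) (hdim : 3 ≤ Module.finrank ℝ E) {e f : E} (he : ‖e‖ = 1)
    (hf : ‖f‖ = 1) (hef : ⟪e, f⟫ = 0) : 1 / 6 ≤ (Q.prod Q).real (dominationSet e f) := by
  have := hQ.isProbabilityMeasure
  obtain ⟨g, hg, heg, hfg⟩ : ∃ g : E, ‖g‖ = 1 ∧ ⟪e, g⟫ = 0 ∧ ⟪f, g⟫ = 0 := by
    set V : Submodule ℝ E := Submodule.span ℝ {e, f}
    have hV : V ≠ ⊤ := by
      intro htop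
      have h1 : Module.finrank ℝ V ≤ 2 := by
        classical
        have := finrank_span_finset_le_card (R := ℝ) (M := E) {e, f}
        rw [Finset.coe_insert, Finset.coe_singleton] at this
        exact this.trans Finset.card_le_two
      rw [htop, finrank_top] at h1
      omega
    have hVo : Vᗮ ≠ ⊥ := by
      rwa [Ne, Submodule.orthogonal_eq_bot_iff]
    obtain ⟨g, hgV, hg0⟩ := Submodule.exists_mem_ne_zero_of_ne_bot hVo
    rw [Submodule.mem_orthogonal] at hgV
    refine ⟨‖g‖⁻¹ • g, ?_, ?_, ?_⟩
    · rw [norm_smul, norm_inv, norm_norm, inv_mul_cancel₀ (norm_ne_zero_iff.2 hg0)]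
    · rw [inner_smul_right, hgV e (Submodule.subset_span (by simp)), mul_zero]
    · rw [inner_smul_right, hgV f (Submodule.subset_span (by simp)), mul_zero]
  have hfe : ⟪f, e⟫ = 0 := by rw [real_inner_comm, hef]
  have hge : ⟪g, e⟫ = 0 := by rw [real_inner_comm, heg]
  have hgf : ⟪g, f⟫ = 0 := by rw [real_inner_comm, hfg]
  have hcomm : ∀ a b : E, dominationSet a b = dominationSet b a := fun a b => by
    ext z; simp [dominationSet, and_comm]
  have h1 : (Q.prod Q).real (dominationSet e g) = (Q.prod Q).real (dominationSet e f) :=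
    hQ.measureReal_dominationSet_eq (by rw [hf, hg]) heg hef
  have h2 : (Q.prod Q).real (dominationSet f g) = (Q.prod Q).real (dominationSet e f) := by
    rw [hcomm e f]
    exact hQ.measureReal_dominationSet_eq (by rw [he, hg]) hfg hfe
  set c := (Q.prod Q).real (dominationSet e f)
  set A := dominationSet e f ∪ Prod.swap ⁻¹' dominationSet e f
  set B := dominationSet e g ∪ Prod.swap ⁻¹' dominationSet e g
  set C := dominationSet f g ∪ Prod.swap ⁻¹' dominationSet f g
  have hA : (Q.prod Q).real A ≤ 2 * c := by
    refine (measureReal_union_le _ _).trans ?_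
    rw [hQ.measureReal_swap_dominationSet, two_mul]
  have hB : (Q.prod Q).real B ≤ 2 * c := by
    refine (measureReal_union_le _ _).trans ?_
    rw [hQ.measureReal_swap_dominationSet, h1, two_mul]
  have hC : (Q.prod Q).real C ≤ 2 * c := by
    refine (measureReal_union_le _ _).trans ?_
    rw [hQ.measureReal_swap_dominationSet, h2, two_mul]
  have hcov : ∀ᵐ z ∂(Q.prod Q), z ∈ A ∪ B ∪ C := by
    filter_upwards [hQ.ae_abs_inner_ne hN he, hQ.ae_abs_inner_ne hN hf,
      hQ.ae_abs_inner_ne hN hg] with z hz1 hz2 hz3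
    simp only [A, B, C, dominationSet, Set.mem_union, Set.mem_ofPred_eq, Set.mem_preimage,
      Prod.fst_swap, Prod.snd_swap]
    rcases lt_or_gt_of_ne hz1 with h1 | h1 <;> rcases lt_or_gt_of_ne hz2 with h2 | h2 <;>
      rcases lt_or_gt_of_ne hz3 with h3 | h3 <;> tauto
  have hone : (Q.prod Q).real (A ∪ B ∪ C) = 1 := by
    have huniv : (A ∪ B ∪ C : Set (E × E)) =ᵐ[Q.prod Q] Set.univ := eventuallyEq_univ.2 hcov
    rw [measureReal_def, measure_congr huniv]
    simp
  have h3 : (Q.prod Q).real (A ∪ B ∪ C) ≤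
      (Q.prod Q).real A + (Q.prod Q).real B + (Q.prod Q).real C :=
    (measureReal_union_le _ _).trans (add_le_add (measureReal_union_le _ _) le_rfl)
  linarith

/-- If `|x'| < |x|`, both `x - x'` and `x + x'` have the sign of `x`. In general their sum is `2 x`,
so for `x ≠ 0` at least one of them has the sign of `x` and the right side cannot be negative. -/
lemma two_mul_indicator_le_sign (x x' : ℝ) :
    (if |x'| < |x| then (2 : ℝ) else 0) ≤
      (Real.sign (x - x') + Real.sign (x + x')) * Real.sign x := by
  split_ifs with h
  · rcases lt_trichotomy x 0 with hx | rfl | hx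
    · rw [abs_of_neg hx, abs_lt] at h
      rw [Real.sign_of_neg hx, Real.sign_of_neg (by linarith : x - x' < 0),
        Real.sign_of_neg (by linarith : x + x' < 0)]
      norm_num
    · simp at h
      exact absurd h (not_lt.2 (abs_nonneg _))
    · rw [abs_of_pos hx, abs_lt] at h
      rw [Real.sign_of_pos hx, Real.sign_of_pos (by linarith : 0 < x - x'),
        Real.sign_of_pos (by linarith : 0 < x + x')]
      norm_num
  · rcases lt_trichotomy x 0 with hx | rfl | hx
    · have h1 : ¬ (0 < x - x' ∧ 0 < x + x') := fun h => by linarith [h.1, h.2]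
      have h2 := (abs_le.1 (abs_realSign_le (x - x'))).2
      have h3 := (abs_le.1 (abs_realSign_le (x + x'))).2
      rw [Real.sign_of_neg hx]
      rcases le_or_gt (x - x') 0 with h4 | h4
      · rcases h4.lt_or_eq with h5 | h5
        · rw [Real.sign_of_neg h5]; linarith
        · rw [h5, Real.sign_of_neg (by linarith : x + x' < 0)]; simp
      · rw [Real.sign_of_neg (by linarith : x + x' < 0)]; linarith
    · simp
    · have h2 := (abs_le.1 (abs_realSign_le (x - x'))).1
      have h3 := (abs_le.1 (abs_realSign_le (x + x'))).1
      rw [Real.sign_of_pos hx]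
      rcases le_or_gt 0 (x - x') with h4 | h4
      · rcases h4.lt_or_eq with h5 | h5
        · rw [Real.sign_of_pos h5]; linarith
        · rw [← h5, Real.sign_of_pos (by linarith : 0 < x + x')]; simp
      · rw [Real.sign_of_pos (by linarith : 0 < x + x')]; linarith

/-- The sign of the product of two coordinates. -/
def quadrantSign (a e : E) (w : E) : ℝ := Real.sign ⟪a, w⟫ * Real.sign ⟪e, w⟫

lemma measurable_quadrantSign (a e : E) : Measurable (quadrantSign a e) :=
  (measurable_realSign.comp (by fun_prop)).mul (measurable_realSign.comp (by fun_prop))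

lemma abs_quadrantSign_le (a e w : E) : |quadrantSign a e w| ≤ 1 := by
  rw [quadrantSign, abs_mul]
  exact mul_le_one₀ (abs_realSign_le _) (abs_nonneg _) (abs_realSign_le _)

lemma abs_mul_le_one {x y : ℝ} (hx : |x| ≤ 1) (hy : |y| ≤ 1) : |x * y| ≤ 1 := by
  rw [abs_mul]
  exact mul_le_one₀ hx (abs_nonneg _) hy

/-- Flipping the coordinates of the second vector along `a` and along `e` preserves the product law.
Summed over the four sign choices, the integrand factors into two terms as in
`two_mul_indicator_le_sign`; the product is nonnegative, and at least 4 on the domination set. -/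
lemma IsIsotropic.measureReal_dominationSet_le (hQ : IsIsotropic Q) {a e : E} (ha : ‖a‖ = 1)
    (he : ‖e‖ = 1) (hae : ⟪a, e⟫ = 0) :
    (Q.prod Q).real (dominationSet a e) ≤
      ∫ z, signKernel a e z.1 z.2 * quadrantSign a e z.1 ∂(Q.prod Q) := by
  have := hQ.isProbabilityMeasure
  have hea : ⟪e, a⟫ = 0 := by rw [real_inner_comm, hae]
  have haa : ⟪a, a⟫ = 1 := by rw [real_inner_self_eq_norm_sq, ha, one_pow]
  have hee : ⟪e, e⟫ = 1 := by rw [real_inner_self_eq_norm_sq, he, one_pow]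
  set F : E × E → ℝ := fun z => signKernel a e z.1 z.2 * quadrantSign a e z.1 with hF
  have hFm : Measurable F := (isKernel_signKernel a e).measurable.mul
    ((measurable_quadrantSign a e).comp measurable_fst)
  have hFb : ∀ z, |F z| ≤ 1 := fun z =>
    abs_mul_le_one ((isKernel_signKernel a e).abs_le_one _ _) (abs_quadrantSign_le _ _ _)
  have hra : ∀ {m : E}, ‖m‖ = 1 → MeasurePreserving (Prod.map (id : E → E) (reflect m))
      (Q.prod Q) (Q.prod Q) := fun hm =>
    (MeasurePreserving.id Q).prod (hQ.measurePreserving_reflect hm)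
  have hcomp : ∀ {T : E × E → E × E}, MeasurePreserving T (Q.prod Q) (Q.prod Q) →
      ∫ z, F (T z) ∂(Q.prod Q) = ∫ z, F z ∂(Q.prod Q) := by
    intro T hT
    conv_rhs => rw [← hT.map_eq]
    rw [integral_map hT.measurable.aemeasurable hFm.aestronglyMeasurable]
  have i1 := hcomp (hra ha)
  have i2 := hcomp (hra he)
  have i3 := hcomp ((hra ha).comp (hra he))
  have hint : ∀ {T : E × E → E × E}, Measurable T → Integrable (fun z => F (T z)) (Q.prod Q) :=
    fun hT => integrable_of_measurable_of_abs_le (hFm.comp hT) fun z => hFb _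
  have hi0 : Integrable F (Q.prod Q) := hint measurable_id
  have hi1 := hint (hra ha).measurable
  have hi2 := hint (hra he).measurable
  have hi3 := hint ((hra ha).comp (hra he)).measurable
  have hsum : 4 * ∫ z, F z ∂(Q.prod Q) = ∫ z, ((F z + F (Prod.map id (reflect a) z)) +
      (F (Prod.map id (reflect e) z) +
        F ((Prod.map id (reflect a) ∘ Prod.map id (reflect e)) z))) ∂(Q.prod Q) := by
    have hi01 : Integrable (fun z => F z + F (Prod.map id (reflect a) z)) (Q.prod Q) := hi0.add hi1
    have hi23 : Integrable (fun z => F (Prod.map id (reflect e) z) +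
        F ((Prod.map id (reflect a) ∘ Prod.map id (reflect e)) z)) (Q.prod Q) := hi2.add hi3
    rw [integral_add hi01 hi23, integral_add hi0 hi1, integral_add hi2 hi3, i1, i2, i3]
    ring
  have hpt : ∀ z : E × E, (dominationSet a e).indicator (fun _ => (4 : ℝ)) z ≤
      (F z + F (Prod.map id (reflect a) z)) + (F (Prod.map id (reflect e) z) +
        F ((Prod.map id (reflect a) ∘ Prod.map id (reflect e)) z)) := by
    intro z
    have e1 : (F z + F (Prod.map id (reflect a) z)) + (F (Prod.map id (reflect e) z) +
        F ((Prod.map id (reflect a) ∘ Prod.map id (reflect e)) z)) =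
        ((Real.sign (⟪a, z.1⟫ - ⟪a, z.2⟫) + Real.sign (⟪a, z.1⟫ + ⟪a, z.2⟫)) * Real.sign ⟪a, z.1⟫) *
        ((Real.sign (⟪e, z.1⟫ - ⟪e, z.2⟫) + Real.sign (⟪e, z.1⟫ + ⟪e, z.2⟫)) *
          Real.sign ⟪e, z.1⟫) := by
      have q1 : ⟪a, z.2⟫ - 2 * ⟪a, z.2⟫ = -⟪a, z.2⟫ := by ring
      have q2 : ⟪e, z.2⟫ - 2 * ⟪e, z.2⟫ = -⟪e, z.2⟫ := by ring
      simp only [hF, signKernel, quadrantSign, Prod.map_fst, Prod.map_snd, id, inner_reflect, haa,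
        hee, hae, hea, mul_one, mul_zero, sub_zero, realSign_mul, Function.comp_apply, q1, q2,
        sub_neg_eq_add]
      ring
    rw [e1]
    have hx := two_mul_indicator_le_sign ⟪a, z.1⟫ ⟪a, z.2⟫
    have hy := two_mul_indicator_le_sign ⟪e, z.1⟫ ⟪e, z.2⟫
    set X := (Real.sign (⟪a, z.1⟫ - ⟪a, z.2⟫) + Real.sign (⟪a, z.1⟫ + ⟪a, z.2⟫)) *
      Real.sign ⟪a, z.1⟫
    set Y := (Real.sign (⟪e, z.1⟫ - ⟪e, z.2⟫) + Real.sign (⟪e, z.1⟫ + ⟪e, z.2⟫)) *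
      Real.sign ⟪e, z.1⟫
    have hX0 : 0 ≤ X := le_trans (by split_ifs <;> norm_num) hx
    have hY0 : 0 ≤ Y := le_trans (by split_ifs <;> norm_num) hy
    by_cases hz : z ∈ dominationSet a e
    · rw [Set.indicator_of_mem hz]
      rw [if_pos hz.1] at hx
      rw [if_pos hz.2] at hy
      nlinarith
    · rw [Set.indicator_of_notMem hz]
      exact mul_nonneg hX0 hY0
  have hfin := integral_mono (μ := Q.prod Q) ((integrable_const (4 : ℝ)).indicator
    (measurableSet_dominationSet a e)) ((hi0.add hi1).add (hi2.add hi3)) hpt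
  rw [integral_indicator_const _ (measurableSet_dominationSet a e), smul_eq_mul] at hfin
  have hfin' : (Q.prod Q).real (dominationSet a e) * 4 ≤ 4 * ∫ z, F z ∂(Q.prod Q) := by
    rw [hsum]
    exact hfin
  linarith

end IsotropicPairs

/-! ### Nondegeneracy of the Kendall kernel -/

section Nondegenerate

variable {E : Type*} [NormedAddCommGroup E] [InnerProductSpace ℝ E] [FiniteDimensional ℝ E]
  [MeasurableSpace E] [BorelSpace E] {Q : Measure E}

open scoped RealInnerProductSpace

/-- Jordan's inequality `sin y ≥ 2 y / π` on `[0, π/2]`, read at `y = arcsin |x|`. -/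
lemma abs_arcsin_le (x : ℝ) (hx : |x| ≤ 1) : 2 / Real.pi * |Real.arcsin x| ≤ |x| := by
  have hpi := Real.pi_pos
  have key : ∀ y : ℝ, 0 ≤ y → y ≤ 1 → 2 / Real.pi * Real.arcsin y ≤ y := by
    intro y hy0 hy1
    have h := Real.mul_le_sin (Real.arcsin_nonneg.2 hy0) (Real.arcsin_le_pi_div_two y)
    rwa [Real.sin_arcsin (by linarith) hy1] at h
  rcases le_total 0 x with h0 | h0
  · rw [abs_of_nonneg h0] at hx ⊢
    rw [abs_of_nonneg (Real.arcsin_nonneg.2 h0)]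
    exact key x h0 hx
  · rw [abs_of_nonpos h0] at hx ⊢
    rw [← abs_neg, ← Real.arcsin_neg, abs_of_nonneg (Real.arcsin_nonneg.2 (by linarith))]
    exact key (-x) (by linarith) hx

lemma IsIsotropic.abs_kernelMean_signKernel_le (hQ : IsIsotropic Q)
    (hN : ∀ t : ℝ, Q {w | ‖w‖ = t} = 0) {a b : E} (ha : ‖a‖ = 1) (hb : ‖b‖ = 1) :
    |kernelMean Q (signKernel a b)| ≤ |⟪a, b⟫| := by
  have hpi := Real.pi_pos
  rw [hQ.kernelMean_signKernel hN ha hb, abs_mul, abs_of_pos (by positivity)]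
  exact abs_arcsin_le _ ((abs_real_inner_le_norm a b).trans_eq (by rw [ha, hb, one_mul]))

/-- Gram-Schmidt applied to `a, b`. -/
lemma exists_orthonormal_inner_eq_sqrt {a b : E} (ha : ‖a‖ = 1) (hb : ‖b‖ = 1)
    (hab : |⟪a, b⟫| < 1) :
    ∃ e : E, ‖e‖ = 1 ∧ ⟪a, e⟫ = 0 ∧ ⟪b, e⟫ = √(1 - ⟪a, b⟫ ^ 2) := by
  have haa : ⟪a, a⟫ = 1 := by rw [real_inner_self_eq_norm_sq, ha, one_pow]
  have hbb : ⟪b, b⟫ = 1 := by rw [real_inner_self_eq_norm_sq, hb, one_pow]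
  have hba : ⟪b, a⟫ = ⟪a, b⟫ := real_inner_comm _ _
  set ρ := ⟪a, b⟫ with hρ
  have hρ2 : ρ ^ 2 < 1 := (sq_lt_one_iff_abs_lt_one ρ).2 hab
  set s := √(1 - ρ ^ 2) with hs
  have hs0 : 0 < s := Real.sqrt_pos.2 (by linarith)
  have hss : s ^ 2 = 1 - ρ ^ 2 := Real.sq_sqrt (by linarith)
  refine ⟨s⁻¹ • (b - ρ • a), ?_, ?_, ?_⟩
  · have h : ‖s⁻¹ • (b - ρ • a)‖ ^ 2 = 1 := by
      rw [← real_inner_self_eq_norm_sq]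
      simp only [inner_smul_left, inner_smul_right, inner_sub_left, inner_sub_right, haa, hbb, hba,
        ← hρ, RCLike.conj_to_real]
      field_simp
      rw [hss]
      ring
    exact (pow_eq_one_iff_of_nonneg (norm_nonneg _) two_ne_zero).1 h
  · rw [inner_smul_right, inner_sub_right, inner_smul_right, haa, ← hρ]
    ring
  · rw [inner_smul_right, inner_sub_right, inner_smul_right, hbb, hba]
    field_simp
    rw [hss]

/-- The first projection of the Kendall kernel of nearly orthogonal forms is nondegenerate. -/
lemma IsIsotropic.le_projVar_signKernel (hQ : IsIsotropic Q)
    (hN : ∀ t : ℝ, Q {w | ‖w‖ = t} = 0) (hdim : 3 ≤ Module.finrank ℝ E) {a b : E} (ha : ‖a‖ = 1)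
    (hb : ‖b‖ = 1) (hab : |⟪a, b⟫| ≤ 1 / 36) : 1 / 144 ≤ projVar Q (signKernel a b) := by
  have := hQ.isProbabilityMeasure
  have hpi := Real.pi_pos
  -- The direction `e` is the part of `b` orthogonal to `a`, normalized. The projection is tested
  -- against `φ`, the sign of the product of the coordinates along `a` and `e`.
  obtain ⟨e, he, hae, hbe⟩ := exists_orthonormal_inner_eq_sqrt ha hb (by linarith)
  have hk := isKernel_signKernel a b
  have hk' := isKernel_signKernel a e
  set φ := quadrantSign a e
  have hφm : Measurable φ := measurable_quadrantSign a e
  have hφb : ∀ w, |φ w| ≤ 1 := abs_quadrantSign_le a e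
  set ρ := ⟪a, b⟫ with hρ
  have hi : Integrable (fun z : E × E => signKernel a b z.1 z.2 * φ z.1) (Q.prod Q) :=
    integrable_of_measurable_of_abs_le (hk.measurable.mul (hφm.comp measurable_fst)) fun z =>
      abs_mul_le_one (hk.abs_le_one _ _) (hφb _)
  have hi' : Integrable (fun z : E × E => signKernel a e z.1 z.2 * φ z.1) (Q.prod Q) :=
    integrable_of_measurable_of_abs_le (hk'.measurable.mul (hφm.comp measurable_fst)) fun z =>
      abs_mul_le_one (hk'.abs_le_one _ _) (hφb _)
  have hbem := isKernel_signKernel b e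
  have hbi : Integrable (fun z : E × E => signKernel b e z.1 z.2) (Q.prod Q) :=
    integrable_of_measurable_of_abs_le (C := 1) hbem.measurable fun z => hbem.abs_le_one z.1 z.2
  have hib : Integrable (fun z : E × E => 1 - signKernel b e z.1 z.2) (Q.prod Q) :=
    (integrable_const _).sub hbi
  -- The forms `b` and `e` rarely disagree in sign: the integral equals `1 - (2/π) arcsin √(1 - ρ²)
  -- = (2/π) arcsin |ρ|`. This is the price of replacing `e` by `b` in the kernel.
  have hdis : ∫ z, (1 - signKernel b e z.1 z.2) ∂(Q.prod Q) ≤ |ρ| := by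
    rw [integral_sub (integrable_const _) hbi, ← hbem.kernelMean_eq_integral_prod,
      hQ.kernelMean_signKernel hN hb he, hbe, ← sq_abs ρ, ← Real.arccos_eq_arcsin (abs_nonneg ρ),
      Real.arccos]
    have h1 := abs_arcsin_le |ρ| (by rw [abs_abs]; linarith)
    rw [abs_abs, abs_of_nonneg (Real.arcsin_nonneg.2 (abs_nonneg ρ))] at h1
    have h2 : 2 / Real.pi * (Real.pi / 2 - Real.arcsin |ρ|) =
        1 - 2 / Real.pi * Real.arcsin |ρ| := by field_simp
    rw [h2]
    simp only [integral_const, probReal_univ, smul_eq_mul, mul_one]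
    linarith
  have hcmp : ∫ z, signKernel a e z.1 z.2 * φ z.1 ∂(Q.prod Q) ≤
      ∫ z, signKernel a b z.1 z.2 * φ z.1 ∂(Q.prod Q) + |ρ| := by
    calc _ ≤ ∫ z, (signKernel a b z.1 z.2 * φ z.1 + (1 - signKernel b e z.1 z.2)) ∂(Q.prod Q) := by
          refine integral_mono_ae hi' (hi.add hib) ?_
          filter_upwards [hQ.ae_inner_ne hN hb, hQ.ae_inner_ne hN he] with z hzb hze
          have h1 : ⟪b, z.1 - z.2⟫ ≠ 0 := by rw [inner_sub_right]; exact sub_ne_zero.2 hzb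
          have h2 : ⟪e, z.1 - z.2⟫ ≠ 0 := by rw [inner_sub_right]; exact sub_ne_zero.2 hze
          have h3 := abs_le.1 (abs_mul_le_one (abs_realSign_le ⟪a, z.1 - z.2⟫) (hφb z.1))
          simp only [signKernel_eq]
          rcases Real.sign_apply_eq_of_ne_zero _ h1 with h | h <;>
            rcases Real.sign_apply_eq_of_ne_zero _ h2 with h' | h' <;> rw [h, h'] <;> linarith
      _ ≤ _ := by
          rw [integral_add hi hib]
          linarith
  have hdom := (hQ.one_sixth_le_dominationSet hN hdim ha he hae).trans
    (hQ.measureReal_dominationSet_le ha he hae)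
  have hproj : ∫ z, signKernel a b z.1 z.2 * φ z.1 ∂(Q.prod Q) =
      ∫ w, proj Q (signKernel a b) w * φ w ∂Q := by
    rw [integral_prod (fun z : E × E => signKernel a b z.1 z.2 * φ z.1) hi]
    simp_rw [integral_mul_const]
    rfl
  have hτ := hQ.abs_kernelMean_signKernel_le hN ha hb
  have hg2 : Integrable (fun w => centeredProj Q (signKernel a b) w ^ 2) Q := by
    have := hk.measurable_centeredProj (P := Q)
    refine integrable_of_measurable_of_abs_le (by fun_prop) (C := 2 ^ 2) fun w => ?_
    rw [abs_pow]
    exact pow_le_pow_left₀ (abs_nonneg _) (hk.abs_centeredProj_le w) 2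
  have hpm := hk.measurable_proj (P := Q)
  -- Here `|g| ≤ 6 g² + 1/24`, and the mean of the kernel contributes at most `|ρ|`. Against the
  -- lower bound `1/6 - |ρ|` with `|ρ| ≤ 1/36` this leaves `6 Var ≥ 5/72`, more than the claimed
  -- `1/24`.
  have hub : ∫ w, proj Q (signKernel a b) w * φ w ∂Q ≤
      6 * projVar Q (signKernel a b) + (1 / 24 + |ρ|) := by
    calc _ ≤ ∫ w, (6 * centeredProj Q (signKernel a b) w ^ 2 + (1 / 24 + |ρ|)) ∂Q := by
          refine integral_mono ?_ ((hg2.const_mul 6).add (integrable_const _)) fun w => ?_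
          · exact integrable_of_measurable_of_abs_le (hpm.mul hφm) fun w =>
              abs_mul_le_one (hk.abs_proj_le w) (hφb w)
          · set τ := kernelMean Q (signKernel a b)
            have e1 : proj Q (signKernel a b) w * φ w =
                centeredProj Q (signKernel a b) w * φ w + τ * φ w := by
              rw [centeredProj]; ring
            set g := centeredProj Q (signKernel a b) w
            have h1 : τ * φ w ≤ |ρ| := by
              refine (le_abs_self _).trans ?_
              rw [abs_mul]
              nlinarith [hφb w, abs_nonneg τ, abs_nonneg (φ w)]
            have h2 : g * φ w ≤ |g| := by
              refine (le_abs_self _).trans ?_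
              rw [abs_mul]
              nlinarith [hφb w, abs_nonneg g]
            have h3 : |g| ≤ 6 * g ^ 2 + 1 / 24 := by
              rw [← sq_abs g]
              nlinarith [sq_nonneg (12 * |g| - 1)]
            simp only [e1]
            linarith
      _ = _ := by
          rw [integral_add (hg2.const_mul 6) (integrable_const _), integral_const_mul]
          simp [projVar]
  rw [hproj] at hcmp
  linarith

end Nondegenerate

/-! ### Transfer of kernels along maps -/

section Transfer

variable {α β : Type*} [MeasurableSpace α] [MeasurableSpace β] {P : Measure α}
  [IsProbabilityMeasure P]

/-- Kernel functionals are invariant under maps, up to a global sign of the kernel. -/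
lemma kernelMean_projVar_map {F : α → β} (hF : Measurable F) {h : α → α → ℝ} {k : β → β → ℝ}
    (hk : IsKernel k) {s : ℝ} (hs : s ^ 2 = 1)
    (hhk : ∀ᵐ z ∂(P.prod P), h z.1 z.2 = s * k (F z.1) (F z.2)) :
    kernelMean P h = s * kernelMean (P.map F) k ∧ projVar P h = projVar (P.map F) k := by
  have hp : ∀ᵐ x ∂P, proj P h x = s * proj (P.map F) k (F x) := by
    filter_upwards [Measure.ae_ae_of_ae_prod hhk] with x hx
    rw [proj, integral_congr_ae hx, integral_const_mul, proj,
      integral_map hF.aemeasurable (hk.measurable_right _).aestronglyMeasurable]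
  have := Measure.isProbabilityMeasure_map (μ := P) hF.aemeasurable
  have hm : kernelMean P h = s * kernelMean (P.map F) k := by
    rw [kernelMean, integral_congr_ae hp, integral_const_mul, kernelMean,
      integral_map hF.aemeasurable hk.measurable_proj.aestronglyMeasurable]
  refine ⟨hm, ?_⟩
  have hkc := hk.measurable_centeredProj (P := P.map F)
  rw [projVar, projVar, integral_map hF.aemeasurable (by fun_prop)]
  refine integral_congr_ae ?_
  filter_upwards [hp] with x hx
  rw [centeredProj, centeredProj, hx, hm, ← mul_sub, mul_pow, hs, one_mul]

end Transfer

/-! ### The uniform law on the sphere and elliptical laws -/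

section Sphere

variable {p : ℕ}

-- The surface measure of a set is defined through the volume of the cone over it. A linear isometry
-- commutes with forming cones and preserves volume.
open scoped Pointwise in
lemma toSphere_map_val_preimage (L : EuclideanSpace ℝ (Fin p) ≃ₗᵢ[ℝ] EuclideanSpace ℝ (Fin p))
    {s : Set (EuclideanSpace ℝ (Fin p))} (hs : MeasurableSet s) :
    (volume : Measure (EuclideanSpace ℝ (Fin p))).toSphere (Subtype.val ⁻¹' (L ⁻¹' s)) =
      (volume : Measure (EuclideanSpace ℝ (Fin p))).toSphere (Subtype.val ⁻¹' s) := by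
  have hL : MeasurableSet (L ⁻¹' s) := L.continuous.measurable hs
  rw [Measure.toSphere_apply' _ (measurable_subtype_coe hL),
    Measure.toSphere_apply' _ (measurable_subtype_coe hs)]
  congr 1
  have hset : Set.Ioo (0 : ℝ) 1 • (Subtype.val '' (Subtype.val ⁻¹' (L ⁻¹' s) :
      Set (Metric.sphere (0 : EuclideanSpace ℝ (Fin p)) 1))) =
      L ⁻¹' (Set.Ioo (0 : ℝ) 1 • (Subtype.val '' (Subtype.val ⁻¹' s :
      Set (Metric.sphere (0 : EuclideanSpace ℝ (Fin p)) 1)))) := by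
    ext x
    simp only [Set.mem_smul, Set.mem_preimage, Subtype.image_preimage_coe, Set.mem_inter_iff,
      mem_sphere_zero_iff_norm]
    constructor
    · rintro ⟨r, hr, y, ⟨hy1, hy2⟩, rfl⟩
      exact ⟨r, hr, L y, ⟨by simpa using hy1, hy2⟩, by simp⟩
    · rintro ⟨r, hr, y, ⟨hy1, hy2⟩, hxy⟩
      refine ⟨r, hr, L.symm y, ⟨by simpa using hy1, by simpa using hy2⟩, ?_⟩
      rw [← map_smul, hxy, L.symm_apply_apply]
  rw [hset]
  exact L.measurePreserving.measure_preimage_emb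
    L.toHomeomorph.measurableEmbedding _

lemma uniformSphere_map (L : EuclideanSpace ℝ (Fin p) ≃ₗᵢ[ℝ] EuclideanSpace ℝ (Fin p)) :
    (uniformSphere p).map L = uniformSphere p := by
  have hLm : Measurable L := L.continuous.measurable
  ext s hs
  rw [Measure.map_apply hLm hs, uniformSphere, Measure.map_apply measurable_subtype_coe (hLm hs),
    Measure.map_apply measurable_subtype_coe hs, Measure.smul_apply, Measure.smul_apply,
    toSphere_map_val_preimage L hs]

lemma isProbabilityMeasure_uniformSphere (hp : p ≠ 0) : IsProbabilityMeasure (uniformSphere p) := by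
  refine ⟨?_⟩
  have hne : Nonempty (Fin p) := ⟨⟨0, Nat.pos_of_ne_zero hp⟩⟩
  rw [uniformSphere, Measure.map_apply measurable_subtype_coe MeasurableSet.univ, Set.preimage_univ,
    Measure.smul_apply, smul_eq_mul]
  refine ENNReal.inv_mul_cancel ?_ (measure_ne_top _ _)
  rw [Measure.measure_univ_ne_zero]
  exact Measure.toSphere_ne_zero _

lemma ae_norm_uniformSphere : ∀ᵐ u ∂(uniformSphere p), ‖u‖ = 1 := by
  rw [uniformSphere, ae_map_iff measurable_subtype_coe.aemeasurable
    (measurableSet_eq_fun (by fun_prop) measurable_const)]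
  exact Eventually.of_forall fun u => by simp

/-- The law of `r U`, where `r` has law `ν` and `U` is uniform on the sphere. -/
def radialLaw (ν : Measure ℝ) (p : ℕ) : Measure (EuclideanSpace ℝ (Fin p)) :=
  (ν.prod (uniformSphere p)).map fun x => x.1 • x.2

/-- The norm of `rU` is `|r|`, and a law with a density has no atom at `t` or `-t`. -/
lemma radialLaw_norm_eq (hp : p ≠ 0) {ν : Measure ℝ} [IsProbabilityMeasure ν] (hν : ν ≪ volume)
    (t : ℝ) : radialLaw ν p {w | ‖w‖ = t} = 0 := by
  have := isProbabilityMeasure_uniformSphere hp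
  have hm : Measurable fun x : ℝ × EuclideanSpace ℝ (Fin p) => x.1 • x.2 := by fun_prop
  rw [radialLaw, Measure.map_apply hm (measurableSet_eq_fun (by fun_prop) measurable_const)]
  have h1 : ∀ᵐ x ∂(ν.prod (uniformSphere p)), ‖x.2‖ = 1 :=
    Measure.quasiMeasurePreserving_snd.ae ae_norm_uniformSphere
  have h2 : ∀ᵐ x ∂(ν.prod (uniformSphere p)), x.1 ∉ ({t, -t} : Set ℝ) := by
    refine Measure.quasiMeasurePreserving_fst.ae (p := fun r => r ∉ ({t, -t} : Set ℝ)) ?_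
    rw [ae_iff]
    simp only [not_not, Set.ofPred_mem_eq]
    exact hν ((Set.toFinite _).measure_zero _)
  have h3 : ∀ᵐ x ∂(ν.prod (uniformSphere p)), ¬ ‖x.1 • x.2‖ = t := by
    filter_upwards [h1, h2] with x hx1 hx2 hx3
    rw [norm_smul, hx1, mul_one, Real.norm_eq_abs] at hx3
    refine hx2 ?_
    rcases abs_cases x.1 with ⟨h, _⟩ | ⟨h, _⟩
    · left; linarith
    · right
      rw [Set.mem_singleton_iff]
      linarith
  rw [ae_iff] at h3
  simpa using h3

/-- Reflections act on `U` alone, since they commute with scaling by `r`. -/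
lemma isIsotropic_radialLaw (hp : p ≠ 0) {ν : Measure ℝ} [IsProbabilityMeasure ν]
    (hν : ν ≪ volume) : IsIsotropic (radialLaw ν p) := by
  have := isProbabilityMeasure_uniformSphere hp
  have hm : Measurable fun x : ℝ × EuclideanSpace ℝ (Fin p) => x.1 • x.2 := by fun_prop
  refine ⟨Measure.isProbabilityMeasure_map hm.aemeasurable, fun m hm' => ?_, ?_⟩
  · have hr : reflect m = ⇑(Submodule.span ℝ {m})ᗮ.reflection :=
      funext fun v => reflect_eq_reflection hm' v
    have hmp : MeasurePreserving (reflect m) (uniformSphere p) (uniformSphere p) :=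
      ⟨measurable_reflect m, by rw [hr, uniformSphere_map]⟩
    have h1 := (MeasurePreserving.id ν).prod hmp
    rw [radialLaw, Measure.map_map (measurable_reflect m) hm]
    conv_rhs => rw [← h1.map_eq, Measure.map_map hm h1.measurable]
    congr 1
    ext x : 1
    simp only [Function.comp_apply, Prod.map_fst, Prod.map_snd, id, reflect, inner_smul_right]
    module
  · have := radialLaw_norm_eq hp hν 0
    simpa using this

end Sphere

/-! ### Kendall's tau under transelliptical laws -/

section Transelliptical

open scoped RealInnerProductSpace

variable {p : ℕ}

/-- A row of a matrix, as a vector of Euclidean space. -/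
def euclideanRow (A : Matrix (Fin p) (Fin p) ℝ) (j : Fin p) : EuclideanSpace ℝ (Fin p) :=
  WithLp.toLp 2 (A j)

lemma inner_euclideanRow (A : Matrix (Fin p) (Fin p) ℝ) (j : Fin p)
    (w : EuclideanSpace ℝ (Fin p)) : ⟪euclideanRow A j, w⟫ = A.mulVec w.ofLp j := by
  simp [euclideanRow, PiLp.inner_apply, Matrix.mulVec, dotProduct, mul_comm]

lemma inner_euclideanRow_euclideanRow (A : Matrix (Fin p) (Fin p) ℝ) (j k : Fin p) :
    ⟪euclideanRow A j, euclideanRow A k⟫ = (A * A.transpose) j k := by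
  rw [inner_euclideanRow]
  simp [euclideanRow, Matrix.mulVec, dotProduct, Matrix.mul_apply]

/-- The kernel of Kendall's tau for the coordinates `j` and `k`. -/
def kendallKernel (j k : Fin p) (x x' : Fin p → ℝ) : ℝ :=
  Real.sign ((x j - x' j) * (x k - x' k))

lemma isKernel_kendallKernel (j k : Fin p) : IsKernel (kendallKernel j k) where
  measurable := measurable_realSign.comp (by fun_prop)
  symm x x' := by
    unfold kendallKernel
    congr 1
    ring
  diag x := by simp [kendallKernel]
  abs_le_one x x' := abs_realSign_le _

lemma measurable_mulVec_ofLp (A : Matrix (Fin p) (Fin p) ℝ) :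
    Measurable fun w : EuclideanSpace ℝ (Fin p) => A.mulVec w.ofLp := by
  refine measurable_pi_lambda _ fun j => ?_
  simp_rw [← inner_euclideanRow]
  fun_prop

lemma ellipticalLaw_zero_eq_map (A : Matrix (Fin p) (Fin p) ℝ) (ν : Measure ℝ) :
    ellipticalLaw 0 A ν = (radialLaw ν p).map fun w => A.mulVec w.ofLp := by
  have hm : Measurable fun x : ℝ × EuclideanSpace ℝ (Fin p) => x.1 • x.2 := by fun_prop
  rw [ellipticalLaw, radialLaw, Measure.map_map (measurable_mulVec_ofLp A) hm]
  congr 1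
  ext x : 1
  simp [Matrix.mulVec_smul]

/-- A monotone `g` reflects strict inequalities between its values. Only ties `g x = g y` lose
information, hence their exclusion. -/
lemma exists_sign_sub_eq {g : ℝ → ℝ} (hg : Monotone g ∨ Antitone g) :
    ∃ s : ℝ, s ^ 2 = 1 ∧
      ∀ x y, g x ≠ g y → Real.sign (x - y) = s * Real.sign (g x - g y) := by
  rcases hg with hg | hg
  · refine ⟨1, one_pow 2, fun x y hxy => ?_⟩
    rcases lt_or_gt_of_ne hxy with h | h
    · rw [Real.sign_of_neg (sub_neg.2 (hg.reflect_lt h)), Real.sign_of_neg (sub_neg.2 h), one_mul]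
    · rw [Real.sign_of_pos (sub_pos.2 (hg.reflect_lt h)), Real.sign_of_pos (sub_pos.2 h), one_mul]
  · refine ⟨-1, by norm_num, fun x y hxy => ?_⟩
    rcases lt_or_gt_of_ne hxy with h | h
    · rw [Real.sign_of_pos (sub_pos.2 (hg.reflect_lt h)), Real.sign_of_neg (sub_neg.2 h)]
      norm_num
    · rw [Real.sign_of_neg (sub_neg.2 (hg.reflect_lt h)), Real.sign_of_pos (sub_pos.2 h)]
      norm_num

lemma measurableSet_apply_ne (j : Fin p) :
    MeasurableSet {z : (Fin p → ℝ) × (Fin p → ℝ) | z.1 j ≠ z.2 j} :=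
  (measurableSet_eq_fun ((measurable_pi_apply j).comp measurable_fst)
    ((measurable_pi_apply j).comp measurable_snd)).compl

variable {P : Measure (Fin p → ℝ)} {S : Matrix (Fin p) (Fin p) ℝ} {ν : Measure ℝ}

/-- The mean and the first projection of the Kendall kernel under an elliptical law. -/
lemma IsElliptical.kernelMean_projVar_kendallKernel (hP : IsElliptical P 0 S ν) (j k : Fin p) :
    kernelMean P (kendallKernel j k) = 2 / Real.pi * Real.arcsin (S j k) ∧
      (3 ≤ p → |S j k| ≤ 1 / 36 → 1 / 144 ≤ projVar P (kendallKernel j k)) ∧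
      ∀ᵐ z ∂(P.prod P), z.1 j ≠ z.2 j := by
  have hp : p ≠ 0 := fun h => (h ▸ j).elim0
  obtain ⟨A, hA, rfl⟩ := hP.representation
  have := hP.isProbabilityMeasure_radius
  have hQ := isIsotropic_radialLaw hp hP.radius_density
  have hN := radialLaw_norm_eq hp hP.radius_density
  have hQp := hQ.isProbabilityMeasure
  have hrow : ∀ j k, ⟪euclideanRow A j, euclideanRow A k⟫ = S j k := fun j k => by
    rw [inner_euclideanRow_euclideanRow, hA]
  have hnorm : ∀ j, ‖euclideanRow A j‖ = 1 := fun j => by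
    have h : ‖euclideanRow A j‖ ^ 2 = 1 := by
      rw [← real_inner_self_eq_norm_sq, hrow, hP.diag_eq_one]
    exact (pow_eq_one_iff_of_nonneg (norm_nonneg _) two_ne_zero).1 h
  have hF := measurable_mulVec_ofLp A
  rw [ellipticalLaw_zero_eq_map]
  have ht := kernelMean_projVar_map (P := radialLaw ν p) hF
    (h := signKernel (euclideanRow A j) (euclideanRow A k)) (isKernel_kendallKernel j k)
    (s := 1) (one_pow 2) (Eventually.of_forall fun z => by
      simp only [signKernel, kendallKernel, inner_euclideanRow, one_mul])
  rw [one_mul] at ht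
  refine ⟨?_, fun h3 hS => ?_, ?_⟩
  · rw [← ht.1, hQ.kernelMean_signKernel hN (hnorm j) (hnorm k), hrow]
  · rw [← ht.2]
    exact hQ.le_projVar_signKernel hN (by simpa using h3) (hnorm j) (hnorm k) (by rwa [hrow])
  · rw [Measure.map_prod_map _ _ hF hF,
      ae_map_iff (hF.prodMap hF).aemeasurable (measurableSet_apply_ne j)]
    filter_upwards [hQ.ae_inner_ne hN (hnorm j)] with z hz
    simpa only [Prod.map_fst, Prod.map_snd, ← inner_euclideanRow] using hz

variable {g : Fin p → ℝ → ℝ}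

/-- The mean and the first projection of the Kendall kernel under a transelliptical law. -/
lemma IsTranselliptical.kernelMean_projVar_kendallKernel (hP : IsTranselliptical P S ν g)
    (j k : Fin p) :
    (∃ s : ℝ, s ^ 2 = 1 ∧
      kernelMean P (kendallKernel j k) = s * (2 / Real.pi * Real.arcsin (S j k))) ∧
      (3 ≤ p → |S j k| ≤ 1 / 36 → 1 / 144 ≤ projVar P (kendallKernel j k)) := by
  have := hP.isProbabilityMeasure
  have hgm : ∀ j, Measurable (g j) := fun j => by
    rcases hP.monotone j with h | h
    exacts [h.measurable, h.measurable]
  have hG : Measurable fun (x : Fin p → ℝ) j => g j (x j) :=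
    measurable_pi_lambda _ fun j => (hgm j).comp (measurable_pi_apply j)
  obtain ⟨s, hs, hsg⟩ := exists_sign_sub_eq (hP.monotone j)
  obtain ⟨s', hs', hsg'⟩ := exists_sign_sub_eq (hP.monotone k)
  obtain ⟨h1, h2, h3⟩ := hP.elliptical.kernelMean_projVar_kendallKernel j k
  -- The almost sure absence of ties is stated for the first index of the pair; a second use with
  -- `k` in that place gives it for `k`.
  obtain ⟨-, -, h4⟩ := hP.elliptical.kernelMean_projVar_kendallKernel k k
  rw [Measure.map_prod_map _ _ hG hG,
    ae_map_iff (hG.prodMap hG).aemeasurable (measurableSet_apply_ne _)] at h3 h4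
  have hss : (s * s') ^ 2 = 1 := by rw [mul_pow, hs, hs', one_mul]
  have ht := kernelMean_projVar_map (P := P) hG (h := kendallKernel j k)
    (isKernel_kendallKernel j k) hss (by
      filter_upwards [h3, h4] with z hz hz'
      simp only [Prod.map_fst, Prod.map_snd] at hz hz'
      simp only [kendallKernel, realSign_mul]
      rw [hsg _ _ hz, hsg' _ _ hz']
      ring)
  exact ⟨⟨s * s', hss, by rw [ht.1, h1]⟩, by rw [ht.2]; exact h2⟩

lemma IsTranselliptical.abs_le_one (hP : IsTranselliptical P S ν g) (j k : Fin p) :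
    |S j k| ≤ 1 := by
  obtain ⟨A, hA, -⟩ := hP.elliptical.representation
  have hnorm : ∀ j, ‖euclideanRow A j‖ = 1 := fun j => by
    have h : ‖euclideanRow A j‖ ^ 2 = 1 := by
      rw [← real_inner_self_eq_norm_sq, inner_euclideanRow_euclideanRow, hA,
        hP.elliptical.diag_eq_one]
    exact (pow_eq_one_iff_of_nonneg (norm_nonneg _) two_ne_zero).1 h
  rw [← hA, ← inner_euclideanRow_euclideanRow]
  exact (abs_real_inner_le_norm _ _).trans_eq (by rw [hnorm, hnorm, one_mul])

/-- By Jordan's inequality a correlation of at most `1 / n` yields a bias of Kendall's tau of at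
most `1 / n`. -/
lemma IsTranselliptical.abs_kernelMean_le (hP : IsTranselliptical P S ν g) (j k : Fin p) :
    |kernelMean P (kendallKernel j k)| ≤ |S j k| := by
  have hpi := Real.pi_pos
  obtain ⟨⟨s, hs, h⟩, -⟩ := hP.kernelMean_projVar_kendallKernel j k
  have hs' : |s| = 1 := by rcases sq_eq_one_iff.1 hs with rfl | rfl <;> simp
  rw [h, abs_mul, hs', one_mul, abs_mul, abs_of_pos (by positivity)]
  exact abs_arcsin_le _ (hP.abs_le_one j k)

/-- The sine inverts the arcsine formula; the unknown sign from the monotone transformations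
disappears in the absolute value. -/
lemma IsTranselliptical.abs_sin_kernelMean (hP : IsTranselliptical P S ν g) (j k : Fin p) :
    |Real.sin (Real.pi / 2 * kernelMean P (kendallKernel j k))| = |S j k| := by
  have hpi := Real.pi_pos
  obtain ⟨⟨s, hs, h⟩, -⟩ := hP.kernelMean_projVar_kendallKernel j k
  have hS := abs_le.1 (hP.abs_le_one j k)
  have e : Real.pi / 2 * (2 / Real.pi * Real.arcsin (S j k)) = Real.arcsin (S j k) := by
    field_simp
  rcases sq_eq_one_iff.1 hs with rfl | rfl
  · rw [h, one_mul, e, Real.sin_arcsin hS.1 hS.2]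
  · rw [h, neg_one_mul, mul_neg, e, Real.sin_neg, Real.sin_arcsin hS.1 hS.2, abs_neg]

end Transelliptical

/-! ### The estimators as functionals of the Kendall kernel -/

section Estimators

variable {n p : ℕ}

/-- The diagonal terms of the sum over `i ≤ i'` vanish, and the factor 2 accounts for the ordered
pairs. -/
lemma kendallTau_eq_uStat (X : Fin n → Fin p → ℝ) (j k : Fin p) :
    kendallTau X j k = uStat (kendallKernel j k) X := by
  rw [kendallTau, uStat, (isKernel_kendallKernel j k).sum_sum_eq]
  have h : ∑ e ∈ Finset.univ.filter (fun e : Fin n × Fin n => e.1 ≤ e.2),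
      concordance X j k e.1 e.2 = ∑ e ∈ Finset.univ.filter (fun e : Fin n × Fin n => e.1 < e.2),
      kendallKernel j k (X e.1) (X e.2) := by
    symm
    refine Finset.sum_subset (fun e => ?_) fun e he he' => ?_
    · simpa using fun h => le_of_lt h
    · simp only [Finset.mem_filter, Finset.mem_univ, true_and, not_lt] at he he'
      rw [le_antisymm he he']
      exact (isKernel_kendallKernel j k).diag _
  rw [h]
  ring

lemma jackknifeVar_eq (X : Fin n → Fin p → ℝ) (j k : Fin p) :
    jackknifeVar X j k = jackknifeUStatVar (kendallKernel j k) X := by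
  rw [jackknifeVar, jackknifeUStatVar]
  congr 1
  refine Finset.sum_congr rfl fun i' _ => ?_
  rw [kendallTau_eq_uStat, leaveOneMean, Finset.sum_erase]
  · rfl
  · exact (isKernel_kendallKernel j k).diag _

end Estimators

/-! ### Normal quantiles -/

section Quantile

lemma cdf_gaussianReal_le_half {x : ℝ} (hx : x < 0) : cdf (gaussianReal 0 1) x ≤ 1 / 2 := by
  have h1 : (gaussianReal 0 1).real (Set.Iic x) = (gaussianReal 0 1).real (Set.Ici (-x)) := by
    conv_lhs => rw [← neg_zero, ← gaussianReal_map_neg,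
      map_measureReal_apply measurable_neg measurableSet_Iic]
    congr 1
    ext y
    simp only [Set.mem_preimage, Set.mem_Iic, Set.mem_Ici]
    constructor <;> intro h <;> linarith
  have h2 : (gaussianReal 0 1).real (Set.Iic x ∪ Set.Ici (-x)) ≤ 1 := measureReal_le_one
  rw [measureReal_union (Set.disjoint_left.2 fun y hy hy' => ?_) measurableSet_Ici, ← h1] at h2
  · rw [cdf_eq_real]
    linarith
  · rw [Set.mem_Iic] at hy
    rw [Set.mem_Ici] at hy'
    linarith

lemma normalQuantile_nonneg {u : ℝ} (hu : 1 / 2 < u) : 0 ≤ normalQuantile u := by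
  refine Real.sInf_nonneg fun x hx => ?_
  simp only [Set.mem_ofPred_eq] at hx
  by_contra! h
  linarith [cdf_gaussianReal_le_half h]

lemma bddBelow_le_cdf {u : ℝ} (hu : 0 < u) :
    BddBelow {x : ℝ | u ≤ cdf (gaussianReal 0 1) x} := by
  obtain ⟨a, ha⟩ := ((tendsto_cdf_atBot (gaussianReal 0 1)).eventually (gt_mem_nhds hu)).exists
  refine ⟨a, fun x hx => ?_⟩
  simp only [Set.mem_ofPred_eq] at hx
  by_contra! h
  linarith [monotone_cdf (gaussianReal 0 1) h.le]

/-- The infimum is attained by right continuity of the distribution function. -/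
lemma le_cdf_normalQuantile {u : ℝ} (hu : u < 1) :
    u ≤ cdf (gaussianReal 0 1) (normalQuantile u) := by
  obtain ⟨b, hb⟩ := ((tendsto_cdf_atTop (gaussianReal 0 1)).eventually (lt_mem_nhds hu)).exists
  have hgt : ∀ x, normalQuantile u < x → u ≤ cdf (gaussianReal 0 1) x := by
    intro x hx
    obtain ⟨y, hy, hyx⟩ := exists_lt_of_csInf_lt ⟨b, by simpa using hb.le⟩ hx
    simp only [Set.mem_ofPred_eq] at hy
    exact hy.trans (monotone_cdf _ hyx.le)
  have hc := ((cdf (gaussianReal 0 1)).right_continuous (normalQuantile u)).mono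
    (Set.Ioi_subset_Ici_self)
  exact ge_of_tendsto hc.tendsto (by filter_upwards [self_mem_nhdsWithin] with x hx using hgt x hx)

lemma normalQuantile_le {u t : ℝ} (ht : 0 ≤ t) (hu : u ≤ cdf (gaussianReal 0 1) t) :
    normalQuantile u ≤ t := by
  rcases le_or_gt u 0 with h | h
  -- For `u ≤ 0` the quantile takes the default value `sInf univ = 0`. This happens when `f` is at
  -- least `p (p - 1)`, which is possible for small `n`.
  · have : {x : ℝ | u ≤ cdf (gaussianReal 0 1) x} = Set.univ :=
      Set.eq_univ_of_forall fun x => by simpa using h.trans (cdf_nonneg _ x)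
    rwa [normalQuantile, this, Real.sInf_univ]
  · exact csInf_le (bddBelow_le_cdf h) (by simpa using hu)

/-- Chernoff's bound for the upper tail, with exponential parameter `t`. -/
lemma one_sub_exp_le_cdf {t : ℝ} (ht : 0 ≤ t) :
    1 - Real.exp (-(t ^ 2 / 2)) ≤ cdf (gaussianReal 0 1) t := by
  have h1 := measure_ge_le_exp_mul_mgf (μ := gaussianReal 0 1) (X := id) t ht
    (by simpa using integrable_exp_mul_gaussianReal (μ := 0) (v := 1) t)
  rw [mgf_id_gaussianReal, ← Real.exp_add] at h1
  have h2 : -t * t + (0 * t + ((1 : NNReal) : ℝ) * t ^ 2 / 2) = -(t ^ 2 / 2) := by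
    simp only [NNReal.coe_one]
    ring
  rw [h2] at h1
  have h3 : (1 : ℝ) ≤ (gaussianReal 0 1).real (Set.Iic t) +
      (gaussianReal 0 1).real {x | t ≤ id x} := by
    rw [← probReal_univ (μ := gaussianReal 0 1)]
    refine (measureReal_mono fun x _ => ?_).trans (measureReal_union_le _ _)
    rcases le_total x t with h | h
    · exact Or.inl h
    · exact Or.inr (by simpa using h)
  rw [cdf_eq_real]
  linarith

/-- Each one-sided tail beyond the quantile has mass at most `u`, the lower one by symmetry. -/
lemma gaussianReal_real_normalQuantile_lt_abs_le {u : ℝ} (hu : 0 < u) :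
    (gaussianReal 0 1).real {x | normalQuantile (1 - u) < |x|} ≤ 2 * u := by
  set q := normalQuantile (1 - u)
  have hq : 1 - u ≤ (gaussianReal 0 1).real (Set.Iic q) := by
    rw [← cdf_eq_real]
    exact le_cdf_normalQuantile (by linarith)
  have h1 : (gaussianReal 0 1).real (Set.Ioi q) ≤ u := by
    rw [← Set.compl_Iic, probReal_compl_eq_one_sub measurableSet_Iic]
    linarith
  have h2 : (gaussianReal 0 1).real (Set.Iio (-q)) = (gaussianReal 0 1).real (Set.Ioi q) := by
    conv_lhs => rw [← neg_zero, ← gaussianReal_map_neg,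
      map_measureReal_apply measurable_neg measurableSet_Iio]
    congr 1
    ext y
    simp
  have h3 : (gaussianReal 0 1).real {x | q < |x|} ≤
      (gaussianReal 0 1).real (Set.Ioi q) + (gaussianReal 0 1).real (Set.Iio (-q)) := by
    refine (measureReal_mono fun x hx => ?_).trans (measureReal_union_le _ _)
    simp only [Set.mem_ofPred_eq] at hx
    rcases lt_abs.1 hx with h | h
    · exact Or.inl h
    · exact Or.inr (lt_neg.1 h)
  linarith

end Quantile

/-! ### Counting large correlations -/

section Counting

variable {p : ℕ} {S : Matrix (Fin p) (Fin p) ℝ}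

/-- The sum of squares is `tr (S²) = ∑ λ²`, and `λ² ≤ M λ` for positive eigenvalues bounded by `M`.
-/
lemma sum_sq_le_of_spectrum_le (hS : S.PosDef) {M : ℝ} (hM : ∀ l ∈ spectrum ℝ S, l ≤ M) :
    ∑ e : Fin p × Fin p, S e.1 e.2 ^ 2 ≤ M * S.trace := by
  have hH : S.IsHermitian := hS.isHermitian
  have hsym : ∀ j k, S k j = S j k := fun j k => by simpa using hH.apply j k
  have h1 : ∑ e : Fin p × Fin p, S e.1 e.2 ^ 2 = (S * S).trace := by
    rw [Fintype.sum_prod_type]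
    simp only [Matrix.trace, Matrix.diag_apply, Matrix.mul_apply]
    exact Finset.sum_congr rfl fun j _ => Finset.sum_congr rfl fun k _ => by rw [hsym j k, sq]
  have h2 : (S * S).trace = ∑ i, hH.eigenvalues i ^ 2 := by
    conv_lhs => rw [hH.spectral_theorem, ← map_mul, Unitary.conjStarAlgAut_apply,
      Matrix.trace_mul_cycle, Unitary.coe_star_mul_self, one_mul, Matrix.diagonal_mul_diagonal,
      Matrix.trace_diagonal]
    exact Finset.sum_congr rfl fun i _ => by simp [sq]
  have h3 : S.trace = ∑ i, hH.eigenvalues i := by simpa using hH.trace_eq_sum_eigenvalues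
  rw [h1, h2, h3, Finset.mul_sum]
  refine Finset.sum_le_sum fun i _ => ?_
  rw [sq]
  exact mul_le_mul_of_nonneg_right (hM _ (hH.eigenvalues_mem_spectrum_real i))
    (hS.eigenvalues_pos i).le

/-- A Chebyshev count: each large entry uses up `c²` of the total `∑ S²`, which is at most `M tr S =
M p`. -/
lemma card_mul_sq_le (hS : S.PosDef) (hd : ∀ j, S j j = 1) {M : ℝ}
    (hM : ∀ l ∈ spectrum ℝ S, l ≤ M) {c : ℝ} (hc : 0 ≤ c) (s : Finset (Fin p × Fin p))
    (hs : ∀ e ∈ s, c ≤ |S e.1 e.2|) : (s.card : ℝ) * c ^ 2 ≤ M * p := by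
  have ht : S.trace = p := by simp [Matrix.trace, hd]
  rw [← ht, ← nsmul_eq_mul]
  refine le_trans ?_ (sum_sq_le_of_spectrum_le hS hM)
  refine le_trans (Finset.card_nsmul_le_sum s (fun e => S e.1 e.2 ^ 2) (c ^ 2) fun e he => ?_) ?_
  · rw [← sq_abs (S e.1 e.2)]
    exact pow_le_pow_left₀ hc (hs e he) 2
  · exact Finset.sum_le_sum_of_subset_of_nonneg (Finset.subset_univ s) fun e _ _ => sq_nonneg _

lemma card_edges_add_card_nonEdges (S : Matrix (Fin p) (Fin p) ℝ) :
    ((edges S).card : ℝ) + (nonEdges S).card = (p : ℝ) * (p - 1) / 2 := by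
  classical
  rw [← card_filter_lt_fin p, ← Nat.cast_add, edges, nonEdges, ← Finset.filter_filter,
    ← Finset.filter_filter, add_comm]
  norm_cast
  convert Finset.card_filter_add_card_filter_not
    (s := Finset.univ.filter fun e : Fin p × Fin p => e.1 < e.2)
    (fun e : Fin p × Fin p => S⁻¹ e.1 e.2 = 0) using 2

end Counting

/-! ### Growth of the dimension -/

section Growth

/-- Eventually `p ≥ exp (C n^ξ / 2)`, which beats every power of `n`. -/
lemma eventually_mul_rpow_le {C ξ : ℝ} (hC : 0 < C) (hξ : 0 < ξ) {p : ℕ → ℕ}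
    (hp : (fun n : ℕ => Real.log (p n)) ~[atTop] (fun n : ℕ => C * (n : ℝ) ^ ξ)) (K a : ℝ) :
    ∀ᶠ n : ℕ in atTop, K * (n : ℝ) ^ a ≤ p n := by
  have hx : Tendsto (fun n : ℕ => (n : ℝ) ^ ξ) atTop atTop :=
    (tendsto_rpow_atTop hξ).comp tendsto_natCast_atTop_atTop
  have h1 := (isLittleO_rpow_exp_pos_mul_atTop (a / ξ) (half_pos hC)).comp_tendsto hx
  have h2 := h1.bound (c := 1 / (|K| + 1)) (by positivity)
  have h3 := hp.isLittleO.bound (c := 1 / 2) (by norm_num)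
  filter_upwards [h2, h3, eventually_gt_atTop 0] with n hn2 hn3 hn
  have hn' : (0 : ℝ) < n := by exact_mod_cast hn
  have hpos : 0 < (n : ℝ) ^ ξ := by positivity
  simp only [Pi.sub_apply, Real.norm_eq_abs] at hn3
  rw [abs_of_pos (mul_pos hC hpos)] at hn3
  have hlog : C / 2 * (n : ℝ) ^ ξ ≤ Real.log (p n) := by linarith [(abs_le.1 hn3).1]
  -- The convention `log 0 = 0` would make `p n = 0` contradict the positive lower bound for `log (p
  -- n)`.
  have hp0 : (0 : ℝ) < p n := by
    by_contra! h
    have h0 : (p n : ℝ) = 0 := le_antisymm h (Nat.cast_nonneg _)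
    rw [h0, Real.log_zero] at hlog
    have := mul_pos (half_pos hC) hpos
    linarith
  simp only [Function.comp_apply, Real.norm_eq_abs] at hn2
  rw [abs_of_pos (by positivity), abs_of_pos (Real.exp_pos _), ← Real.rpow_mul hn'.le,
    mul_div_cancel₀ _ hξ.ne', div_mul_eq_mul_div, one_mul, le_div_iff₀ (by positivity)] at hn2
  have hle : Real.exp (C / 2 * (n : ℝ) ^ ξ) ≤ p n := by
    rw [← Real.exp_log hp0]
    exact Real.exp_le_exp.2 hlog
  have hna : 0 < (n : ℝ) ^ a := by positivity
  nlinarith [le_abs_self K]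

/-- Eventually `p² ≤ exp (4 C n^ξ)`. As `ξ < β`, half of the exponent `c n^β` absorbs this, and the
other half falls below any `K > 0`. -/
lemma eventually_sq_mul_exp_le {C ξ β : ℝ} (hC : 0 < C) (hξβ : ξ < β) {p : ℕ → ℕ}
    (hβ : 0 < β)
    (hp : (fun n : ℕ => Real.log (p n)) ~[atTop] (fun n : ℕ => C * (n : ℝ) ^ ξ)) {c K : ℝ}
    (hc : 0 < c) (hK : 0 < K) :
    ∀ᶠ n : ℕ in atTop, (p n : ℝ) ^ 2 * Real.exp (-(c * (n : ℝ) ^ β)) ≤ K := by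
  have h1 := hp.isLittleO.bound (c := 1) one_pos
  have h2 : Tendsto (fun n : ℕ => (n : ℝ) ^ (β - ξ)) atTop atTop :=
    (tendsto_rpow_atTop (by linarith)).comp tendsto_natCast_atTop_atTop
  have h3 : Tendsto (fun n : ℕ => (n : ℝ) ^ β) atTop atTop :=
    (tendsto_rpow_atTop hβ).comp tendsto_natCast_atTop_atTop
  filter_upwards [h1, h2.eventually_ge_atTop (8 * C / c),
    h3.eventually_ge_atTop (-(2 * Real.log K / c)), eventually_gt_atTop 0] with n hn1 hn2 hn3 hn
  have hn' : (0 : ℝ) < n := by exact_mod_cast hn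
  have hpos : 0 < (n : ℝ) ^ ξ := by positivity
  simp only [Pi.sub_apply, Real.norm_eq_abs] at hn1
  rw [abs_of_pos (mul_pos hC hpos)] at hn1
  have hlog : Real.log (p n) ≤ 2 * C * (n : ℝ) ^ ξ := by linarith [(abs_le.1 hn1).2]
  have hexp : (p n : ℝ) ≤ Real.exp (2 * C * (n : ℝ) ^ ξ) := by
    rcases (Nat.cast_nonneg (α := ℝ) (p n)).eq_or_lt with h | h
    · rw [← h]
      exact (Real.exp_pos _).le
    · rw [← Real.exp_log h]
      exact Real.exp_le_exp.2 hlog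
  have hsplit : (n : ℝ) ^ β = (n : ℝ) ^ ξ * (n : ℝ) ^ (β - ξ) := by
    rw [← Real.rpow_add hn']
    congr 1
    ring
  rw [div_le_iff₀ hc] at hn2
  have h4 : 4 * C * (n : ℝ) ^ ξ ≤ c / 2 * (n : ℝ) ^ β := by
    rw [hsplit]
    nlinarith
  have h5 : -(c / 2 * (n : ℝ) ^ β) ≤ Real.log K := by
    rw [neg_le, le_div_iff₀ hc] at hn3
    nlinarith
  calc (p n : ℝ) ^ 2 * Real.exp (-(c * (n : ℝ) ^ β))
      ≤ Real.exp (2 * C * (n : ℝ) ^ ξ) ^ 2 * Real.exp (-(c * (n : ℝ) ^ β)) := by gcongr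
    _ = Real.exp (4 * C * (n : ℝ) ^ ξ - c * (n : ℝ) ^ β) := by
        rw [sq, ← Real.exp_add, ← Real.exp_add]
        congr 1
        ring
    _ ≤ Real.exp (Real.log K) := Real.exp_le_exp.2 (by linarith)
    _ = K := Real.exp_log hK

end Growth

/-! ### Control of the false positive rate -/

section FalsePositives

variable {n p : ℕ} {P : Measure (Fin p → ℝ)} {S : Matrix (Fin p) (Fin p) ℝ} {ν : Measure ℝ}
  {g : Fin p → ℝ → ℝ}

lemma isProbabilityMeasure_sampleLaw [IsProbabilityMeasure P] :
    IsProbabilityMeasure (sampleLaw P n) := by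
  unfold sampleLaw
  infer_instance

lemma measurable_kendallTau (j k : Fin p) :
    Measurable fun X : Fin n → Fin p → ℝ => kendallTau X j k := by
  simp_rw [kendallTau_eq_uStat]
  exact (isKernel_kendallKernel j k).measurable_uStat

lemma measurable_jackknifeVar (j k : Fin p) :
    Measurable fun X : Fin n → Fin p → ℝ => jackknifeVar X j k := by
  have hk := isKernel_kendallKernel j k
  simp_rw [jackknifeVar_eq, jackknifeUStatVar]
  exact (Finset.measurable_sum _ fun i _ =>
    ((hk.measurable_leaveOneMean i).sub hk.measurable_uStat).pow_const 2).const_mul _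

lemma measurableSet_threshold_lt (f : ℝ) (j k : Fin p) :
    MeasurableSet {X : Fin n → Fin p → ℝ | threshold f X j k < |corrEstimator X j k|} := by
  have h1 := measurable_kendallTau (n := n) j k
  have h2 := measurable_jackknifeVar (n := n) j k
  have h3 : Measurable fun X : Fin n → Fin p → ℝ => corrEstimator X j k := by
    unfold corrEstimator
    split_ifs
    · exact measurable_const
    · exact Real.measurable_sin.comp (h1.const_mul _)
  refine measurableSet_lt ?_ h3.abs
  unfold threshold
  exact (((Real.continuous_sqrt.measurable.comp h2).const_mul _).mul_const _).div_const _

/-- The probability of a false positive at a nearly uncorrelated pair. -/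
lemma exists_measureReal_threshold_lt_le {ε : ℝ} (hε : 0 < ε) :
    ∃ N : ℕ, ∀ n ≥ N, ∀ (p : ℕ) (P : Measure (Fin p → ℝ)) (S : Matrix (Fin p) (Fin p) ℝ)
      (ν : Measure ℝ) (g : Fin p → ℝ → ℝ), IsTranselliptical P S ν g → 3 ≤ p →
      ∀ j k : Fin p, j ≠ k → |S j k| ≤ 1 / n → ∀ f : ℝ, 0 < f → f < (p : ℝ) * ((p : ℝ) - 1) / 2 →
        (sampleLaw P n).real {X | threshold f X j k < |corrEstimator X j k|} ≤
          2 * (f / ((p : ℝ) * ((p : ℝ) - 1))) + ε := by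
  obtain ⟨N, hN⟩ := exists_measureReal_studentized_le (v₀ := 1 / 144) (by norm_num) hε
  refine ⟨max N 36, fun n hn p P S ν g hP hp j k hjk hS f hf hf' => ?_⟩
  have hn36 : (36 : ℝ) ≤ n := by exact_mod_cast (le_max_right N 36).trans hn
  have hp' : (3 : ℝ) ≤ p := by exact_mod_cast hp
  have hpp : 0 < (p : ℝ) * ((p : ℝ) - 1) := mul_pos (by linarith) (by linarith)
  have hpi := Real.pi_pos
  set u := f / ((p : ℝ) * ((p : ℝ) - 1)) with hu
  have hu0 : 0 < u := by positivity
  have hu1 : u < 1 / 2 := by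
    rw [hu, div_lt_iff₀ hpp]
    linarith
  have hS' : |S j k| ≤ 1 / 36 := hS.trans (one_div_le_one_div_of_le (by norm_num) hn36)
  have hPp := hP.isProbabilityMeasure
  have := isProbabilityMeasure_sampleLaw (n := n) (P := P)
  have hk := isKernel_kendallKernel j k
  have hq := normalQuantile_nonneg (u := 1 - u) (by linarith)
  have h1 := hN n ((le_max_left N 36).trans hn) (Fin p → ℝ) _ P hPp _ hk
    ((hP.kernelMean_projVar_kendallKernel j k).2 hp hS') ((hP.abs_kernelMean_le j k).trans hS)
    (normalQuantile (1 - u)) hq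
  have h2 := gaussianReal_real_normalQuantile_lt_abs_le hu0
  refine (measureReal_mono fun X hX => ?_).trans (h1.trans (by linarith))
  simp only [Set.mem_ofPred_eq] at hX ⊢
  rw [threshold, corrEstimator, if_neg hjk, jackknifeVar_eq, kendallTau_eq_uStat, ← hu] at hX
  have h3 : |Real.sin (Real.pi / 2 * uStat (kendallKernel j k) X)| ≤
      Real.pi / 2 * |uStat (kendallKernel j k) X| := by
    refine Real.abs_sin_le_abs.trans ?_
    rw [abs_mul, abs_of_pos (by positivity : 0 < Real.pi / 2)]
  have h4 := hX.trans_le h3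
  rw [mul_assoc, mul_div_assoc] at h4
  exact lt_of_mul_lt_mul_left h4 (by positivity)

open Classical in
lemma integral_falsePositiveRate [IsProbabilityMeasure P] (f : ℝ) :
    ∫ X, falsePositiveRate S (threshold f X) X ∂(sampleLaw P n) =
      (∑ e ∈ nonEdges S, (sampleLaw P n).real
        {X | threshold f X e.1 e.2 < |corrEstimator X e.1 e.2|}) / (nonEdges S).card := by
  have := isProbabilityMeasure_sampleLaw (n := n) (P := P)
  have h1 : ∀ X : Fin n → Fin p → ℝ, falsePositiveRate S (threshold f X) X =
      (∑ e ∈ nonEdges S, Set.indicator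
        {X : Fin n → Fin p → ℝ | threshold f X e.1 e.2 < |corrEstimator X e.1 e.2|} 1 X) /
        (nonEdges S).card := by
    intro X
    rw [falsePositiveRate]
    congr 1
    have h2 : edgesHat (threshold f X) X ∩ nonEdges S = (nonEdges S).filter
        fun e => threshold f X e.1 e.2 < |corrEstimator X e.1 e.2| := by
      ext e
      simp only [edgesHat, nonEdges, Finset.mem_inter, Finset.mem_filter, Finset.mem_univ, true_and]
      tauto
    rw [h2, Finset.card_filter]
    push_cast
    exact Finset.sum_congr rfl fun e _ => by
      simp only [Set.indicator_apply, Set.mem_ofPred_eq, Pi.one_apply]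
  simp_rw [h1]
  rw [integral_div, integral_finsetSum]
  · congr 1
    exact Finset.sum_congr rfl fun e _ => integral_indicator_one (measurableSet_threshold_lt f _ _)
  · exact fun e _ => (integrable_const (1 : ℝ)).indicator (measurableSet_threshold_lt f _ _)

open Classical in
/-- The false positive rate is controlled when few pairs of non-edges are correlated. -/
lemma integral_falsePositiveRate_le [IsProbabilityMeasure P] {f u ε c : ℝ} (hu : 0 ≤ u)
    (hε : 0 ≤ ε)
    (hgood : ∀ e ∈ nonEdges S, |S e.1 e.2| ≤ c → (sampleLaw P n).real
      {X | threshold f X e.1 e.2 < |corrEstimator X e.1 e.2|} ≤ u + ε)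
    (hbad : (((nonEdges S).filter fun e => c < |S e.1 e.2|).card : ℝ) ≤
      ε * (nonEdges S).card) :
    ∫ X, falsePositiveRate S (threshold f X) X ∂(sampleLaw P n) ≤ u + 2 * ε := by
  have := isProbabilityMeasure_sampleLaw (n := n) (P := P)
  rw [integral_falsePositiveRate]
  refine div_le_of_le_mul₀ (Nat.cast_nonneg _) (by positivity) ?_
  have h1 : ∀ e ∈ nonEdges S, (sampleLaw P n).real
      {X | threshold f X e.1 e.2 < |corrEstimator X e.1 e.2|} ≤
        (u + ε) + if c < |S e.1 e.2| then 1 else 0 := by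
    intro e he
    split_ifs with h
    · have : (sampleLaw P n).real
        {X | threshold f X e.1 e.2 < |corrEstimator X e.1 e.2|} ≤ 1 := measureReal_le_one
      linarith
    · rw [add_zero]
      exact hgood e he (not_lt.1 h)
  refine (Finset.sum_le_sum h1).trans ?_
  rw [Finset.sum_add_distrib, Finset.sum_const, nsmul_eq_mul, ← Finset.natCast_card_filter]
  linarith

/-- Bound for the number of correlated non-edges in terms of the spectrum. -/
lemma card_filter_nonEdges_le (hS : S.PosDef) (hd : ∀ j, S j j = 1) {M b c ε : ℝ}
    (hM : ∀ l ∈ spectrum ℝ S, l ≤ M) (hb : 0 < b) (hc : 0 < c) (hε : 0 < ε)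
    (hedge : ∀ e ∈ edges S, b ≤ |S e.1 e.2|)
    (hp : 1 + 2 * M * (1 / b ^ 2 + 1 / (ε * c ^ 2)) ≤ p)
    (s : Finset (Fin p × Fin p)) (hs : ∀ e ∈ s, c ≤ |S e.1 e.2|) :
    (s.card : ℝ) ≤ ε * (nonEdges S).card := by
  have h1 := card_mul_sq_le hS hd hM hb.le (edges S) hedge
  have h2 := card_mul_sq_le hS hd hM hc.le s hs
  have h3 := card_edges_add_card_nonEdges S
  have hp0 : (0 : ℝ) ≤ p := Nat.cast_nonneg _
  have h1' : ((edges S).card : ℝ) ≤ M * p * (1 / b ^ 2) := by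
    rw [mul_one_div, le_div_iff₀ (by positivity)]
    exact h1
  have h2' : (s.card : ℝ) ≤ ε * (M * p * (1 / (ε * c ^ 2))) := by
    rw [mul_one_div, ← mul_div_assoc, mul_div_mul_left _ _ hε.ne', le_div_iff₀ (by positivity)]
    exact h2
  refine h2'.trans (mul_le_mul_of_nonneg_left ?_ hε.le)
  -- Multiplied by `p`, the assumption on `p` says that `p (p - 1) / 2` exceeds the bound for the
  -- number of edges by `M p / (ε c²)`, which is therefore at most the number of non-edges.
  have h4 := mul_le_mul_of_nonneg_left hp hp0
  linarith

lemma card_nonEdges_le (S : Matrix (Fin p) (Fin p) ℝ) :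
    ((nonEdges S).card : ℝ) ≤ (p : ℝ) * (p - 1) / 2 := by
  rw [← card_edges_add_card_nonEdges S]
  exact le_add_of_nonneg_left (Nat.cast_nonneg _)

end FalsePositives

/-- The expected false positive rate is asymptotically controlled. -/
lemma eventually_integral_falsePositiveRate_le {C₁ κ C₃ ξ f₀ : ℝ} (hC₁ : 0 < C₁) (hκ : κ < 1 / 2)
    (hC₃ : 0 < C₃) (hξ : 0 < ξ) (hf₀ : 0 < f₀) {p : ℕ → ℕ}
    (hp : (fun n : ℕ => Real.log (p n)) ~[atTop] (fun n : ℕ => C₃ * (n : ℝ) ^ ξ))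
    {f : ℕ → ℝ} {S : ∀ n, Matrix (Fin (p n)) (Fin (p n)) ℝ} {ν : ℕ → Measure ℝ}
    {g : ∀ n, Fin (p n) → ℝ → ℝ} {P : ∀ n, Measure (Fin (p n) → ℝ)} {α C₂ : ℝ}
    (hf : ∀ n, f₀ ≤ f n) (hf' : ∀ᶠ n in atTop, f n < (p n : ℝ) * ((p n : ℝ) - 1) / 2)
    (hP : ∀ n, 3 ≤ n → IsTranselliptical (P n) (S n) (ν n) (g n))
    (hedge : ∀ n, 3 ≤ n → ∀ e ∈ edges (S n), C₁ * (n : ℝ) ^ (-κ) ≤ |S n e.1 e.2|)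
    (hC₂ : 0 < C₂) (hα : 0 ≤ α)
    (hM : ∀ n, 3 ≤ n → ∀ l ∈ spectrum ℝ (S n), l ≤ C₂ * (n : ℝ) ^ α) {ε : ℝ} (hε : 0 < ε) :
    ∀ᶠ n : ℕ in atTop, ∫ X, falsePositiveRate (S n) (threshold (f n) X) X ∂(sampleLaw (P n) n) ≤
      f n / ((nonEdges (S n)).card : ℝ) + ε := by
  classical
  obtain ⟨N, hN⟩ := exists_measureReal_threshold_lt_le (half_pos hε)
  filter_upwards [eventually_ge_atTop N, eventually_ge_atTop 3, hf',
    eventually_mul_rpow_le hC₃ hξ hp 3 0,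
    -- The cutoff `1 / n` contributes `n²` and the edge bound `n^(2κ) ≤ n²`; together with the
    -- spectral bound `n^α` this gives the exponent `α + 2`.
    eventually_mul_rpow_le hC₃ hξ hp (1 + 2 * C₂ * (1 / C₁ ^ 2 + 2 / ε)) (α + 2)]
    with n hnN hn3 hfn hp3 hpn
  have hn3' : (3 : ℝ) ≤ n := by exact_mod_cast hn3
  have hn0 : (0 : ℝ) < n := by linarith
  rw [Real.rpow_zero, mul_one] at hp3
  have hp3' : 3 ≤ p n := by exact_mod_cast hp3
  have hTE := hP n hn3
  have := hTE.isProbabilityMeasure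
  have hf0 : 0 < f n := hf₀.trans_le (hf n)
  have hpp : 0 < (p n : ℝ) * ((p n : ℝ) - 1) := mul_pos (by linarith) (by linarith)
  have hb : 0 < C₁ * (n : ℝ) ^ (-κ) := by positivity
  have hX : 1 ≤ (n : ℝ) ^ (α + 2) := Real.one_le_rpow (by linarith) (by linarith)
  have e1 : (n : ℝ) ^ α * (1 / (C₁ * (n : ℝ) ^ (-κ)) ^ 2) ≤ (n : ℝ) ^ (α + 2) * (1 / C₁ ^ 2) := by
    have h1 : (n : ℝ) ^ α * (1 / (C₁ * (n : ℝ) ^ (-κ)) ^ 2) =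
        (n : ℝ) ^ (α + 2 * κ) * (1 / C₁ ^ 2) := by
      rw [Real.rpow_add hn0, Real.rpow_neg hn0.le, two_mul, Real.rpow_add hn0]
      field_simp
    rw [h1]
    gcongr
    · linarith
    · linarith
  have e2 : (n : ℝ) ^ α * (1 / (ε / 2 * (1 / (n : ℝ)) ^ 2)) = (n : ℝ) ^ (α + 2) * (2 / ε) := by
    rw [Real.rpow_add hn0, Real.rpow_two]
    field_simp
  have hbad := card_filter_nonEdges_le (ε := ε / 2) (c := 1 / n) hTE.elliptical.posDef
    hTE.elliptical.diag_eq_one (hM n hn3) hb (by positivity) (by positivity) (hedge n hn3)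
    (by
      refine le_trans ?_ hpn
      have h2 : 2 * (C₂ * (n : ℝ) ^ α) * (1 / (C₁ * (n : ℝ) ^ (-κ)) ^ 2 +
          1 / (ε / 2 * (1 / (n : ℝ)) ^ 2)) ≤
          2 * C₂ * ((n : ℝ) ^ (α + 2) * (1 / C₁ ^ 2) + (n : ℝ) ^ (α + 2) * (2 / ε)) := by
        rw [mul_assoc 2 (C₂ * _), mul_assoc C₂, mul_add ((n : ℝ) ^ α), e2, ← mul_assoc 2 C₂]
        gcongr
      linarith)
    ((nonEdges (S n)).filter fun e => 1 / (n : ℝ) < |S n e.1 e.2|)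
    fun e he => (Finset.mem_filter.1 he).2.le
  have hmain := integral_falsePositiveRate_le (n := n) (P := P n) (S := S n) (f := f n)
    (u := 2 * (f n / ((p n : ℝ) * ((p n : ℝ) - 1)))) (ε := ε / 2) (c := 1 / n)
    (by positivity) (by positivity)
    (fun e he hS => hN n hnN (p n) (P n) (S n) (ν n) (g n) hTE hp3' e.1 e.2
      (by
        simp only [nonEdges, Finset.mem_filter] at he
        exact he.2.1.ne) hS (f n) hf0 hfn) hbad
  -- Without non-edges, both the rate and its bound are divisions by zero and take the value 0.
  rcases (Nat.cast_nonneg (α := ℝ) (nonEdges (S n)).card).eq_or_lt with h0 | h0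
  · rw [integral_falsePositiveRate, ← h0, div_zero, div_zero, zero_add]
    exact hε.le
  · refine hmain.trans ?_
    have h2 : 2 * (f n / ((p n : ℝ) * ((p n : ℝ) - 1))) ≤ f n / (nonEdges (S n)).card := by
      rw [← mul_div_assoc, div_le_div_iff₀ hpp h0]
      nlinarith [card_nonEdges_le (S n)]
    linarith

/-! ### Sure screening -/

section SureScreening

lemma IsKernel.jackknifeUStatVar_le {α : Type*} [MeasurableSpace α] {h : α → α → ℝ}
    (hh : IsKernel h) {n : ℕ} (hn : 3 ≤ n) (x : Fin n → α) : jackknifeUStatVar h x ≤ 10 ^ 2 := by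
  have hn' : (3 : ℝ) ≤ n := by exact_mod_cast hn
  have h1 : ∑ i, (leaveOneMean h x i - uStat h x) ^ 2 ≤ n * 4 := by
    refine (Finset.sum_le_card_nsmul _ _ 4 fun i _ => ?_).trans (by simp)
    have h2 := _root_.abs_le.1 (hh.abs_leaveOneMean_le hn x i)
    have h3 := _root_.abs_le.1 (hh.abs_uStat_le hn x)
    nlinarith
  -- The left side is `16 n (n - 1) / (n - 2)²`, which is largest at `n = 3`, with value 96.
  have h4 : 4 * ((n : ℝ) - 1) / ((n : ℝ) - 2) ^ 2 * (n * 4) ≤ 10 ^ 2 := by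
    rw [div_mul_eq_mul_div, div_le_iff₀ (pow_pos (by linarith) 2)]
    nlinarith
  refine le_trans ?_ h4
  rw [jackknifeUStatVar]
  exact mul_le_mul_of_nonneg_left h1
    (div_nonneg (mul_nonneg (by norm_num) (by linarith)) (sq_nonneg _))

variable {n p : ℕ} {P : Measure (Fin p → ℝ)} {S : Matrix (Fin p) (Fin p) ℝ} {ν : Measure ℝ}
  {g : Fin p → ℝ → ℝ}

lemma threshold_le (hn : 3 ≤ n) {f t : ℝ} (ht : 0 ≤ t)
    (hq : normalQuantile (1 - f / ((p : ℝ) * ((p : ℝ) - 1))) ≤ t) (X : Fin n → Fin p → ℝ)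
    (j k : Fin p) : threshold f X j k ≤ 5 * Real.pi * t / √n := by
  have hpi := Real.pi_pos
  have h1 : √(jackknifeVar X j k) ≤ 10 := by
    rw [jackknifeVar_eq]
    exact Real.sqrt_le_iff.2 ⟨by norm_num, (isKernel_kendallKernel j k).jackknifeUStatVar_le hn X⟩
  rw [threshold]
  refine div_le_div_of_nonneg_right ?_ (Real.sqrt_nonneg _)
  calc Real.pi / 2 * √(jackknifeVar X j k) * normalQuantile (1 - f / ((p : ℝ) * ((p : ℝ) - 1)))
      ≤ Real.pi / 2 * √(jackknifeVar X j k) * t := mul_le_mul_of_nonneg_left hq (by positivity)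
    _ ≤ Real.pi / 2 * 10 * t := by gcongr
    _ = 5 * Real.pi * t := by ring

/-- The assumption gives `f / (p (p - 1)) ≥ exp (-t² / 2)`, and the latter dominates the upper
normal tail at `t`. -/
lemma normalQuantile_le_of_sq_mul_exp_le {f f₀ t : ℝ} (hf₀ : 0 < f₀) (hf : f₀ ≤ f) (hp : 2 ≤ p)
    (ht : 0 ≤ t) (h : (p : ℝ) ^ 2 * Real.exp (-(t ^ 2 / 2)) ≤ f₀) :
    normalQuantile (1 - f / ((p : ℝ) * ((p : ℝ) - 1))) ≤ t := by
  have hp' : (2 : ℝ) ≤ p := by exact_mod_cast hp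
  have hpp : 0 < (p : ℝ) * ((p : ℝ) - 1) := mul_pos (by linarith) (by linarith)
  refine normalQuantile_le ht ((sub_le_sub_left ?_ 1).trans (one_sub_exp_le_cdf ht))
  rw [le_div_iff₀ hpp]
  nlinarith [Real.exp_pos (-(t ^ 2 / 2))]

/-- The correlation estimators are uniformly close to their targets with high probability. -/
lemma IsTranselliptical.measureReal_exists_corrEstimator_lt_le (hP : IsTranselliptical P S ν g)
    (hn : 3 ≤ n) {t : ℝ} (ht : 0 ≤ t) :
    (sampleLaw P n).real {X | ∃ j k, j ≠ k ∧ |corrEstimator X j k| < |S j k| - Real.pi / 2 * t} ≤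
      (p : ℝ) ^ 2 * (2 * Real.exp (-(n * t ^ 2 / 72))) := by
  have := hP.isProbabilityMeasure
  have := isProbabilityMeasure_sampleLaw (n := n) (P := P)
  have hpi := Real.pi_pos
  have hsub : {X : Fin n → Fin p → ℝ |
      ∃ j k, j ≠ k ∧ |corrEstimator X j k| < |S j k| - Real.pi / 2 * t} ⊆
      ⋃ e ∈ (Finset.univ : Finset (Fin p × Fin p)),
        {X | t ≤ |uStat (kendallKernel e.1 e.2) X - kernelMean P (kendallKernel e.1 e.2)|} := by
    intro X hX
    simp only [Set.mem_ofPred_eq] at hX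
    obtain ⟨j, k, hjk, h⟩ := hX
    simp only [Set.mem_iUnion, Set.mem_ofPred_eq]
    refine ⟨(j, k), Finset.mem_univ _, ?_⟩
    rw [corrEstimator, if_neg hjk, kendallTau_eq_uStat, ← hP.abs_sin_kernelMean] at h
    have h1 := abs_sub_abs_le_abs_sub (Real.sin (Real.pi / 2 * kernelMean P (kendallKernel j k)))
      (Real.sin (Real.pi / 2 * uStat (kendallKernel j k) X))
    -- The sine is 1-Lipschitz, so the error of the correlation estimator is at most `π / 2` times
    -- that of Kendall's tau.
    have h2 := Real.abs_sin_sub_sin_le (Real.pi / 2 * uStat (kendallKernel j k) X)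
      (Real.pi / 2 * kernelMean P (kendallKernel j k))
    rw [← mul_sub, abs_mul, abs_of_pos (by positivity : 0 < Real.pi / 2)] at h2
    rw [abs_sub_comm] at h1
    have h3 : Real.pi / 2 * t <
      Real.pi / 2 * |uStat (kendallKernel j k) X - kernelMean P (kendallKernel j k)| := by linarith
    exact (lt_of_mul_lt_mul_left h3 (by positivity)).le
  refine (measureReal_mono hsub (measure_ne_top _ _)).trans
    ((measureReal_biUnion_finset_le _ _).trans ?_)
  refine (Finset.sum_le_card_nsmul _ _ (2 * Real.exp (-(n * t ^ 2 / 72))) fun e _ =>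
    (isKernel_kendallKernel e.1 e.2).measureReal_abs_uStat_ge_le hn ht).trans_eq ?_
  simp [sq]

/-- All correlations that exceed `b` are selected with high probability. -/
lemma IsTranselliptical.one_sub_le_measureReal_selected (hP : IsTranselliptical P S ν g)
    (hn : 3 ≤ n) {f b : ℝ} (hb : 0 ≤ b)
    (hγ : ∀ (X : Fin n → Fin p → ℝ) (j k : Fin p), j ≠ k → threshold f X j k < b / 2) :
    1 - (p : ℝ) ^ 2 * (2 * Real.exp (-(n * (b / Real.pi) ^ 2 / 72))) ≤ (sampleLaw P n).real
      {X | ∀ j k, j ≠ k → b ≤ |S j k| → threshold f X j k < |corrEstimator X j k|} := by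
  have := hP.isProbabilityMeasure
  have := isProbabilityMeasure_sampleLaw (n := n) (P := P)
  have hpi := Real.pi_pos
  have h1 := hP.measureReal_exists_corrEstimator_lt_le hn (t := b / Real.pi) (by positivity)
  have h2 : Real.pi / 2 * (b / Real.pi) = b / 2 := by field_simp
  rw [h2] at h1
  have h3 : (1 : ℝ) ≤ (sampleLaw P n).real
      {X | ∀ j k, j ≠ k → b ≤ |S j k| → threshold f X j k < |corrEstimator X j k|} +
      (sampleLaw P n).real {X | ∃ j k, j ≠ k ∧ |corrEstimator X j k| < |S j k| - b / 2} := by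
    rw [← probReal_univ (μ := sampleLaw P n)]
    refine (measureReal_mono fun X _ => ?_).trans (measureReal_union_le _ _)
    by_cases h : ∃ j k, j ≠ k ∧ |corrEstimator X j k| < |S j k| - b / 2
    · exact Or.inr (by simpa only [Set.mem_ofPred_eq] using h)
    · left
      simp only [Set.mem_ofPred_eq]
      intro j k hjk hS
      push Not at h
      linarith [h j k hjk, hγ X j k hjk]
  linarith

/-- Edges are recorded only for `j < k`; symmetry of `S` and of its inverse removes the restriction,
as neighborhoods require. -/
lemma le_abs_of_inv_ne_zero (hS : S.PosDef) {b : ℝ} (hedge : ∀ e ∈ edges S, b ≤ |S e.1 e.2|)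
    {j k : Fin p} (hjk : j ≠ k) (h : S⁻¹ j k ≠ 0) : b ≤ |S j k| := by
  have hsym : ∀ j k, S k j = S j k := fun j k => by simpa using hS.isHermitian.apply j k
  have hsym' : ∀ j k, S⁻¹ k j = S⁻¹ j k := fun j k => by
    simpa using hS.isHermitian.inv.apply j k
  rcases lt_or_gt_of_ne hjk with hlt | hlt
  · exact hedge (j, k) (by simp [edges, hlt, h])
  · rw [← hsym]
    exact hedge (k, j) (by simp [edges, hlt, hsym', h])

end SureScreening

/-- Sure screening of all pairs with a nonzero partial correlation. -/
lemma exists_sureScreening {C₁ κ C₃ ξ f₀ : ℝ} (hC₁ : 0 < C₁) (hκ' : κ < 1 / 2)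
    (hC₃ : 0 < C₃) (hξ' : ξ < 1 - 2 * κ) (hf₀ : 0 < f₀) {p : ℕ → ℕ}
    (hp : (fun n : ℕ => Real.log (p n)) ~[atTop] (fun n : ℕ => C₃ * (n : ℝ) ^ ξ)) :
    ∃ C₄ : ℝ, 0 < C₄ ∧ ∃ C₅ : ℝ, 0 < C₅ ∧ ∀ n, 3 ≤ n →
      ∀ (P : Measure (Fin (p n) → ℝ)) (S : Matrix (Fin (p n)) (Fin (p n)) ℝ) (ν : Measure ℝ)
        (g : Fin (p n) → ℝ → ℝ) (f : ℝ), IsTranselliptical P S ν g → f₀ ≤ f →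
        (∀ e ∈ edges S, C₁ * (n : ℝ) ^ (-κ) ≤ |S e.1 e.2|) →
        1 - C₄ * Real.exp (-C₅ * (n : ℝ) ^ (1 - 2 * κ)) ≤ (sampleLaw P n).real
          {X | ∀ j k, j ≠ k → S⁻¹ j k ≠ 0 → threshold f X j k < |corrEstimator X j k|} := by
  have hpi := Real.pi_pos
  have hβ : 0 < 1 - 2 * κ := by linarith
  set β := 1 - 2 * κ with hβ_def
  -- Hoeffding's inequality at `t = C₁ n^(-κ) / π` has exponent `C₁² n^β / (72 π²) = 2 C₅ n^β`, one
  -- half being kept to absorb `p²`. The choice of `c` turns the threshold bound `5 π c n^(β/2) /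
  -- √n` into `C₁ n^(-κ) / 4`.
  set C₅ := C₁ ^ 2 / (144 * Real.pi ^ 2) with hC₅
  set c := C₁ / (20 * Real.pi) with hc
  have hC₅0 : 0 < C₅ := by positivity
  have hc0 : 0 < c := by positivity
  obtain ⟨N, hN⟩ := eventually_atTop.1
    ((eventually_sq_mul_exp_le hC₃ hξ' hβ hp hC₅0 one_pos).and
      (eventually_sq_mul_exp_le hC₃ hξ' hβ hp (c := c ^ 2 / 2) (by positivity) hf₀))
  -- For `n < N` this constant makes the claimed lower bound negative; for `n ≥ N` a factor 2 is
  -- enough.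
  refine ⟨2 * Real.exp (C₅ * (N : ℝ) ^ β), by positivity, C₅, hC₅0,
    fun n hn P S ν g f hP hf hedge => ?_⟩
  have hPp := hP.isProbabilityMeasure
  have := isProbabilityMeasure_sampleLaw (n := n) (P := P)
  have hn' : (3 : ℝ) ≤ n := by exact_mod_cast hn
  have hn0 : (0 : ℝ) < n := by linarith
  rcases lt_or_ge n N with hnN | hnN
  · have h1 : (n : ℝ) ^ β ≤ (N : ℝ) ^ β :=
      Real.rpow_le_rpow hn0.le (by exact_mod_cast hnN.le) hβ.le
    have h2 : 1 ≤ Real.exp (C₅ * (N : ℝ) ^ β) * Real.exp (-C₅ * (n : ℝ) ^ β) := by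
      rw [← Real.exp_add]
      exact Real.one_le_exp (by nlinarith)
    refine le_trans ?_ measureReal_nonneg
    linarith
  obtain ⟨h1, h2⟩ := hN n hnN
  have hsq : ((n : ℝ) ^ (β / 2)) ^ 2 = (n : ℝ) ^ β := by
    rw [← Real.rpow_natCast, ← Real.rpow_mul hn0.le]
    congr 1
    push_cast
    ring
  have hb0 : 0 < C₁ * (n : ℝ) ^ (-κ) := by positivity
  have hγ : ∀ (X : Fin n → Fin (p n) → ℝ) (j k : Fin (p n)), j ≠ k →
      threshold f X j k < C₁ * (n : ℝ) ^ (-κ) / 2 := by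
    intro X j k hjk
    -- Two distinct indices exist, so the denominator `p (p - 1)` does not vanish.
    have hp2 : 2 ≤ p n := by
      by_contra! h
      exact hjk (Fin.ext (by omega))
    have ht : 0 ≤ c * (n : ℝ) ^ (β / 2) := by positivity
    refine (threshold_le hn ht
      (normalQuantile_le_of_sq_mul_exp_le hf₀ hf hp2 ht ?_) X j k).trans_lt ?_
    · rw [mul_pow, hsq, mul_div_right_comm]
      exact h2
    · have e1 : (n : ℝ) ^ (β / 2) / √n = (n : ℝ) ^ (-κ) := by
        rw [Real.sqrt_eq_rpow, ← Real.rpow_sub hn0, hβ_def]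
        congr 1
        ring
      have e2 : 5 * Real.pi * (c * (n : ℝ) ^ (β / 2)) / √n = C₁ * (n : ℝ) ^ (-κ) / 4 := by
        rw [← e1, hc]
        field_simp
        ring
      rw [e2]
      linarith
  have hmain := hP.one_sub_le_measureReal_selected hn hb0.le hγ
  have hexp : (n : ℝ) * (C₁ * (n : ℝ) ^ (-κ) / Real.pi) ^ 2 / 72 =
      C₅ * (n : ℝ) ^ β + C₅ * (n : ℝ) ^ β := by
    have e1 : (n : ℝ) ^ β = n * ((n : ℝ) ^ (-κ)) ^ 2 := by
      rw [← Real.rpow_natCast, ← Real.rpow_mul hn0.le, ← Real.rpow_one_add' hn0.le]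
      · congr 1
        rw [hβ_def]
        push_cast
        ring
      · push_cast
        linarith
    rw [e1, hC₅]
    field_simp
    ring
  rw [hexp, neg_add, Real.exp_add] at hmain
  have hN1 : 1 ≤ Real.exp (C₅ * (N : ℝ) ^ β) := Real.one_le_exp (by positivity)
  have he := Real.exp_pos (-(C₅ * (n : ℝ) ^ β))
  refine le_trans ?_ (hmain.trans (measureReal_mono fun X hX => ?_))
  · rw [neg_mul]
    have h3 : (p n : ℝ) ^ 2 * (2 * (Real.exp (-(C₅ * (n : ℝ) ^ β)) *
        Real.exp (-(C₅ * (n : ℝ) ^ β)))) ≤ 2 * Real.exp (-(C₅ * (n : ℝ) ^ β)) := by nlinarith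
    nlinarith
  · simp only [Set.mem_ofPred_eq] at hX ⊢
    exact fun j k hjk h => hX j k hjk (le_abs_of_inv_ne_zero hP.elliptical.posDef hedge hjk h)

end Grass

end

/-! ### Assembly of the theorem. -/

theorem theorem3
    (C₁ κ C₃ ξ f₀ : ℝ) (hC₁ : 0 < C₁) (hκ : 0 < κ) (hκ' : κ < 1 / 2)
    (hC₃ : 0 < C₃) (hξ : 0 < ξ) (hξ' : ξ < 1 - 2 * κ) (hf₀ : 0 < f₀)
    -- the dimension: `log p = C₃ n^ξ`, up to the rounding of `p` to an integer
    (p : ℕ → ℕ)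
    (hp : (fun n : ℕ => Real.log (p n)) ~[atTop] (fun n : ℕ => C₃ * (n : ℝ) ^ ξ)) :
    ∃ C₄ : ℝ, 0 < C₄ ∧ ∃ C₅ : ℝ, 0 < C₅ ∧
      ∀ (f : ℕ → ℝ) (S : ∀ n, Matrix (Fin (p n)) (Fin (p n)) ℝ) (ν : ℕ → Measure ℝ)
        (g : ∀ n, Fin (p n) → ℝ → ℝ) (P : ∀ n, Measure (Fin (p n) → ℝ)) (α C₂ : ℝ),
        (∀ n, f₀ ≤ f n) →
        (∀ᶠ n in atTop, f n < (p n : ℝ) * ((p n : ℝ) - 1) / 2) →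
        (∀ n, 3 ≤ n → Grass.IsTranselliptical (P n) (S n) (ν n) (g n)) →
        -- Lower bound for the correlations over the edges
        (∀ n, 3 ≤ n → ∀ e ∈ Grass.edges (S n), C₁ * (n : ℝ) ^ (-κ) ≤ |S n e.1 e.2|) →
        -- Upper bound for the largest eigenvalue
        0 ≤ α → 0 < C₂ →
        (∀ n, 3 ≤ n → ∀ l ∈ spectrum ℝ (S n), l ≤ C₂ * (n : ℝ) ^ α) →
        -- The largest correlation over the non-edges is of smaller order than `n^(-(1-ξ)/2)`
        (∀ ε > 0, ∀ᶠ n : ℕ in atTop, ∀ e ∈ Grass.nonEdges (S n),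
          |S n e.1 e.2| ≤ ε * (n : ℝ) ^ (-((1 - ξ) / 2))) →
        -- Asymptotic control of the expected false positive rate
        (∀ ε > 0, ∀ᶠ n : ℕ in atTop,
          ∫ X, Grass.falsePositiveRate (S n) (Grass.threshold (f n) X) X
              ∂(Grass.sampleLaw (P n) n)
            ≤ f n / ((Grass.nonEdges (S n)).card : ℝ) + ε) ∧
        -- Sure screening, for the edge set and for the neighborhoods
        (∀ n : ℕ, 3 ≤ n →
          1 - C₄ * Real.exp (-C₅ * (n : ℝ) ^ (1 - 2 * κ)) ≤
            (Grass.sampleLaw (P n) n).real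
              {X | Grass.edges (S n) ⊆ Grass.edgesHat (Grass.threshold (f n) X) X}) ∧
        (∀ n : ℕ, 3 ≤ n → ∀ j,
          1 - C₄ * Real.exp (-C₅ * (n : ℝ) ^ (1 - 2 * κ)) ≤
            (Grass.sampleLaw (P n) n).real
              {X | Grass.neighborhood (S n) j ⊆
                Grass.neighborhoodHat (Grass.threshold (f n) X) X j}) := by
  -- A single event, on which every pair with a nonzero partial correlation passes its threshold in
  -- either order of the indices, lies in the screening events of the edge set and of every
  -- neighborhood.
  obtain ⟨C₄, hC₄, C₅, hC₅, hscreen⟩ := Grass.exists_sureScreening hC₁ hκ' hC₃ hξ' hf₀ hp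
  refine ⟨C₄, hC₄, C₅, hC₅, fun f S ν g P α C₂ hf hf' hP hedge hα hC₂ hM _ => ⟨fun ε hε =>
    Grass.eventually_integral_falsePositiveRate_le hC₁ hκ' hC₃ hξ hf₀ hp hf hf' hP hedge hC₂ hα hM
      hε, fun n hn => ?_, fun n hn j => ?_⟩⟩
  · have := (hP n hn).isProbabilityMeasure
    have := Grass.isProbabilityMeasure_sampleLaw (n := n) (P := P n)
    refine (hscreen n hn (P n) (S n) (ν n) (g n) (f n) (hP n hn) (hf n) (hedge n hn)).trans
      (measureReal_mono fun X hX => ?_)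
    simp only [Set.mem_ofPred_eq] at hX ⊢
    intro e he
    simp only [Grass.edges, Grass.edgesHat, Finset.mem_filter, Finset.mem_univ, true_and] at he ⊢
    exact ⟨he.1, hX e.1 e.2 he.1.ne he.2⟩
  · have := (hP n hn).isProbabilityMeasure
    have := Grass.isProbabilityMeasure_sampleLaw (n := n) (P := P n)
    refine (hscreen n hn (P n) (S n) (ν n) (g n) (f n) (hP n hn) (hf n) (hedge n hn)).trans
      (measureReal_mono fun X hX => ?_)
    simp only [Set.mem_ofPred_eq] at hX ⊢
    intro k hk
    simp only [Grass.neighborhood, Grass.neighborhoodHat, Finset.mem_filter, Finset.mem_univ,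
      true_and] at hk ⊢
    exact ⟨hk.1, hX j k hk.1.symm hk.2⟩
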